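/- Let $k$ be a field, $Q$ a quiver (not necessarily finite), $\rho$ a set of paths of length $\ge 2$ in $Q$, and $\Lambda = kQ/(\rho)$ a string algebra: every vertex is the head of at most two arrows and the tail of at most two arrows, and for every arrow $y$ there is at most one path $xy$ of length $2$ with $xy\notin\rho$ and at most one path $yz$ of length $2$ with $yz\notin\rho$. (In a path $x_1x_2\cdots x_m$ the tail of $x_i$ is the head of $x_{i+1}$.) Modules are left $\Lambda$-modules $M$ with $\Lambda M = M$; thus $M=\bigoplus_v e_vM$, where $e_v$ is the trivial path at the vertex $v$. A module $M$ is *finitely controlled* if for every $a\in\Lambda$ the set $aM$ is contained in a finitely generated submodule of $M$. *Words.* A letter is an arrow $x$ (direct) or its formal inverse $x^{-1}$ (inverse), whose head is the tail of $x$ and whose tail is the head of $x$. Let $I$ be $\{0,\dots,n\}$ ($n\ge 0$), $\mathbb N$, $-\mathbb N$ or $\mathbb Z$. An $I$-word $C$ consists of letters $C_i$ for all $i$ with $i,i-1\in I$, such that for consecutive letters the tail of $C_i$ is the head of $C_{i+1}$ and $C_i^{-1}\ne C_{i+1}$, and such that no $x_1\cdots x_m\in\rho$ and no inverse $x_m^{-1}\cdots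 x_1^{-1}$ of it occurs as a sequence of consecutive letters of $C$; for $I=\{0\}$ it consists of a vertex. It has vertices $v_i(C)$ $(i\in I)$, where $v_i(C)$ is the tail of $C_i$ or the head of $C_{i+1}$. For $i\in I$ put $C_{>i}=C_{i+1}C_{i+2}\cdots$ and $(C_{\le i})^{-1}=C_i^{-1}C_{i-1}^{-1}\cdots$. *String and band modules.* The string module $M(C)$ has $k$-basis $b_i$ $(i\in I)$, with $e_vb_i=b_i$ if $v_i(C)=v$ and $e_vb_i=0$ otherwise, and, for an arrow $x$, $xb_i=b_{i-1}$ if $C_i=x$, $xb_i=b_{i+1}$ if $C_{i+1}=x^{-1}$, and $xb_i=0$ otherwise. If $C$ is a periodic $\mathbb Z$-word of (minimal) period $n$, then $M(C)$ is a $\Lambda$-$k[T,T^{-1}]$-bimodule with $T$ acting by $b_i\mapsto b_{i-n}$, and for a $k[T,T^{-1}]$-module $V$ one puts $M(C,V)=M(C)\otimes_{k[T,T^{-1}]}V$. The band modules are the $M(C,V)$ with $V$ finite-dimensional and indecomposable. *Primitive cycles and primitive torsion.* A primitive cycle $P$ is a non-trivial path from a vertex to itself such that ${}^\infty P^\infty=\cdots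 P\,|\,PP\cdots$ is a periodic $\mathbb Z$-word of period equal to the length of $P$. Let $z_v\in\Lambda$ be the sum of the (at most two) primitive cycles with head $v$; the polynomial ring $k[z]$ acts on a module $M$, with $z$ acting as $z_v$ on $e_vM$. Put $\tau^1(M)=\{m\in M: f(z)m=0 \text{ for some } f\in k[z] \text{ with } f(0)=1\}$. A primitive simple is a simple module $S$ with $\tau^1(S)=S$. *$P$-peaks.* Let $P$ be a primitive cycle and $C$ an $I$-word. An index $i\in I$ is a $P$-peak for $C$ if one of the two words $C_{>i}$ and $(C_{\le i})^{-1}$ is equal to $(P^{-1})^\infty=P^{-1}P^{-1}\cdots$, and the other one is not of the form $PD$ with a word $D$. **Theorem.** Let $S$ be a primitive simple, $M$ a finitely controlled $\Lambda$-module, and $N$ a submodule of $M$ with $\tau^1(M)\subseteq N$ and $M/N\cong S$. Suppose that $N=\bigoplus_{\lambda\in\Phi}N_\lambda$, where every $N_\lambda$ is a submodule isomorphic to a string module or a band module. Then $S\cong M({}^\infty P^\infty,V)$ for some primitive cycle $P$ and some simple $k[T,T^{-1}]$-module $V$. Moreover, for every primitive cycle $P$ for which such a $V$ exists, there are $\mu\in\Phi$,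 a word $C$ which has a $P$-peak and satisfies $N_\mu\cong M(C)$, and a submodule $N'_\mu$ of $M$ with $N'_\mu\cong N_\mu$, such that $$M = N'_\mu\oplus N',\qquad N'=\bigoplus_{\lambda\in\Phi\smallsetminus\{\mu\}}N_\lambda .$$ -/

import Mathlib

noncomputable section

open scoped Classical

namespace StringAlg

universe u v w

/-! ### Quivers and paths

An arrow `x : a ⟶ b` has tail `a` and head `b`. Paths are written as in `x₁ x₂ ⋯ xₘ`, where the
tail of `xᵢ` is the head of `xᵢ₊₁`; so the leftmost arrow is the last one that is traversed. -/

/-- The arrows of the quiver `Q`. -/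
abbrev Arrow (Q : Type v) [Quiver.{w} Q] := Quiver.Total Q

/-- The paths of the quiver `Q` (including the trivial ones). -/
structure QPath (Q : Type v) [Quiver.{w} Q] where
  tail : Q
  head : Q
  path : Quiver.Path tail head

section Paths

variable {Q : Type v} [Quiver.{w} Q]

/-- The list `[x₁, …, xₘ]` of the arrows of a path `x₁ ⋯ xₘ`. -/
def arrows {a b : Q} : Quiver.Path a b → List (Arrow Q)
  | .nil => []
  | .cons p x => ⟨_, _, x⟩ :: arrows p

theorem length_arrows {a b : Q} (p : Quiver.Path a b) : (arrows p).length = p.length := by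
  induction p with
  | nil => rfl
  | cons p x ih => simp [arrows, ih]

/-- The product `p q` (first `q`, then `p`) of two paths, if the tail of `p` is the head of `q`. -/
def QPath.mul? (p q : QPath Q) : Option (QPath Q) :=
  if h : p.tail = q.head then some ⟨q.tail, p.head, q.path.comp (p.path.cast h rfl)⟩ else none

/-- The trivial path at a vertex. -/
def QPath.triv (a : Q) : QPath Q := ⟨a, a, .nil⟩

/-- An arrow as a path of length one. -/
def QPath.ofArrow (x : Arrow Q) : QPath Q := ⟨x.left, x.right, x.hom.toPath⟩

/-- `kQ/(ρ)` is a string algebra: `ρ` is a set of paths of length `≥ 2`, and conditions (a) and (b)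
in the definition of a string algebra hold. -/
structure IsString (ρ : Set (QPath Q)) : Prop where
  two_le : ∀ p ∈ ρ, 2 ≤ p.path.length
  heads : ∀ a : Q, {x : Arrow Q | x.right = a}.encard ≤ 2
  tails : ∀ a : Q, {x : Arrow Q | x.left = a}.encard ≤ 2
  left_unique : ∀ {a b : Q} (y : a ⟶ b),
    {p : QPath Q | p ∉ ρ ∧ ∃ (c : Q) (x : b ⟶ c), p = ⟨a, c, y.toPath.cons x⟩}.Subsingleton
  right_unique : ∀ {a b : Q} (y : a ⟶ b),
    {p : QPath Q | p ∉ ρ ∧ ∃ (c : Q) (z : c ⟶ a), p = ⟨c, b, z.toPath.cons y⟩}.Subsingleton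

end Paths

/-! ### The path algebra `kQ` (without a unit in general) -/

/-- The path algebra: the vector space with basis the paths of `Q`. -/
def PathAlgebra (k : Type u) (Q : Type v) [Field k] [Quiver.{w} Q] := QPath Q →₀ k

section PathAlgebra

variable {k : Type u} {Q : Type v} [Field k] [Quiver.{w} Q]

instance : AddCommGroup (PathAlgebra k Q) := inferInstanceAs (AddCommGroup (QPath Q →₀ k))

instance : Module k (PathAlgebra k Q) := inferInstanceAs (Module k (QPath Q →₀ k))

/-- A path, as an element of the path algebra. -/
def PathAlgebra.of (k : Type u) [Field k] (p : QPath Q) : PathAlgebra k Q := Finsupp.single p 1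

/-- The product of two paths in the path algebra. -/
def PathAlgebra.pathMul (k : Type u) [Field k] (p q : QPath Q) : PathAlgebra k Q :=
  (p.mul? q).elim 0 (PathAlgebra.of k)

/-- The linear map on the path algebra with given values on paths. -/
def PathAlgebra.lin {A : Type*} [AddCommGroup A] [Module k A] (f : QPath Q → A) :
    PathAlgebra k Q →ₗ[k] A :=
  Finsupp.linearCombination k f

@[simp] theorem PathAlgebra.lin_of {A : Type*} [AddCommGroup A] [Module k A] (f : QPath Q → A)
    (p : QPath Q) : PathAlgebra.lin f (PathAlgebra.of k p) = f p :=
  (Finsupp.linearCombination_single k 1 p).trans (one_smul k (f p))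

theorem PathAlgebra.hom_ext {A : Type*} [AddCommGroup A] [Module k A]
    {f g : PathAlgebra k Q →ₗ[k] A}
    (h : ∀ p, f (PathAlgebra.of k p) = g (PathAlgebra.of k p)) : f = g :=
  Finsupp.lhom_ext' fun p => LinearMap.ext_ring (h p)

theorem PathAlgebra.induction {P : PathAlgebra k Q → Prop} (h0 : P 0)
    (hadd : ∀ a b, P a → P b → P (a + b)) (hof : ∀ (t : k) p, P (t • PathAlgebra.of k p))
    (a : PathAlgebra k Q) : P a :=
  Finsupp.induction_linear a h0 hadd fun p t => by
    have h3 : t • PathAlgebra.of k p = Finsupp.single p t := Finsupp.smul_single_one p t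
    exact h3 ▸ hof t p

/-- The multiplication of the path algebra, as a bilinear map. -/
def PathAlgebra.mulₗ : PathAlgebra k Q →ₗ[k] PathAlgebra k Q →ₗ[k] PathAlgebra k Q :=
  PathAlgebra.lin fun p => PathAlgebra.lin fun q => PathAlgebra.pathMul k p q

instance : Mul (PathAlgebra k Q) := ⟨fun a b => PathAlgebra.mulₗ a b⟩

theorem PathAlgebra.mul_def (a b : PathAlgebra k Q) : a * b = PathAlgebra.mulₗ a b := rfl

theorem PathAlgebra.of_mul_of (p q : QPath Q) :
    PathAlgebra.of k p * PathAlgebra.of k q = PathAlgebra.pathMul k p q := by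
  simp [PathAlgebra.mul_def, PathAlgebra.mulₗ]

theorem PathAlgebra.of_mul_of_assoc (p q r : QPath Q) :
    PathAlgebra.of k p * PathAlgebra.of k q * PathAlgebra.of k r =
      PathAlgebra.of k p * (PathAlgebra.of k q * PathAlgebra.of k r) := by
  obtain ⟨a, b, p⟩ := p
  obtain ⟨c, d, q⟩ := q
  obtain ⟨e, f, r⟩ := r
  have h0 : ∀ a : PathAlgebra k Q, 0 * a = 0 := fun a => by simp [PathAlgebra.mul_def]
  have h1 : ∀ a : PathAlgebra k Q, a * 0 = 0 := fun a => by simp [PathAlgebra.mul_def]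
  by_cases h : a = d <;> by_cases h' : c = f
  · subst h h'
    simp [PathAlgebra.of_mul_of, PathAlgebra.pathMul, QPath.mul?]
  · subst h
    simp [PathAlgebra.of_mul_of, PathAlgebra.pathMul, QPath.mul?, h', h1]
  · subst h'
    simp [PathAlgebra.of_mul_of, PathAlgebra.pathMul, QPath.mul?, h, h0]
  · simp [PathAlgebra.of_mul_of, PathAlgebra.pathMul, QPath.mul?, h, h', h0, h1]

instance : NonUnitalRing (PathAlgebra k Q) where
  left_distrib a b c := by simp [PathAlgebra.mul_def]
  right_distrib a b c := by simp [PathAlgebra.mul_def]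
  zero_mul a := by simp [PathAlgebra.mul_def]
  mul_zero a := by simp [PathAlgebra.mul_def]
  mul_assoc a b c := by
    let m := PathAlgebra.mulₗ (k := k) (Q := Q)
    have h : (LinearMap.compr₂ m m) =
        ((LinearMap.llcomp k _ _ _).compl₁₂ m LinearMap.id |>.flip.comp m).flip := by
      refine PathAlgebra.hom_ext fun p => PathAlgebra.hom_ext fun q => PathAlgebra.hom_ext fun r => ?_
      exact PathAlgebra.of_mul_of_assoc (k := k) p q r
    exact congrArg (fun f => f a b c) h

instance : IsScalarTower k (PathAlgebra k Q) (PathAlgebra k Q) :=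
  ⟨fun t a b => by simp [PathAlgebra.mul_def]⟩

instance : SMulCommClass k (PathAlgebra k Q) (PathAlgebra k Q) :=
  ⟨fun t a b => by simp [PathAlgebra.mul_def]⟩

end PathAlgebra
/-! ### The algebra `Λ = kQ/(ρ)` and its modules

`Λ` has no unit if `Q` has infinitely many vertices. Modules over `Λ` (as a `k`-algebra that may
lack a unit) are the same as modules over the unital algebra `k ⊕ Λ = (k ⊕ kQ)/(ρ)`. -/

section Alg

variable {Q : Type v} [Quiver.{w} Q]

/-- The generators of the ideal `(ρ)`. -/
inductive ZeroRel (k : Type u) [Field k] (ρ : Set (QPath Q)) :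
    Unitization k (PathAlgebra k Q) → Unitization k (PathAlgebra k Q) → Prop
  | mk (p : QPath Q) (hp : p ∈ ρ) :
      ZeroRel k ρ (Unitization.inr (PathAlgebra.of k p)) 0

/-- The algebra `k ⊕ Λ`, where `Λ = kQ/(ρ)`. -/
def UAlg (k : Type u) [Field k] (ρ : Set (QPath Q)) := RingQuot (ZeroRel k ρ)

variable (k : Type u) [Field k] (ρ : Set (QPath Q))

instance : Ring (UAlg k ρ) := inferInstanceAs (Ring (RingQuot (ZeroRel k ρ)))

instance : Algebra k (UAlg k ρ) := inferInstanceAs (Algebra k (RingQuot (ZeroRel k ρ)))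

/-- The quotient map `k ⊕ kQ → k ⊕ Λ`. -/
def UAlg.mk : Unitization k (PathAlgebra k Q) →ₐ[k] UAlg k ρ := RingQuot.mkAlgHom k (ZeroRel k ρ)

/-- The subset `Λ` of `k ⊕ Λ`: the image of `kQ`. -/
def Lam : Set (UAlg k ρ) := Set.range fun a : PathAlgebra k Q => UAlg.mk k ρ (Unitization.inr a)

/-- A path, as an element of `Λ`. -/
def pathElt (p : QPath Q) : UAlg k ρ := UAlg.mk k ρ (Unitization.inr (PathAlgebra.of k p))

/-- The idempotent `e_a` of `Λ` at the vertex `a`. -/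
def idem (a : Q) : UAlg k ρ := pathElt k ρ (QPath.triv a)

/-- An arrow, as an element of `Λ`. -/
def arrowElt (x : Arrow Q) : UAlg k ρ := pathElt k ρ (QPath.ofArrow x)

section Modules

variable (M : Type*) [AddCommGroup M] [Module (UAlg k ρ) M]

/-- `M` is a unital `Λ`-module: `Λ M = M`. -/
def IsUnital : Prop :=
  Submodule.span (UAlg k ρ) {y : M | ∃ a ∈ Lam k ρ, ∃ m : M, y = a • m} = ⊤

/-- `M` is finitely controlled: for every `a ∈ Λ`, the set `a M` is contained in a finitely
generated submodule of `M`. -/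
def IsFinitelyControlled : Prop :=
  ∀ a ∈ Lam k ρ, ∃ F : Submodule (UAlg k ρ) M, F.FG ∧ ∀ m : M, a • m ∈ F

end Modules

/-! #### Modules given by the action of the vertices and arrows -/

variable {k}
variable {A : Type*} [Ring A] [Algebra k A] (e : Q → A) (f : Arrow Q → A)

/-- The product `f x₁ ⋯ f xₘ` for a path `x₁ ⋯ xₘ`, and `e a` for the trivial path at `a`. -/
def evalPath {a : Q} : {b : Q} → Quiver.Path a b → A
  | _, .nil => e a
  | _, .cons p x => f ⟨_, _, x⟩ * evalPath p

variable {e f}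

theorem evalPath_comp (he : ∀ a, e a * e a = e a) (hl : ∀ x, e x.right * f x = f x) {a b c : Q}
    (q : Quiver.Path a b) (p : Quiver.Path b c) :
    evalPath e f (q.comp p) = evalPath e f p * evalPath e f q := by
  induction p with
  | nil =>
    cases q with
    | nil => simp [evalPath, he]
    | cons q x => simp [evalPath, ← mul_assoc, hl ⟨_, _, x⟩]
  | cons p x ih => simp [evalPath, ih, mul_assoc]

theorem evalPath_mul_zero (he' : ∀ a b, a ≠ b → e a * e b = 0) (he : ∀ a, e a * e a = e a)
    (hl : ∀ x, e x.right * f x = f x) {a b c d : Q}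
    (q : Quiver.Path a b) (p : Quiver.Path c d) (h : c ≠ b) :
    evalPath e f p * evalPath e f q = 0 := by
  have h1 : evalPath e f p = evalPath e f p * e c := by
    simpa [evalPath] using evalPath_comp he hl (.nil : Quiver.Path c c) p
  have h2 : evalPath e f q = e b * evalPath e f q := by
    simpa [evalPath] using evalPath_comp he hl q (.nil : Quiver.Path b b)
  rw [h1, h2, mul_assoc, ← mul_assoc (e c), he' _ _ h]
  simp

/-- The homomorphism `kQ → A` given by suitable images of the vertices and the arrows. -/
def pathLift (he' : ∀ a b, a ≠ b → e a * e b = 0) (he : ∀ a, e a * e a = e a)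
    (hl : ∀ x, e x.right * f x = f x) :
    PathAlgebra k Q →ₙₐ[k] A where
  __ := PathAlgebra.lin (k := k) fun p => evalPath e f p.path
  map_zero' := by simp
  map_mul' a b := by
    let φ : PathAlgebra k Q →ₗ[k] A := PathAlgebra.lin fun p => evalPath e f p.path
    have h : (PathAlgebra.mulₗ (k := k) (Q := Q)).compr₂ φ =
        (LinearMap.mul k A).compl₁₂ φ φ := by
      refine PathAlgebra.hom_ext fun p => PathAlgebra.hom_ext fun q => ?_
      obtain ⟨a, b, p⟩ := p
      obtain ⟨c, d, q⟩ := q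
      have := PathAlgebra.of_mul_of (k := k) ⟨a, b, p⟩ ⟨c, d, q⟩
      rw [PathAlgebra.mul_def] at this
      simp only [LinearMap.compr₂_apply, this, LinearMap.compl₁₂_apply, LinearMap.mul_apply', φ,
        PathAlgebra.lin_of]
      by_cases h : a = d
      · subst h
        simp [PathAlgebra.pathMul, QPath.mul?, evalPath_comp he hl]
      · simp [PathAlgebra.pathMul, QPath.mul?, h, evalPath_mul_zero he' he hl q p h]
    exact congrArg (fun f => f a b) h
  map_smul' := by simp

/-- The homomorphism `k ⊕ Λ → A` given by suitable images of the vertices and the arrows. -/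
def UAlg.lift (he' : ∀ a b, a ≠ b → e a * e b = 0) (he : ∀ a, e a * e a = e a)
    (hl : ∀ x, e x.right * f x = f x)
    (hρ : ∀ p ∈ ρ, evalPath e f p.path = 0) : UAlg k ρ →ₐ[k] A :=
  RingQuot.liftAlgHom k ⟨Unitization.lift (pathLift he' he hl), by
    rintro _ _ ⟨p, hp⟩
    simpa [pathLift] using hρ p hp⟩

theorem UAlg.lift_pathElt (he' : ∀ a b, a ≠ b → e a * e b = 0) (he : ∀ a, e a * e a = e a)
    (hl : ∀ x, e x.right * f x = f x)
    (hρ : ∀ p ∈ ρ, evalPath e f p.path = 0) (p : QPath Q) :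
    UAlg.lift (k := k) ρ he' he hl hρ (pathElt k ρ p) = evalPath e f p.path := by
  refine (RingQuot.liftAlgHom_mkAlgHom_apply k _ _ _).trans ?_
  simp [pathLift]

/-- `k ⊕ Λ` is spanned over `k` by the unit and the paths. -/
theorem UAlg.induction {P : UAlg k ρ → Prop} (h1 : P 1) (hp : ∀ p, P (pathElt k ρ p))
    (hadd : ∀ a b, P a → P b → P (a + b)) (hsmul : ∀ (t : k) a, P a → P (t • a)) (a : UAlg k ρ) :
    P a := by
  obtain ⟨a, rfl⟩ := RingQuot.mkAlgHom_surjective k (ZeroRel k ρ) a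
  change P (UAlg.mk k ρ a)
  induction a using Unitization.ind with
  | inl_add_inr r a =>
    rw [map_add]
    refine hadd _ _ ?_ ?_
    · have : (Unitization.inl r : Unitization k (PathAlgebra k Q)) = r • 1 := by
        ext <;> simp
      rw [this, map_smul, map_one]
      exact hsmul _ _ h1
    · induction a using PathAlgebra.induction with
      | h0 =>
        have := hsmul 0 _ h1
        rw [zero_smul] at this
        rw [Unitization.inr_zero, map_zero]
        exact this
      | hadd a b ha hb =>
        rw [Unitization.inr_add, map_add]
        exact hadd _ _ ha hb
      | hof t p =>
        rw [Unitization.inr_smul, map_smul]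
        exact hsmul t _ (hp p)

end Alg

/-! ### Letters and words -/

/-- A letter: an arrow `x` (a direct letter) or its formal inverse `x⁻¹` (an inverse letter). -/
inductive Letter (Q : Type v) [Quiver.{w} Q]
  | dir (x : Arrow Q)
  | inv (x : Arrow Q)

section Words

variable {Q : Type v} [Quiver.{w} Q]

/-- The inverse of a letter. -/
def Letter.inverse : Letter Q → Letter Q
  | .dir x => .inv x
  | .inv x => .dir x

/-- The head of a letter. -/
def Letter.head : Letter Q → Q
  | .dir x => x.right
  | .inv x => x.left

/-- The tail of a letter. -/
def Letter.tail : Letter Q → Q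
  | .dir x => x.left
  | .inv x => x.right

/-- The letters `x₁, …, xₘ` of a path `x₁ ⋯ xₘ`. -/
def dirLetters {a b : Q} (p : Quiver.Path a b) : List (Letter Q) := (arrows p).map .dir

/-- The letters `xₘ⁻¹, …, x₁⁻¹` of the inverse of a path `x₁ ⋯ xₘ`. -/
def invLetters {a b : Q} (p : Quiver.Path a b) : List (Letter Q) := (arrows p).reverse.map .inv

/-- The types of index sets of words. -/
inductive Shape
  | fin (n : ℕ)
  | nat
  | negNat
  | int

/-- The index sets `{0, …, n}`, `ℕ`, `-ℕ` and `ℤ`. -/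
def Shape.idx : Shape → Set ℤ
  | .fin n => Set.Icc 0 (n : ℤ)
  | .nat => Set.Ici 0
  | .negNat => Set.Iic 0
  | .int => Set.univ

/-- The list `L` occurs in the sequence `c`, as a sequence of consecutive letters starting at
position `i`. -/
def OccursAt (c : ℤ → Option (Letter Q)) (i : ℤ) (L : List (Letter Q)) : Prop :=
  ∀ j : ℕ, j < L.length → c (i + j) = L[j]?

/-- An `I`-word `C` for the string algebra `kQ/(ρ)`. Here `letter i` is the letter `Cᵢ`, which is
present if and only if `i` and `i - 1` are in `I`, and `vertex i` is the vertex `vᵢ(C)`, which is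
present if and only if `i` is in `I`. For `I = {0}` one gets the trivial word at a vertex. -/
structure Word (ρ : Set (QPath Q)) where
  shape : Shape
  vertex : ℤ → Option Q
  letter : ℤ → Option (Letter Q)
  vertex_isSome : ∀ i, (vertex i).isSome ↔ i ∈ shape.idx
  letter_isSome : ∀ i, (letter i).isSome ↔ i ∈ shape.idx ∧ i - 1 ∈ shape.idx
  vertex_tail : ∀ i l, letter i = some l → vertex i = some l.tail
  vertex_head : ∀ i l, letter i = some l → vertex (i - 1) = some l.head
  not_inverse : ∀ i l, letter i = some l → letter (i + 1) ≠ some l.inverse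
  not_rel : ∀ p ∈ ρ, ∀ i, ¬ OccursAt letter i (dirLetters p.path)
  not_rel_inv : ∀ p ∈ ρ, ∀ i, ¬ OccursAt letter i (invLetters p.path)

namespace Word

variable {ρ : Set (QPath Q)} (C : Word ρ)

/-- `C` is a `ℤ`-word with `C = C[n]`, where `n > 0`, and `n` is minimal with this property. -/
structure HasPeriod (n : ℕ) : Prop where
  shape_eq : C.shape = .int
  pos : 0 < n
  periodic : ∀ i, C.letter (i + n) = C.letter i
  minimal : ∀ m : ℕ, 0 < m → (∀ i, C.letter (i + m) = C.letter i) → n ≤ m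

/-- `C` is the `ℤ`-word `∞P∞ = ⋯ P | P P ⋯`. -/
def IsBiInfinitePower {a : Q} (P : Quiver.Path a a) : Prop :=
  C.shape = .int ∧ ∀ i : ℤ, C.letter i = (dirLetters P)[((i - 1) % (P.length : ℤ)).toNat]?

/-- The two words which start at position `i` of `C`, namely `C_{>i}` (for `d = true`) and
`(C_{≤i})⁻¹` (for `d = false`): `C.side i d n` is the letter number `n + 1` of that word. -/
def side (i : ℤ) (d : Bool) (n : ℕ) : Option (Letter Q) :=
  if d then C.letter (i + 1 + n) else (C.letter (i - n)).map Letter.inverse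

/-- The word at position `i` in direction `d` is `(P⁻¹)^∞`. -/
def IsDeepSide {a : Q} (P : Quiver.Path a a) (i : ℤ) (d : Bool) : Prop :=
  ∀ n : ℕ, C.side i d n = (invLetters P)[n % P.length]?

/-- The word at position `i` in direction `d` is of the form `P D` for some word `D`. -/
def StartsWith {a : Q} (P : Quiver.Path a a) (i : ℤ) (d : Bool) : Prop :=
  ∀ n : ℕ, n < P.length → C.side i d n = (dirLetters P)[n]?

/-- `i` is a `P`-peak for `C`: one of the two words at position `i` is `(P⁻¹)^∞` (that is, `i` is
`P`-deep), and the other one is not of the form `P D`. If `P` has sign `ε`, then `(P⁻¹)^∞` has sign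
`-ε`, so the first one of the two words is `C(i, -ε)` and the other one is `C(i, ε)`. -/
def IsPeak {a : Q} (P : Quiver.Path a a) (i : ℤ) : Prop :=
  i ∈ C.shape.idx ∧ ∃ d : Bool, C.IsDeepSide P i d ∧ ¬ C.StartsWith P i (!d)

end Word

/-- `P` is a primitive cycle: a non-trivial direct word, such that `∞P∞` is a periodic
`ℤ`-word of period equal to the length of `P`. -/
def IsPrimitiveCycle (ρ : Set (QPath Q)) {a : Q} (P : Quiver.Path a a) : Prop :=
  ∃ C : Word ρ, C.IsBiInfinitePower P ∧ C.HasPeriod P.length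

end Words

/-! ### Primitive torsion -/

section Torsion

variable {Q : Type v} [Quiver.{w} Q] (k : Type u) [Field k] (ρ : Set (QPath Q))

/-- The sum `z_a` of all primitive cycles with head `a`. (There are at most two of them.) -/
def zElt (a : Q) : UAlg k ρ :=
  ∑ᶠ P : {P : Quiver.Path a a // IsPrimitiveCycle ρ P}, pathElt k ρ ⟨a, a, P⟩

variable (M : Type*) [AddCommGroup M] [Module (UAlg k ρ) M]

/-- The primitive torsion `τ¹(M)` of a unital module: the set of all `m` with `f(z) m = 0` for some
polynomial `f` with `f(0) = 1`. Here `z` acts on `M = ⨁ e_a M` as multiplication by `z_a` on `e_a M`,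
so that `f(z) m` has component `f(z_a) e_a m` in `e_a M`. -/
def primitiveTorsion : Set M :=
  {m | ∃ f : Polynomial k, f.eval 0 = 1 ∧
    ∀ a : Q, Polynomial.aeval (zElt k ρ a) f • (idem k ρ a • m) = 0}

end Torsion

/-! ### String modules -/

section StringModules

variable {Q : Type v} [Quiver.{w} Q] (k : Type u) [Field k] {ρ : Set (QPath Q)}

/-- The string module `M(C)`: the vector space with basis the symbols `bᵢ` with `i ∈ I`. -/
def StringModule (C : Word ρ) := C.shape.idx →₀ k

variable {k} (C : Word ρ)

instance : AddCommGroup (StringModule k C) := inferInstanceAs (AddCommGroup (C.shape.idx →₀ k))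

instance : Module k (StringModule k C) := inferInstanceAs (Module k (C.shape.idx →₀ k))

namespace StringModule

variable (k)

/-- The basis element `bᵢ` for `i ∈ I`. -/
def single (i : C.shape.idx) : StringModule k C := Finsupp.single i 1

/-- The basis element `bᵢ` for `i ∈ I`, and `0` for other `i`. -/
def b (i : ℤ) : StringModule k C :=
  if h : i ∈ C.shape.idx then single k C ⟨i, h⟩ else 0

variable {k}

/-- The linear map with given values on the basis elements. -/
def lin {A : Type*} [AddCommGroup A] [Module k A] (f : ℤ → A) : StringModule k C →ₗ[k] A :=
  Finsupp.linearCombination k fun i : C.shape.idx => f i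

theorem lin_b {A : Type*} [AddCommGroup A] [Module k A] (f : ℤ → A) {i : ℤ}
    (hi : i ∈ C.shape.idx) : lin C f (b k C i) = f i := by
  rw [b, dif_pos hi]
  exact (Finsupp.linearCombination_single k 1 _).trans (one_smul k _)

variable {C}

theorem hom_ext {A : Type*} [AddCommGroup A] [Module k A] {f g : StringModule k C →ₗ[k] A}
    (h : ∀ i ∈ C.shape.idx, f (b k C i) = g (b k C i)) : f = g :=
  Finsupp.lhom_ext' fun i => LinearMap.ext_ring <| by
    have := h i i.2
    rw [b, dif_pos i.2] at this
    exact this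

variable (k) (C)

/-- The action of `e_a` on `M(C)`: `e_a bᵢ = bᵢ` if `vᵢ(C) = a`, and `e_a bᵢ = 0` otherwise. -/
def idemAct (a : Q) : Module.End k (StringModule k C) :=
  lin C fun i => if C.vertex i = some a then b k C i else 0

/-- The action of an arrow `x` on `M(C)`: `x bᵢ` is `bᵢ₋₁` if `Cᵢ = x`, it is `bᵢ₊₁` if
`Cᵢ₊₁ = x⁻¹`, and it is `0` otherwise. -/
def arrowAct (x : Arrow Q) : Module.End k (StringModule k C) :=
  lin C fun i =>
    if C.letter i = some (.dir x) then b k C (i - 1)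
    else if C.letter (i + 1) = some (.inv x) then b k C (i + 1)
    else 0

variable {k} {C}

theorem mem_of_letter {i : ℤ} {l : Letter Q} (h : C.letter i = some l) :
    i ∈ C.shape.idx ∧ i - 1 ∈ C.shape.idx :=
  (C.letter_isSome i).1 (by simp [h])

theorem mem_of_letter_succ {i : ℤ} {l : Letter Q} (h : C.letter (i + 1) = some l) :
    i ∈ C.shape.idx ∧ i + 1 ∈ C.shape.idx := by
  have := mem_of_letter h
  simpa [and_comm] using this

theorem idemAct_b (a : Q) {i : ℤ} (hi : i ∈ C.shape.idx) :
    idemAct k C a (b k C i) = if C.vertex i = some a then b k C i else 0 := lin_b C _ hi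

theorem arrowAct_b (x : Arrow Q) {i : ℤ} (hi : i ∈ C.shape.idx) :
    arrowAct k C x (b k C i) =
      if C.letter i = some (.dir x) then b k C (i - 1)
      else if C.letter (i + 1) = some (.inv x) then b k C (i + 1)
      else 0 := lin_b C _ hi

theorem idemAct_mul_self (a : Q) : idemAct k C a * idemAct k C a = idemAct k C a := by
  refine hom_ext fun i hi => ?_
  simp only [Module.End.mul_apply, idemAct_b a hi]
  split_ifs with h
  · simp [idemAct_b a hi, h]
  · simp

theorem idemAct_mul_of_ne (a c : Q) (hac : a ≠ c) : idemAct k C a * idemAct k C c = 0 := by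
  refine hom_ext fun i hi => ?_
  simp only [Module.End.mul_apply, idemAct_b c hi]
  split_ifs with h
  · simp [idemAct_b a hi, h, hac.symm]
  · simp

theorem idemAct_mul_arrowAct (x : Arrow Q) :
    idemAct k C x.right * arrowAct k C x = arrowAct k C x := by
  refine hom_ext fun i hi => ?_
  simp only [Module.End.mul_apply, arrowAct_b x hi]
  split_ifs with h h'
  · simp [idemAct_b _ (mem_of_letter h).2, C.vertex_head i _ h, Letter.head]
  · simp [idemAct_b _ (mem_of_letter h').1, C.vertex_tail _ _ h', Letter.tail]
  · simp

/-- A non-trivial path acts on a basis element by moving along `C` in one direction. -/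
theorem evalPath_b {a c : Q} (p : Quiver.Path a c) {i : ℤ} (hi : i ∈ C.shape.idx) :
    evalPath (idemAct k C) (arrowAct k C) p (b k C i) = 0 ∨
    (OccursAt C.letter (i - p.length + 1) (dirLetters p) ∧ i - p.length ∈ C.shape.idx ∧
      evalPath (idemAct k C) (arrowAct k C) p (b k C i) = b k C (i - p.length)) ∨
    (OccursAt C.letter (i + 1) (invLetters p) ∧ i + p.length ∈ C.shape.idx ∧
      evalPath (idemAct k C) (arrowAct k C) p (b k C i) = b k C (i + p.length)) := by
  induction p with
  | nil =>
    rw [evalPath, idemAct_b a hi]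
    split_ifs with h
    · exact Or.inr (Or.inl ⟨by simp [OccursAt, dirLetters, arrows], by simpa using hi, by simp⟩)
    · exact Or.inl rfl
  | @cons d c p x ih =>
    rw [evalPath, Module.End.mul_apply]
    have hd : dirLetters (p.cons x) = .dir ⟨_, _, x⟩ :: dirLetters p := by
      simp [dirLetters, arrows]
    have hv : invLetters (p.cons x) = invLetters p ++ [.inv ⟨_, _, x⟩] := by
      simp [invLetters, arrows]
    have hdl : (dirLetters p).length = p.length := by simp [dirLetters, length_arrows]
    have hvl : (invLetters p).length = p.length := by simp [invLetters, length_arrows]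
    -- The two ways to extend an occurrence by one letter.
    have ed : OccursAt C.letter (i - p.length + 1) (dirLetters p) →
        C.letter (i - p.length) = some (.dir ⟨_, _, x⟩) →
        OccursAt C.letter (i - (p.cons x).length + 1) (dirLetters (p.cons x)) := by
      intro ho hx j hj
      rw [hd] at hj ⊢
      rcases j with _ | j
      · rw [show i - ((p.cons x).length : ℤ) + 1 + ((0 : ℕ) : ℤ) = i - p.length by
          simp only [Quiver.Path.length_cons]; push_cast; ring]
        simpa using hx
      · rw [show i - ((p.cons x).length : ℤ) + 1 + ((j + 1 : ℕ) : ℤ) = i - p.length + 1 + j by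
          simp only [Quiver.Path.length_cons]; push_cast; ring]
        simpa using ho j (by simpa using hj)
    have ev : OccursAt C.letter (i + 1) (invLetters p) →
        C.letter (i + p.length + 1) = some (.inv ⟨_, _, x⟩) →
        OccursAt C.letter (i + 1) (invLetters (p.cons x)) := by
      intro ho hx j hj
      rw [hv] at hj ⊢
      rcases lt_or_ge j p.length with h | h
      · rw [List.getElem?_append_left (by omega)]
        exact ho j (by omega)
      · have : j = p.length := by simp [hvl] at hj; omega
        subst this
        rw [List.getElem?_append_right (by omega), hvl, add_right_comm, hx]
        simp
    have nil_case : p.length = 0 → OccursAt C.letter (i - p.length + 1) (dirLetters p) ∧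
        OccursAt C.letter (i + 1) (invLetters p) := by
      intro h
      constructor <;> intro j hj <;> omega
    rcases ih with h | ⟨ho, hm, h⟩ | ⟨ho, hm, h⟩
    · exact Or.inl (by simp [h])
    · rw [h, arrowAct_b _ hm]
      split_ifs with h1 h2
      · refine Or.inr (Or.inl ⟨ed ho h1, ?_, ?_⟩)
        · have := (mem_of_letter h1).2
          simpa [sub_sub] using this
        · simp [sub_sub]
      · rcases Nat.eq_zero_or_pos p.length with h0 | h0
        · have h2' : C.letter (i + p.length + 1) = some (.inv ⟨_, _, x⟩) := by
            simpa [h0] using h2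
          refine Or.inr (Or.inr ⟨ev (nil_case h0).2 h2', ?_, ?_⟩)
          · simpa [add_assoc] using (mem_of_letter h2').1
          · simp [h0]
        · have := ho 0 (by omega)
          simp only [Nat.cast_zero, add_zero, h2] at this
          exfalso
          rw [List.getElem?_eq_getElem (by omega)] at this
          simp [dirLetters] at this
      · exact Or.inl rfl
    · rw [h, arrowAct_b _ hm]
      split_ifs with h1 h2
      · rcases Nat.eq_zero_or_pos p.length with h0 | h0
        · have h1' : C.letter (i - p.length) = some (.dir ⟨_, _, x⟩) := by
            simpa [h0] using h1
          refine Or.inr (Or.inl ⟨ed (nil_case h0).1 h1', ?_, ?_⟩)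
          · simpa [sub_sub] using (mem_of_letter h1').2
          · simp [h0]
        · have := ho (p.length - 1) (by omega)
          rw [show i + 1 + ((p.length - 1 : ℕ) : ℤ) = i + p.length by omega, h1] at this
          exfalso
          rw [List.getElem?_eq_getElem (by omega)] at this
          simp [invLetters] at this
      · refine Or.inr (Or.inr ⟨ev ho h2, ?_, ?_⟩)
        · simpa [add_assoc] using (mem_of_letter h2).1
        · simp [add_assoc]
      · exact Or.inl rfl

theorem evalPath_rel (p : QPath Q) (hp : p ∈ ρ) :
    evalPath (idemAct k C) (arrowAct k C) p.path = 0 := by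
  refine hom_ext fun i hi => ?_
  rcases evalPath_b (k := k) p.path hi with h | ⟨ho, _⟩ | ⟨ho, _⟩
  · simpa using h
  · exact absurd ho (C.not_rel p hp _)
  · exact absurd ho (C.not_rel_inv p hp _)

variable (k C)

/-- The action of `k ⊕ Λ` on the string module `M(C)`. -/
def act : UAlg k ρ →ₐ[k] Module.End k (StringModule k C) :=
  UAlg.lift ρ (e := idemAct k C) (f := arrowAct k C) idemAct_mul_of_ne idemAct_mul_self
    idemAct_mul_arrowAct evalPath_rel

instance : Module (UAlg k ρ) (StringModule k C) :=
  Module.compHom (StringModule k C) (act k C).toRingHom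

variable {k C}

theorem smul_def (a : UAlg k ρ) (m : StringModule k C) : a • m = act k C a m := rfl

theorem idem_smul_b (a : Q) {i : ℤ} (hi : i ∈ C.shape.idx) :
    idem k ρ a • b k C i = if C.vertex i = some a then b k C i else 0 := by
  rw [smul_def, idem, act, UAlg.lift_pathElt]
  exact idemAct_b a hi

theorem arrowElt_smul_b (x : Arrow Q) {i : ℤ} (hi : i ∈ C.shape.idx) :
    arrowElt k ρ x • b k C i =
      if C.letter i = some (.dir x) then b k C (i - 1)
      else if C.letter (i + 1) = some (.inv x) then b k C (i + 1)
      else 0 := by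
  rw [smul_def, arrowElt, act, UAlg.lift_pathElt]
  change arrowAct k C x (idemAct k C x.left (b k C i)) = _
  rw [idemAct_b _ hi]
  split_ifs with h1 h2 h3 h3 h2
  · rw [arrowAct_b x hi, if_pos h2]
  · rw [arrowAct_b x hi, if_neg h2, if_pos h3]
  · rw [arrowAct_b x hi, if_neg h2, if_neg h3]
  · exact absurd (C.vertex_tail _ _ h3) h1
  · have := C.vertex_head _ _ h2
    simp only [add_sub_cancel_right] at this
    exact absurd this h1
  · simp

end StringModule
end StringModules

/-! ### Band modules -/

section BandModules

variable {Q : Type v} [Quiver.{w} Q] (k : Type u) [Field k] {ρ : Set (QPath Q)}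

/-- The `Λ`-`k[T,T⁻¹]`-bimodule `M(C)` for a periodic `ℤ`-word `C` of period `n`. -/
def Bimodule {C : Word ρ} {n : ℕ} (_ : C.HasPeriod n) := StringModule k C

variable {C : Word ρ} {n : ℕ} (h : C.HasPeriod n)

instance : AddCommGroup (Bimodule k h) := inferInstanceAs (AddCommGroup (StringModule k C))

instance : Module k (Bimodule k h) := inferInstanceAs (Module k (StringModule k C))

instance : Module (UAlg k ρ) (Bimodule k h) :=
  inferInstanceAs (Module (UAlg k ρ) (StringModule k C))

theorem Word.HasPeriod.mem {C : Word ρ} {n : ℕ} (h : C.HasPeriod n) (i : ℤ) :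
    i ∈ C.shape.idx := by
  rw [h.shape_eq]
  trivial

theorem Word.HasPeriod.letter_sub {C : Word ρ} {n : ℕ} (h : C.HasPeriod n) (m i : ℤ) :
    C.letter (i - m * n) = C.letter i := by
  have h1 : Function.Periodic C.letter (n : ℤ) := h.periodic
  have h2 := h1.int_mul m
  simpa using (h2 (i - m * n)).symm

theorem Word.HasPeriod.vertex_sub {C : Word ρ} {n : ℕ} (h : C.HasPeriod n) (m i : ℤ) :
    C.vertex (i - m * n) = C.vertex i := by
  obtain ⟨l, hl⟩ := Option.isSome_iff_exists.1 ((C.letter_isSome i).2 ⟨h.mem _, h.mem _⟩)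
  rw [C.vertex_tail _ _ hl, C.vertex_tail _ _ ((h.letter_sub m i).trans hl)]

/-- The power `t^m` of the isomorphism `t = t_{C,n} : M(C) → M(C)` with `t(bᵢ) = bᵢ₋ₙ`. -/
def shiftAct {C : Word ρ} {n : ℕ} (_ : C.HasPeriod n) (m : ℤ) :
    Module.End k (StringModule k C) :=
  StringModule.lin C fun i => StringModule.b k C (i - m * n)

theorem shiftAct_b (m i : ℤ) :
    shiftAct k h m (StringModule.b k C i) = StringModule.b k C (i - m * n) :=
  StringModule.lin_b C _ (h.mem i)

/-- The action of `k[T,T⁻¹]` on `M(C)`, with `T` acting as `t_{C,n}`. -/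
def laurentAct {C : Word ρ} {n : ℕ} (h : C.HasPeriod n) :
    LaurentPolynomial k →ₐ[k] Module.End k (StringModule k C) :=
  AddMonoidAlgebra.lift k (Module.End k (StringModule k C)) ℤ
    { toFun := fun m => shiftAct k h m.toAdd
      map_one' := StringModule.hom_ext fun i _ => by simp [shiftAct_b]
      map_mul' := fun m m' => StringModule.hom_ext fun i _ => by
        simp only [toAdd_mul, shiftAct_b, Module.End.mul_apply]
        congr 1
        ring }

instance : Module (LaurentPolynomial k) (Bimodule k h) :=
  Module.compHom (StringModule k C) (laurentAct k h).toRingHom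

theorem shiftAct_idemAct (m : ℤ) (a : Q) :
    Commute (shiftAct k h m) (StringModule.idemAct k C a) := by
  refine StringModule.hom_ext fun i hi => ?_
  simp only [Module.End.mul_apply, StringModule.idemAct_b a (h.mem _), shiftAct_b, h.vertex_sub]
  split_ifs <;> simp [shiftAct_b]

theorem shiftAct_arrowAct (m : ℤ) (x : Arrow Q) :
    Commute (shiftAct k h m) (StringModule.arrowAct k C x) := by
  refine StringModule.hom_ext fun i hi => ?_
  have h1 := h.letter_sub m (i + 1)
  rw [show i + 1 - m * n = i - m * n + 1 by ring] at h1
  simp only [Module.End.mul_apply, StringModule.arrowAct_b x (h.mem _), shiftAct_b, h.letter_sub,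
    h1]
  split_ifs
  · rw [shiftAct_b]; congr 1; ring
  · rw [shiftAct_b]; congr 1; ring
  · simp

theorem shiftAct_act (m : ℤ) (a : UAlg k ρ) :
    Commute (shiftAct k h m) (StringModule.act k C a) := by
  induction a using UAlg.induction with
  | h1 => simp
  | hadd a b ha hb => rw [map_add]; exact ha.add_right hb
  | hsmul t a ha => rw [map_smul]; exact ha.smul_right t
  | hp p =>
    obtain ⟨a, c, p⟩ := p
    rw [StringModule.act, UAlg.lift_pathElt]
    induction p with
    | nil => exact shiftAct_idemAct k h m _
    | cons p x ih => exact (shiftAct_arrowAct k h m _).mul_right ih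

theorem laurentAct_act (p : LaurentPolynomial k) (a : UAlg k ρ) :
    Commute (laurentAct k h p) (StringModule.act k C a) := by
  induction p using LaurentPolynomial.induction_on' with
  | add p q hp hq => rw [map_add]; exact hp.add_left hq
  | C_mul_T m t =>
    have : laurentAct k h (LaurentPolynomial.C t * LaurentPolynomial.T m) =
        t • shiftAct k h m := by
      rw [← LaurentPolynomial.single_eq_C_mul_T]
      exact AddMonoidAlgebra.lift_single _ _ _
    rw [this]
    exact (shiftAct_act k h m a).smul_left t

instance : SMulCommClass (LaurentPolynomial k) (UAlg k ρ) (Bimodule k h) :=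
  ⟨fun p a m => congrArg (fun f : Module.End k (StringModule k C) => f m)
    (laurentAct_act k h p a)⟩

/-- The module `M(C,V) = M(C) ⊗ V`, where the tensor product is over `k[T,T⁻¹]`. -/
abbrev BandModule (V : Type*) [AddCommGroup V] [Module (LaurentPolynomial k) V] :=
  TensorProduct (LaurentPolynomial k) (Bimodule k h) V

/-- `V` is an indecomposable module. -/
def IsIndecomposableModule (R : Type*) [Ring R] (V : Type*) [AddCommGroup V] [Module R V] : Prop :=
  Nontrivial V ∧ ∀ A B : Submodule R V, IsCompl A B → A = ⊥ ∨ B = ⊥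

variable (ρ) (M : Type*) [AddCommGroup M] [Module (UAlg k ρ) M]

/-- `M` is isomorphic to a string module. -/
def IsStringModule : Prop :=
  ∃ C : Word ρ, Nonempty (M ≃ₗ[UAlg k ρ] StringModule k C)

/-- `M` is isomorphic to a band module `M(C,V)`: here `C` is a periodic `ℤ`-word, and `V` is a
finite-dimensional indecomposable `k[T,T⁻¹]`-module. -/
def IsBandModule : Prop :=
  ∃ (C : Word ρ) (n : ℕ) (h : C.HasPeriod n) (V : Type u) (_ : AddCommGroup V)
    (_ : Module (LaurentPolynomial k) V),
    Module.Finite k (RestrictScalars k (LaurentPolynomial k) V) ∧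
    IsIndecomposableModule (LaurentPolynomial k) V ∧
    Nonempty (M ≃ₗ[UAlg k ρ] BandModule k h V)

/-- `M` is a primitive simple: a simple, primitive torsion module. -/
def IsPrimitiveSimple : Prop :=
  IsSimpleModule (UAlg k ρ) M ∧ primitiveTorsion k ρ M = Set.univ

/-- `M` is isomorphic to `M(∞P∞, V)`, where `P` is a primitive cycle and `V` is a simple
`k[T,T⁻¹]`-module. -/
def IsSimpleOfCycle {a : Q} (P : Quiver.Path a a) : Prop :=
  ∃ (C : Word ρ) (h : C.HasPeriod P.length) (V : Type u) (_ : AddCommGroup V)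
    (_ : Module (LaurentPolynomial k) V),
    C.IsBiInfinitePower P ∧ IsSimpleModule (LaurentPolynomial k) V ∧
    Nonempty (M ≃ₗ[UAlg k ρ] BandModule k h V)

end BandModules

end StringAlg

end

noncomputable section

open scoped Classical

namespace StringAlg

universe u v w

/-! ### The algebra `Λ`: products of paths -/

section Products

variable {Q : Type v} [Quiver.{w} Q] {k : Type u} [Field k] {ρ : Set (QPath Q)}

/-! Write p for the image of P in Λ. An arrow of a string algebra has at most one continuation on
each side, so after p only the paths running round P survive: they span Λp, one has pap ∈ k[p]p for
all a, and z acts on pM as p does (`Cyc.mul_p_mem`, `Cyc.p_mul_mul_p`, `zElt_mul_p`). Torsion of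
elements of pM can thus be tested with polynomials in p. Some primitive cycle acts non-trivially on
S. For any such cycle there are an irreducible f = 1 + X f₁ and s ∈ S with f(p)s = 0 and ps ≠ 0
(`exists_irreducible_aeval_smul_eq_zero`), and S is M(^∞P^∞, V) with V = k[X]/(f) and T acting as X
(`isSimpleOfCycle_of_p_smul_ne_zero`).

For the splitting, lift s to m ∈ M and decompose f(p)m ∈ N into components y_λ. Suppose each y_λ
were f(p)y'_λ up to an element killed by a polynomial in p with constant term 1. Then p(m - ∑ y'_λ)
would be primitive torsion, hence in N, against ps ≠ 0. So some N_μ obstructs the correction of m.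
Band modules never do, since p is algebraic on them. In a string module, p is nilpotent on each
basis vector at which neither word is (P⁻¹)^∞. The word ^∞P^∞ is excluded by finite control
(`false_of_forall_good`); for other words the remaining basis vectors are powers of p applied to at
most two peaks, one for each direction (`exists_peak_decomposition`). As f(p) is invertible where p
is nilpotent, the obstruction sits at a peak b.

Let Z be the quotient of M by the other summands, and ι : M(C) → Z the inclusion of N_μ. A Bézout
identity changes m so that f(p)m = p ι(b + w), with w far behind b (`dvd_or_exists_peak`). Then m' =
ι(b) - f₁(p)m + ι(w) satisfies pm' = m and f(p)m' = ι(b + w). There is a homomorphism η with η(b) =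
-p f₁(p)m' and η(w) = 0 (`exists_isPeakHom`), so that ι + η sends b + w to m'; it is an isomorphism
(`bijective_add_peakHom`). Lifting η to M, one gets N'_μ as the image of the lifted sum
(`dvd_or_exists_isCompl`). -/

theorem UAlg.mk_inr_mul (a b : PathAlgebra k Q) :
    UAlg.mk k ρ (Unitization.inr a) * UAlg.mk k ρ (Unitization.inr b) =
      UAlg.mk k ρ (Unitization.inr (a * b)) := by
  rw [← map_mul, Unitization.inr_mul]

theorem pathElt_mul_pathElt {a b c : Q} (p : Quiver.Path b c) (q : Quiver.Path a b) :
    pathElt k ρ ⟨b, c, p⟩ * pathElt k ρ ⟨a, b, q⟩ = pathElt k ρ ⟨a, c, q.comp p⟩ := by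
  rw [pathElt, pathElt, UAlg.mk_inr_mul, PathAlgebra.of_mul_of]
  simp [PathAlgebra.pathMul, QPath.mul?, pathElt]

theorem pathElt_mul_of_ne {p q : QPath Q} (h : p.tail ≠ q.head) :
    pathElt k ρ p * pathElt k ρ q = 0 := by
  rw [pathElt, pathElt, UAlg.mk_inr_mul, PathAlgebra.of_mul_of]
  simp [PathAlgebra.pathMul, QPath.mul?, h]

theorem pathElt_of_mem {p : QPath Q} (h : p ∈ ρ) : pathElt k ρ p = 0 := by
  have : UAlg.mk k ρ (Unitization.inr (PathAlgebra.of k p)) = UAlg.mk k ρ 0 :=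
    RingQuot.mkAlgHom_rel k (ZeroRel.mk p h)
  rw [pathElt, this, map_zero]

theorem pathElt_cons {a b c : Q} (p : Quiver.Path a b) (x : b ⟶ c) :
    pathElt k ρ ⟨a, c, p.cons x⟩ = arrowElt k ρ ⟨b, c, x⟩ * pathElt k ρ ⟨a, b, p⟩ :=
  (pathElt_mul_pathElt (x.toPath) p).symm

theorem idem_mul_self (a : Q) : idem k ρ a * idem k ρ a = idem k ρ a :=
  pathElt_mul_pathElt _ _

theorem idem_mul_of_ne {a b : Q} (h : a ≠ b) : idem k ρ a * idem k ρ b = 0 :=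
  pathElt_mul_of_ne h

theorem idem_mul_pathElt {a b : Q} (p : Quiver.Path a b) :
    idem k ρ b * pathElt k ρ ⟨a, b, p⟩ = pathElt k ρ ⟨a, b, p⟩ :=
  pathElt_mul_pathElt (.nil) p

theorem pathElt_mul_idem {a b : Q} (p : Quiver.Path a b) :
    pathElt k ρ ⟨a, b, p⟩ * idem k ρ a = pathElt k ρ ⟨a, b, p⟩ := by
  exact (pathElt_mul_pathElt p (.nil)).trans (by rw [Quiver.Path.nil_comp])

theorem idem_mul_arrowElt (x : Arrow Q) :
    idem k ρ x.right * arrowElt k ρ x = arrowElt k ρ x := idem_mul_pathElt _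

theorem arrowElt_mul_idem (x : Arrow Q) :
    arrowElt k ρ x * idem k ρ x.left = arrowElt k ρ x := pathElt_mul_idem _

/-- The arrows `x`, `y` form a path `x y` of length two which is not in `ρ`. -/
inductive Allowed (ρ : Set (QPath Q)) : Arrow Q → Arrow Q → Prop
  | mk {a b c : Q} (x : b ⟶ c) (y : a ⟶ b) (h : (⟨a, c, y.toPath.cons x⟩ : QPath Q) ∉ ρ) :
      Allowed ρ ⟨b, c, x⟩ ⟨a, b, y⟩

theorem Allowed.left_eq_right {x y : Arrow Q} (h : Allowed ρ x y) : x.left = y.right := by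
  cases h; rfl

theorem Allowed.left_unique (hρ : IsString ρ) {x x' y : Arrow Q} (h : Allowed ρ x y)
    (h' : Allowed ρ x' y) : x = x' := by
  cases h with
  | mk x y h =>
    cases h' with
    | mk x' _ h' =>
      have := hρ.left_unique y ⟨h, _, x, rfl⟩ ⟨h', _, x', rfl⟩
      simp only [QPath.mk.injEq, true_and] at this
      obtain ⟨rfl, this⟩ := this
      have := eq_of_heq this
      injection this with _ _ _ h2
      rw [h2]

theorem Allowed.right_unique (hρ : IsString ρ) {x y y' : Arrow Q} (h : Allowed ρ x y)
    (h' : Allowed ρ x y') : y = y' := by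
  cases h with
  | mk x y h =>
    cases h' with
    | mk _ y' h' =>
      have := hρ.right_unique x ⟨h, _, y, rfl⟩ ⟨h', _, y', rfl⟩
      simp only [QPath.mk.injEq, true_and] at this
      obtain ⟨rfl, this⟩ := this
      have := eq_of_heq this
      injection this with _ _ h2
      injection h2 with _ _ _ h3
      rw [h3]

theorem arrowElt_mul_of_not_allowed {x y : Arrow Q} (h : ¬ Allowed ρ x y) :
    arrowElt k ρ x * arrowElt k ρ y = 0 := by
  obtain ⟨b, c, x⟩ := x
  obtain ⟨a, b', y⟩ := y
  by_cases hb : b = b'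
  · subst hb
    rw [arrowElt, arrowElt, QPath.ofArrow, QPath.ofArrow, pathElt_mul_pathElt]
    refine pathElt_of_mem ?_
    by_contra h'
    exact h (.mk x y h')
  · exact pathElt_mul_of_ne hb

theorem Word.allowed_of_dir (C : Word ρ) {i : ℤ} {x y : Arrow Q}
    (hx : C.letter i = some (.dir x)) (hy : C.letter (i + 1) = some (.dir y)) :
    Allowed ρ x y := by
  have h1 := C.vertex_tail _ _ hx
  have h2 := C.vertex_head _ _ hy
  rw [add_sub_cancel_right, h1] at h2
  obtain ⟨b, c, x⟩ := x
  obtain ⟨a, b', y⟩ := y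
  simp only [Letter.tail, Letter.head, Option.some.injEq] at h2
  subst h2
  refine .mk x y fun h => C.not_rel _ h i ?_
  intro j hj
  simp only [dirLetters, arrows, Quiver.Hom.toPath, List.map_cons, List.map_nil,
    List.length_cons, List.length_nil] at hj ⊢
  interval_cases j
  · simpa using hx
  · simpa using hy

theorem Word.allowed_of_inv (C : Word ρ) {i : ℤ} {x y : Arrow Q}
    (hx : C.letter i = some (.inv x)) (hy : C.letter (i + 1) = some (.inv y)) :
    Allowed ρ y x := by
  have h1 := C.vertex_tail _ _ hx
  have h2 := C.vertex_head _ _ hy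
  rw [add_sub_cancel_right, h1] at h2
  obtain ⟨a, b', x⟩ := x
  obtain ⟨b, c, y⟩ := y
  simp only [Letter.tail, Letter.head, Option.some.injEq] at h2
  subst h2
  refine .mk y x fun h => C.not_rel_inv _ h i ?_
  intro j hj
  simp only [invLetters, arrows, Quiver.Hom.toPath, List.reverse_cons, List.reverse_nil,
    List.nil_append, List.cons_append, List.map_cons, List.map_nil,
    List.length_cons, List.length_nil] at hj ⊢
  interval_cases j
  · simpa using hx
  · simpa using hy

/-- Every element of a set containing `1` which is stable under sums, scalars and left
multiplication by vertices and arrows. -/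
theorem UAlg.induction_left {P : UAlg k ρ → Prop} (h1 : P 1)
    (hadd : ∀ a b, P a → P b → P (a + b)) (hsmul : ∀ (t : k) a, P a → P (t • a))
    (hidem : ∀ v, P (idem k ρ v)) (harrow : ∀ x a, P a → P (arrowElt k ρ x * a))
    (a : UAlg k ρ) : P a := by
  refine UAlg.induction ρ h1 ?_ hadd hsmul a
  rintro ⟨a, b, p⟩
  induction p with
  | nil => exact hidem a
  | cons p x ih => rw [pathElt_cons]; exact harrow _ _ ih

/-! ### Linear maps and subspaces compatible with vertices and arrows. -/

section Modules

variable {X Y : Type*} [AddCommGroup X] [Module k X] [Module (UAlg k ρ) X]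
  [IsScalarTower k (UAlg k ρ) X] [AddCommGroup Y] [Module k Y] [Module (UAlg k ρ) Y]
  [IsScalarTower k (UAlg k ρ) Y]

/-- A linear map that commutes with the action of vertices and arrows, as a homomorphism. -/
def homOfGenerators (φ : X →ₗ[k] Y) (hi : ∀ a x, φ (idem k ρ a • x) = idem k ρ a • φ x)
    (ha : ∀ y x, φ (arrowElt k ρ y • x) = arrowElt k ρ y • φ x) : X →ₗ[UAlg k ρ] Y where
  toFun := φ
  map_add' := φ.map_add
  map_smul' a x := by
    change φ (a • x) = a • φ x
    induction a using UAlg.induction_left generalizing x with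
    | h1 => simp
    | hadd a b ha hb => simp [add_smul, ha, hb]
    | hsmul t a ha => simp [ha]
    | hidem v => exact hi v x
    | harrow y a h => rw [mul_smul, mul_smul, ha, h]

/-- A subspace stable under vertices and arrows, as a submodule. -/
def submoduleOfGenerators (W : Submodule k X) (hi : ∀ a, ∀ x ∈ W, idem k ρ a • x ∈ W)
    (ha : ∀ y, ∀ x ∈ W, arrowElt k ρ y • x ∈ W) : Submodule (UAlg k ρ) X where
  carrier := W
  add_mem' := W.add_mem
  zero_mem' := W.zero_mem
  smul_mem' a x hx := by
    change a • x ∈ W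
    induction a using UAlg.induction_left with
    | h1 => simpa using hx
    | hadd a b ha hb => rw [add_smul]; exact W.add_mem ha hb
    | hsmul t a ha => rw [smul_assoc]; exact W.smul_mem t ha
    | hidem v => exact hi v x hx
    | harrow y a h => rw [mul_smul]; exact ha y _ h

end Modules

end Products

/-! ### Primitive cycles -/

section Cycles

variable {Q : Type v} [Quiver.{w} Q] {ρ : Set (QPath Q)}

/-- Two sequences of arrows whose consecutive arrows compose and which agree at one place agree
everywhere. -/
theorem eq_of_allowed (hρ : IsString ρ) {X Y : ℤ → Arrow Q} (hX : ∀ i, Allowed ρ (X i) (X (i + 1)))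
    (hY : ∀ i, Allowed ρ (Y i) (Y (i + 1))) {i j : ℤ} (h : X i = Y j) (m : ℤ) :
    X (i + m) = Y (j + m) := by
  induction m using Int.induction_on with
  | zero => simpa using h
  | succ m ih =>
    have h1 := hX (i + m)
    have h2 := hY (j + m)
    rw [← ih] at h2
    rw [← add_assoc, ← add_assoc]
    exact h1.right_unique hρ h2
  | pred m ih =>
    have h1 := hX (i + (-m - 1))
    have h2 := hY (j + (-m - 1))
    rw [show i + (-(m : ℤ) - 1) + 1 = i + -m by ring] at h1
    rw [show j + (-(m : ℤ) - 1) + 1 = j + -m by ring, ← ih] at h2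
    exact h1.left_unique hρ h2

/-- A cyclic sequence of `n` distinct arrows `Xᵢ`, indexed by the integers modulo `n`, such that the
paths `Xᵢ Xᵢ₊₁` are not in `ρ`. -/
structure Cyc (ρ : Set (QPath Q)) where
  X : ℤ → Arrow Q
  n : ℕ
  pos : 0 < n
  allowed : ∀ i, Allowed ρ (X i) (X (i + 1))
  eq_iff : ∀ i j, X i = X j ↔ (n : ℤ) ∣ i - j

namespace Cyc

variable (k : Type u) [Field k] (c : Cyc ρ)

/-- The path `Xᵢ₋ᵣ₊₁ ⋯ Xᵢ₋₁ Xᵢ` of length `r`. -/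
def seg (i : ℤ) : ℕ → UAlg k ρ
  | 0 => idem k ρ (c.X i).left
  | r + 1 => arrowElt k ρ (c.X (i - r)) * seg i r

/-- The cycle `X₁ ⋯ Xₙ`. -/
def p : UAlg k ρ := c.seg k 0 c.n

variable {k}

theorem seg_succ (i : ℤ) (r : ℕ) :
    c.seg k i (r + 1) = arrowElt k ρ (c.X (i - r)) * c.seg k i r := rfl

theorem left_eq_right (i : ℤ) : (c.X i).left = (c.X (i + 1)).right := (c.allowed i).left_eq_right

theorem seg_congr {i j : ℤ} (h : (c.n : ℤ) ∣ i - j) (r : ℕ) : c.seg k i r = c.seg k j r := by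
  induction r with
  | zero => rw [seg, seg, (c.eq_iff i j).2 h]
  | succ r ih => rw [seg_succ, seg_succ, ih, (c.eq_iff (i - r) (j - r)).2 (by simpa using h)]

theorem idem_mul_seg (i : ℤ) (r : ℕ) :
    idem k ρ (c.X (i - r)).left * c.seg k i r = c.seg k i r := by
  cases r with
  | zero => simp [seg, idem_mul_self]
  | succ r =>
    rw [seg_succ, ← mul_assoc, c.left_eq_right,
      show i - ((r + 1 : ℕ) : ℤ) + 1 = i - r by push_cast; ring, idem_mul_arrowElt]

theorem seg_add (i : ℤ) (r s : ℕ) : c.seg k i (r + s) = c.seg k (i - r) s * c.seg k i r := by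
  induction s with
  | zero => rw [add_zero, seg, idem_mul_seg]
  | succ s ih =>
    rw [← add_assoc, seg_succ, seg_succ, ih, mul_assoc]
    congr 3
    push_cast
    ring_nf

/-- The leftmost arrow of a non-trivial path on the cycle has the next arrow of the cycle as its
only continuation outside `ρ`. All computations with the cycle rest on this. -/
theorem arrowElt_mul_seg_of_ne (hρ : IsString ρ) {y : Arrow Q} {i : ℤ} {r : ℕ} (hr : 0 < r)
    (h : y ≠ c.X (i - r)) : arrowElt k ρ y * c.seg k i r = 0 := by
  obtain ⟨r, rfl⟩ := Nat.exists_eq_add_of_lt hr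
  rw [zero_add] at h ⊢
  rw [seg_succ, ← mul_assoc, arrowElt_mul_of_not_allowed, zero_mul]
  intro h'
  have h2 := c.allowed (i - ((r + 1 : ℕ) : ℤ))
  rw [show i - ((r + 1 : ℕ) : ℤ) + 1 = i - r by push_cast; ring] at h2
  exact h (h'.left_unique hρ h2)

theorem seg_mul_seg_of_not_dvd (hρ : IsString ρ) {i j : ℤ} {r s : ℕ} (hr : 0 < r) (hs : 0 < s)
    (h : ¬ (c.n : ℤ) ∣ j - (i - r)) : c.seg k j s * c.seg k i r = 0 := by
  obtain ⟨s, rfl⟩ := Nat.exists_eq_add_of_lt hs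
  rw [zero_add, add_comm, seg_add, mul_assoc, seg_succ, seg]
  have h1 : arrowElt k ρ (c.X (j - ((0 : ℕ) : ℤ))) * idem k ρ (c.X j).left =
      arrowElt k ρ (c.X j) := by
    simpa using arrowElt_mul_idem (c.X j)
  rw [h1, c.arrowElt_mul_seg_of_ne hρ hr, mul_zero]
  rwa [Ne, c.eq_iff]

theorem idem_mul_p : idem k ρ (c.X 0).left * c.p k = c.p k := by
  have := c.idem_mul_seg (k := k) 0 c.n
  rwa [(c.eq_iff (0 - c.n) 0).2 (by simp)] at this

theorem seg_zero_add (r : ℕ) : c.seg k 0 (c.n + r) = c.seg k 0 r * c.p k := by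
  rw [seg_add, c.seg_congr (j := 0) (by simp)]
  rfl

theorem seg_mul (e : ℕ) : c.seg k 0 (c.n * (e + 1)) = c.p k ^ (e + 1) := by
  induction e with
  | zero => simp [p]
  | succ e ih => rw [mul_add, mul_one, add_comm, seg_zero_add, ih, ← pow_succ]

/-- The left ideal generated by the cycle is spanned by the paths which go round the cycle. -/
theorem mul_p_mem (hρ : IsString ρ) (a : UAlg k ρ) :
    a * c.p k ∈ Submodule.span k (Set.range fun r : ℕ => c.seg k 0 r * c.p k) := by
  let W := submoduleOfGenerators (ρ := ρ) (X := UAlg k ρ)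
    (Submodule.span k (Set.range fun r : ℕ => c.seg k 0 r * c.p k)) ?_ ?_
  · have h : c.p k ∈ W := by
      refine Submodule.subset_span ⟨0, ?_⟩
      simpa [seg] using c.idem_mul_p
    exact W.smul_mem a h
  · intro v x hx
    induction hx using Submodule.span_induction with
    | mem x hx =>
      obtain ⟨r, rfl⟩ := hx
      change idem k ρ v * (c.seg k 0 r * c.p k) ∈ _
      by_cases hv : v = (c.X (0 - r)).left
      · rw [hv, ← mul_assoc, idem_mul_seg]
        exact Submodule.subset_span ⟨r, rfl⟩
      · rw [← c.idem_mul_seg, ← mul_assoc, ← mul_assoc, idem_mul_of_ne hv]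
        simp
    | zero => simp
    | add x y _ _ hx hy => rw [smul_add]; exact add_mem hx hy
    | smul t x _ hx => rw [smul_comm]; exact Submodule.smul_mem _ t hx
  · intro y x hx
    induction hx using Submodule.span_induction with
    | mem x hx =>
      obtain ⟨r, rfl⟩ := hx
      change arrowElt k ρ y * (c.seg k 0 r * c.p k) ∈ _
      by_cases hy : y = c.X (0 - r)
      · rw [hy, ← mul_assoc, ← seg_succ]
        exact Submodule.subset_span ⟨r + 1, rfl⟩
      -- Absorbing the cycle makes the path non-trivial also for `r = 0`.
      · rw [← seg_zero_add, c.arrowElt_mul_seg_of_ne hρ (by have := c.pos; omega)]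
        · simp
        · rwa [(c.eq_iff _ (0 - r)).2]
          push_cast
          simp
    | zero => simp
    | add x y _ _ hx hy => rw [smul_add]; exact add_mem hx hy
    | smul t x _ hx => rw [smul_comm]; exact Submodule.smul_mem _ t hx

/-- The corner of the cycle is spanned by the powers of the cycle. -/
theorem p_mul_mul_p (hρ : IsString ρ) (a : UAlg k ρ) :
    ∃ h : Polynomial k, c.p k * a * c.p k = Polynomial.aeval (c.p k) h * c.p k := by
  rw [mul_assoc]
  have hb := c.mul_p_mem hρ a
  generalize a * c.p k = b at hb ⊢
  induction hb using Submodule.span_induction with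
  | mem x hx =>
    obtain ⟨r, rfl⟩ := hx
    have hn := c.pos
    dsimp only
    rw [← seg_zero_add]
    by_cases hr : (c.n : ℤ) ∣ r
    · obtain ⟨e, rfl⟩ := Int.natCast_dvd_natCast.1 hr
      refine ⟨Polynomial.X ^ (e + 1), ?_⟩
      rw [show c.n + c.n * e = c.n * (e + 1) by ring, seg_mul, map_pow, Polynomial.aeval_X,
        ← pow_succ, ← pow_succ']
    · refine ⟨0, ?_⟩
      rw [map_zero, zero_mul]
      refine c.seg_mul_seg_of_not_dvd hρ (by omega) hn ?_
      rwa [show (0 : ℤ) - (0 - ((c.n + r : ℕ) : ℤ)) = c.n * 1 + r by push_cast; ring,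
        dvd_add_right (Dvd.intro _ rfl)]
  | zero => exact ⟨0, by simp⟩
  | add x y _ _ hx hy =>
    obtain ⟨h, hx⟩ := hx
    obtain ⟨h', hy⟩ := hy
    exact ⟨h + h', by rw [mul_add, hx, hy, map_add, add_mul]⟩
  | smul t x _ hx =>
    obtain ⟨h, hx⟩ := hx
    exact ⟨t • h, by rw [mul_smul_comm, hx, map_smul, smul_mul_assoc]⟩

end Cyc

/-! ### Primitive cycles as periodic sequences of arrows. -/

theorem arrows_injective {a b : Q} {p q : Quiver.Path a b} (h : arrows p = arrows q) : p = q := by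
  induction p with
  | nil =>
    cases q with
    | nil => rfl
    | cons q x => simp [arrows] at h
  | cons p x ih =>
    cases q with
    | nil => simp [arrows] at h
    | cons q y =>
      simp only [arrows, List.cons.injEq, Quiver.Total.mk.injEq] at h
      obtain ⟨⟨rfl, _, h1⟩, h2⟩ := h
      rw [eq_of_heq h1, ih h2]

theorem Cyc.pathElt_eq_seg (k : Type u) [Field k] (c : Cyc ρ) (i : ℤ) {a b : Q}
    (P : Quiver.Path a b)
    (h : ∀ t : ℕ, t < P.length → (arrows P)[t]? = some (c.X (i - P.length + 1 + t)))
    (h0 : P.length = 0 → (c.X i).left = a) :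
    pathElt k ρ ⟨a, b, P⟩ = c.seg k i P.length ∧ (c.X i).left = a := by
  induction P with
  | nil =>
    have := h0 rfl
    subst this
    exact ⟨rfl, rfl⟩
  | @cons d b P x ih =>
    have h1 : c.X (i - P.length) = ⟨d, b, x⟩ := by
      have := h 0 (by simp)
      simp only [arrows, Quiver.Path.length_cons, List.getElem?_cons_zero,
        Option.some.injEq] at this
      rw [this]
      congr 1
      push_cast
      ring
    obtain ⟨h2, h3⟩ := ih (fun t ht => by
      have := h (t + 1) (by simpa using ht)
      rw [arrows, List.getElem?_cons_succ] at this
      rw [this]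
      congr 2
      simp only [Quiver.Path.length_cons]
      push_cast
      ring) (fun h0 => by
      have := Quiver.Path.eq_of_length_zero P h0
      rw [h0] at h1
      simp only [Nat.cast_zero, sub_zero] at h1
      rw [h1, this])
    exact ⟨by rw [pathElt_cons, h2, Quiver.Path.length_cons, Cyc.seg_succ, h1], h3⟩

/-- The sequence of arrows of a primitive cycle. -/
structure Cyc.Represents (c : Cyc ρ) {a : Q} (P : Quiver.Path a a) : Prop where
  length : c.n = P.length
  arrows : ∀ i : ℤ, (arrows P)[((i - 1) % (P.length : ℤ)).toNat]? = some (c.X i)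

/-- Minimality of the period makes the arrows within one period distinct: a coincidence `X i = X j`
spreads to the whole sequence by `eq_of_allowed`, so `i - j` modulo the length would be a shorter
period. -/
theorem IsPrimitiveCycle.exists_cyc (hρ : IsString ρ) {a : Q} {P : Quiver.Path a a}
    (hP : IsPrimitiveCycle ρ P) : ∃ c : Cyc ρ, c.Represents P := by
  obtain ⟨C, hC, hper⟩ := hP
  have hn := hper.pos
  have h1 : ∀ i : ℤ, ∃ x : Arrow Q, (arrows P)[((i - 1) % (P.length : ℤ)).toNat]? = some x := by
    intro i
    have := Int.emod_lt_of_pos (i - 1) (Int.natCast_pos.2 hn)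
    have := Int.emod_nonneg (i - 1) (Int.natCast_pos.2 hn).ne'
    exact ⟨_, List.getElem?_eq_getElem (by rw [length_arrows]; omega)⟩
  choose X hX using h1
  have hl : ∀ i, C.letter i = some (.dir (X i)) := fun i => by
    rw [hC.2, dirLetters, List.getElem?_map, hX]; rfl
  have hal : ∀ i, Allowed ρ (X i) (X (i + 1)) := fun i => C.allowed_of_dir (hl i) (hl _)
  have hi : ∀ i j, C.letter i = C.letter j ↔ X i = X j := fun i j => by simp [hl]
  refine ⟨⟨X, P.length, hn, hal, fun i j => ⟨fun h => ?_, fun ⟨m, hm⟩ => ?_⟩⟩, rfl, hX⟩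
  · have h2 := eq_of_allowed hρ hal hal h
    rw [Int.dvd_iff_emod_eq_zero]
    by_contra h0
    have h3 := Int.emod_lt_of_pos (i - j) (Int.natCast_pos.2 hn)
    have h4 := Int.emod_nonneg (i - j) (Int.natCast_pos.2 hn).ne'
    obtain ⟨m, hm⟩ := Int.eq_ofNat_of_zero_le h4
    have := hper.minimal m (by omega) (fun l => by
      rw [← hm, Int.emod_def, show l + (i - j - P.length * ((i - j) / P.length)) =
        l + (i - j) - ((i - j) / P.length) * P.length by ring, hper.letter_sub, hi]
      have := h2 (l - j)
      rwa [show i + (l - j) = l + (i - j) by ring, show j + (l - j) = l by ring] at this)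
    omega
  · rw [← hi, show j = i - m * P.length by linarith, hper.letter_sub]

namespace Cyc.Represents

variable {c : Cyc ρ} {a : Q} {P : Quiver.Path a a}

theorem getElem? (h : c.Represents P) {t : ℕ} (ht : t < P.length) :
    (StringAlg.arrows P)[t]? = some (c.X (t + 1)) := by
  rw [← h.arrows (t + 1), add_sub_cancel_right, Int.emod_eq_of_lt (by omega) (by omega)]
  simp

theorem pathElt_eq (h : c.Represents P) (k : Type u) [Field k] :
    pathElt k ρ ⟨a, a, P⟩ = c.p k ∧ (c.X 0).left = a := by
  rw [Cyc.p, h.length]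
  refine c.pathElt_eq_seg k 0 P (fun t ht => ?_) fun h0 => ?_
  · rw [h.getElem? ht]
    congr 1
    rw [c.eq_iff, h.length]
    exact ⟨1, by ring⟩
  · have := c.pos
    have := h.length
    omega

theorem getElem?_dirLetters (h : c.Represents P) {t : ℕ} (ht : t < P.length) :
    (dirLetters P)[t]? = some (.dir (c.X (t + 1))) := by
  rw [dirLetters, List.getElem?_map, h.getElem? ht]
  rfl

theorem getElem?_invLetters (h : c.Represents P) (t : ℕ) :
    (invLetters P)[t % P.length]? = some (.inv (c.X (-t))) := by
  have hn : 0 < P.length := h.length ▸ c.pos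
  have ht := Nat.mod_lt t hn
  rw [invLetters, List.getElem?_map, List.getElem?_reverse (by rwa [length_arrows]),
    length_arrows, h.getElem? (by omega)]
  simp only [Option.map_some, Option.some.injEq, Letter.inv.injEq]
  rw [c.eq_iff, h.length]
  have := Nat.mod_add_div t P.length
  refine ⟨1 + t / P.length, ?_⟩
  zify at this
  rw [mul_add, ← sub_eq_zero]
  have h3 : ((P.length - 1 - t % P.length : ℕ) : ℤ) = P.length - 1 - (t % P.length : ℤ) := by
    push_cast [Nat.cast_sub (show t % P.length ≤ P.length - 1 by omega),
      Nat.cast_sub (show 1 ≤ P.length by omega)]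
    ring
  rw [h3]
  linarith

end Cyc.Represents

/-- The arrow traversed first determines the bi-infinite sequence of arrows, which in turn
determines its minimal period. -/
theorem Cyc.Represents.ext (hρ : IsString ρ) {a : Q} {P P' : Quiver.Path a a} {c c' : Cyc ρ}
    (h : c.Represents P) (h' : c'.Represents P') (h0 : c.X 0 = c'.X 0) : P = P' := by
  have h1 : ∀ i, c.X i = c'.X i := fun i => by
    simpa using eq_of_allowed hρ c.allowed c'.allowed h0 i
  have h2 : c.n = c'.n := by
    refine Nat.dvd_antisymm ?_ ?_
    · have := (c'.eq_iff c'.n 0).2 (by simp)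
      rw [← h1, ← h1, c.eq_iff, sub_zero] at this
      exact Int.natCast_dvd_natCast.1 this
    · have := (c.eq_iff c.n 0).2 (by simp)
      rw [h1, h1, c'.eq_iff, sub_zero] at this
      exact Int.natCast_dvd_natCast.1 this
  refine arrows_injective (List.ext_getElem? fun t => ?_)
  have h3 : P.length = P'.length := by rw [← h.length, ← h'.length, h2]
  rcases lt_or_ge t P.length with ht | ht
  · rw [h.getElem? ht, h'.getElem? (h3 ▸ ht), h1]
  · rw [List.getElem?_eq_none (by rwa [length_arrows]),
      List.getElem?_eq_none (by rwa [length_arrows, ← h3])]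

theorem finite_primitiveCycles (hρ : IsString ρ) (a : Q) :
    Finite {P : Quiver.Path a a // IsPrimitiveCycle ρ P} := by
  have hf : {x : Arrow Q | x.left = a}.Finite :=
    Set.finite_of_encard_le_coe (k := 2) (hρ.tails a)
  have := hf.to_subtype
  choose c hc using fun P : {P : Quiver.Path a a // IsPrimitiveCycle ρ P} => P.2.exists_cyc hρ
  refine Finite.of_injective (β := {x : Arrow Q | x.left = a})
    -- The field ℚ is a dummy: only the tail of the first traversed arrow matters here.
    (fun P => ⟨(c P).X 0, ((hc P).pathElt_eq ℚ).2⟩) fun P P' h => ?_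
  exact Subtype.ext ((hc P).ext hρ (hc P') (congrArg Subtype.val h))

/-! ### The element z on the image of a primitive cycle. -/

variable (k : Type u) [Field k]

/-- Another primitive cycle at `a` is entered by an arrow other than `c.X 0`, and `c.X 0` is the
only arrow that can follow p; so its product with p is zero. -/
theorem zElt_mul_p (hρ : IsString ρ) {a : Q} {P : Quiver.Path a a} (hP : IsPrimitiveCycle ρ P)
    {c : Cyc ρ} (hc : c.Represents P) : zElt k ρ a * c.p k = c.p k * c.p k := by
  have := finite_primitiveCycles hρ a
  have := Fintype.ofFinite {P : Quiver.Path a a // IsPrimitiveCycle ρ P}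
  rw [zElt, finsum_eq_sum_of_fintype, Finset.sum_mul, Finset.sum_eq_single ⟨P, hP⟩]
  · rw [(hc.pathElt_eq k).1]
  · rintro ⟨P', hP'⟩ - hne
    obtain ⟨c', hc'⟩ := hP'.exists_cyc hρ
    rw [(hc'.pathElt_eq k).1]
    have h0 : c'.X 0 ≠ c.X 0 := fun h => hne (Subtype.ext (hc'.ext hρ hc h))
    obtain ⟨n, hn⟩ := Nat.exists_eq_add_of_lt c'.pos
    rw [zero_add] at hn
    rw [Cyc.p, hn, add_comm, Cyc.seg_add, mul_assoc, Cyc.seg_succ, Cyc.seg]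
    have h1 : arrowElt k ρ (c'.X (0 - ((0 : ℕ) : ℤ))) * idem k ρ (c'.X 0).left =
        arrowElt k ρ (c'.X 0) := by
      simpa using arrowElt_mul_idem (c'.X 0)
    rw [h1, Cyc.p, c.arrowElt_mul_seg_of_ne hρ c.pos, mul_zero]
    rwa [(c.eq_iff (0 - c.n) 0).2 (by simp)]
  · simp

end Cycles

/-! ### Words seen from a given position in a given direction -/

/-- A position in a word, together with a direction. -/
structure Flag where
  i : ℤ
  d : Bool

namespace Flag

variable (s : Flag)

/-- The position at distance `l` in the given direction. -/
def pos (l : ℤ) : ℤ := if s.d then s.i + l else s.i - l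

/-- The signed distance of a position. -/
def rel (j : ℤ) : ℤ := if s.d then j - s.i else s.i - j

/-- Move the position by `m` steps in the given direction. -/
def shift (m : ℤ) : Flag := ⟨s.pos m, s.d⟩

@[simp] theorem pos_zero : s.pos 0 = s.i := by simp [pos]

@[simp] theorem rel_pos (l : ℤ) : s.rel (s.pos l) = l := by
  rcases s with ⟨i, _ | _⟩ <;> simp [rel, pos]

@[simp] theorem pos_rel (j : ℤ) : s.pos (s.rel j) = j := by
  rcases s with ⟨i, _ | _⟩ <;> simp [rel, pos]

theorem pos_shift (m l : ℤ) : (s.shift m).pos l = s.pos (m + l) := by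
  rcases s with ⟨i, _ | _⟩ <;> simp [shift, pos] <;> ring

end Flag

section Flags

variable {Q : Type v} [Quiver.{w} Q] {ρ : Set (QPath Q)}

theorem Letter.inverse_inverse (l : Letter Q) : l.inverse.inverse = l := by cases l <;> rfl

theorem Letter.head_inverse (l : Letter Q) : l.inverse.head = l.tail := by cases l <;> rfl

namespace Word

variable (C : Word ρ) (s : Flag)

/-- The letter number `l` of `C`, seen from the flag `s`. -/
def letterAt (l : ℤ) : Option (Letter Q) :=
  if s.d then C.letter (s.i + l) else (C.letter (s.i + 1 - l)).map Letter.inverse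

theorem letterAt_shift (m l : ℤ) : C.letterAt (s.shift m) l = C.letterAt s (m + l) := by
  rcases s with ⟨i, _ | _⟩ <;> simp [letterAt, Flag.shift, Flag.pos]
  · rw [show i - m + 1 - l = i + 1 - (m + l) by ring]
  · rw [add_assoc]

variable {C s}

theorem mem_of_letterAt {l : ℤ} {x : Letter Q} (h : C.letterAt s l = some x) :
    s.pos l ∈ C.shape.idx ∧ s.pos (l - 1) ∈ C.shape.idx := by
  rcases s with ⟨i, _ | _⟩
  · simp only [letterAt, Bool.false_eq_true, if_false, Option.map_eq_some_iff] at h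
    obtain ⟨y, hy, -⟩ := h
    have := StringModule.mem_of_letter hy
    simp only [Flag.pos, Bool.false_eq_true, if_false]
    rw [show i - (l - 1) = i + 1 - l by ring, show i - l = i + 1 - l - 1 by ring]
    exact ⟨this.2, this.1⟩
  · simp only [letterAt, if_true] at h
    have := StringModule.mem_of_letter h
    simp only [Flag.pos, if_true]
    rw [← add_sub_assoc]
    exact this

theorem vertex_head_at {l : ℤ} {x : Letter Q} (h : C.letterAt s (l + 1) = some x) :
    C.vertex (s.pos l) = some x.head := by
  rcases s with ⟨i, _ | _⟩
  · simp only [letterAt, Bool.false_eq_true, if_false, Option.map_eq_some_iff] at h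
    obtain ⟨y, hy, rfl⟩ := h
    have := C.vertex_tail _ _ hy
    rw [Letter.head_inverse, ← this]
    simp only [Flag.pos, Bool.false_eq_true, if_false]
    congr 1
    ring
  · simp only [letterAt, if_true] at h
    have := C.vertex_head _ _ h
    rw [← this]
    simp only [Flag.pos, if_true]
    congr 1
    ring

theorem letterAt_succ_ne {l : ℤ} {x : Letter Q} (h : C.letterAt s l = some x) :
    C.letterAt s (l + 1) ≠ some x.inverse := by
  rcases s with ⟨i, _ | _⟩
  · simp only [letterAt, Bool.false_eq_true, if_false, Option.map_eq_some_iff, ne_eq] at h ⊢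
    obtain ⟨y, hy, rfl⟩ := h
    rintro ⟨z, hz, h'⟩
    rw [Letter.inverse_inverse] at h'
    refine C.not_inverse _ _ hz ?_
    rw [h', ← hy]
    congr 1
    ring
  · simp only [letterAt, if_true] at h ⊢
    have := C.not_inverse _ _ h
    rwa [add_assoc] at this

theorem allowed_of_letterAt_inv {l : ℤ} {x y : Arrow Q} (hx : C.letterAt s l = some (.inv x))
    (hy : C.letterAt s (l + 1) = some (.inv y)) : Allowed ρ y x := by
  rcases s with ⟨i, _ | _⟩
  · simp only [letterAt, Bool.false_eq_true, if_false, Option.map_eq_some_iff] at hx hy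
    obtain ⟨x', hx', hx⟩ := hx
    obtain ⟨y', hy', hy⟩ := hy
    have hx2 : x' = .dir x := by rw [← x'.inverse_inverse, hx]; rfl
    have hy2 : y' = .dir y := by rw [← y'.inverse_inverse, hy]; rfl
    subst hx2 hy2
    refine C.allowed_of_dir hy' ?_
    rw [← hx']
    congr 1
    ring
  · simp only [letterAt, if_true] at hx hy
    rw [← add_assoc] at hy
    exact C.allowed_of_inv hx hy

variable (C s)

/-- The letter number `l` is the one which occurs at this place in `(P⁻¹)^∞`. -/
def Good (c : Cyc ρ) (l : ℤ) : Prop := C.letterAt s l = some (.inv (c.X (1 - l)))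

/-- The word at the flag `s` is `(P⁻¹)^∞`. -/
def Deep (c : Cyc ρ) : Prop := ∀ l, 1 ≤ l → C.Good s c l

/-- The flag `s` is a peak. -/
def Peak (c : Cyc ρ) : Prop := C.Deep s c ∧ ∃ t : ℕ, t < c.n ∧ ¬ C.Good s c (-t)

theorem good_shift {c : Cyc ρ} {m : ℤ} (hm : (c.n : ℤ) ∣ m) (l : ℤ) :
    C.Good (s.shift m) c l ↔ C.Good s c (m + l) := by
  rw [Good, Good, letterAt_shift, (c.eq_iff (1 - l) (1 - (m + l))).2 (by ring_nf; exact hm)]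

/-- The letters number 0, -1, …, 1 - n, inverted, are the first n letters of the opposite word. They
are all good exactly when this word begins with P. -/
theorem isPeak_of_peak {c : Cyc ρ} {a : Q} {P : Quiver.Path a a} (hc : c.Represents P)
    (h : C.Peak s c) : C.IsPeak P s.i := by
  obtain ⟨h1, t, ht, h2⟩ := h
  refine ⟨?_, s.d, fun m => ?_, fun h3 => h2 ?_⟩
  · have := (mem_of_letterAt (h1 1 le_rfl)).2
    simpa using this
  · rw [hc.getElem?_invLetters]
    have := h1 (m + 1) (by omega)
    rw [Good, show (1 : ℤ) - (m + 1) = -m by ring] at this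
    rw [← this]
    rcases s with ⟨i, _ | _⟩
    · simp only [side, letterAt, Bool.false_eq_true, if_false]
      congr 2
      ring
    · simp only [side, letterAt, if_true]
      congr 1
      ring
  · rw [hc.length] at ht
    have := h3 t ht
    rw [hc.getElem?_dirLetters ht] at this
    rw [Good, sub_neg_eq_add, add_comm 1]
    rcases s with ⟨i, _ | _⟩
    · simp only [side, letterAt, Bool.not_false, Bool.false_eq_true, if_false, if_true] at this ⊢
      rw [show i + 1 - (-(t : ℤ)) = i + 1 + t by ring, this]
      rfl
    · simp only [side, letterAt, Bool.not_true, Bool.false_eq_true, if_false, if_true,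
        Option.map_eq_some_iff] at this ⊢
      obtain ⟨y, hy, hy'⟩ := this
      rw [← sub_eq_add_neg, hy, ← y.inverse_inverse, hy']
      rfl

end Word

/-! ### String modules seen from a flag -/

namespace StringModule

variable {k : Type u} [Field k] {C : Word ρ}

instance : IsScalarTower k (UAlg k ρ) (StringModule k C) :=
  ⟨fun t a m => by rw [smul_def, smul_def, map_smul]; rfl⟩

theorem b_mem_span (y : StringModule k C) :
    y ∈ Submodule.span k {y | ∃ i ∈ C.shape.idx, y = b k C i} := by
  refine Finsupp.induction_linear y (zero_mem _) (fun _ _ => add_mem) fun i t => ?_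
  have : (Finsupp.single i t : C.shape.idx →₀ k) = t • (b k C i : StringModule k C) := by
    rw [b, dif_pos i.2]
    exact (Finsupp.smul_single_one i t).symm
  rw [this]
  exact Submodule.smul_mem _ _ (Submodule.subset_span ⟨i, i.2, rfl⟩)

variable (k C) (s : Flag)

/-- The basis element at distance `l` from the flag `s`. -/
def bAt (l : ℤ) : StringModule k C := b k C (s.pos l)

theorem bAt_shift (m l : ℤ) : bAt k C (s.shift m) l = bAt k C s (m + l) := by
  rw [bAt, bAt, Flag.pos_shift]

variable {k C s}

theorem idem_smul_bAt (a : Q) {l : ℤ} (hl : s.pos l ∈ C.shape.idx) :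
    idem k ρ a • bAt k C s l = if C.vertex (s.pos l) = some a then bAt k C s l else 0 :=
  idem_smul_b a hl

theorem arrowElt_smul_bAt (x : Arrow Q) {l : ℤ} (hl : s.pos l ∈ C.shape.idx) :
    arrowElt k ρ x • bAt k C s l =
      if C.letterAt s l = some (.dir x) then bAt k C s (l - 1)
      else if C.letterAt s (l + 1) = some (.inv x) then bAt k C s (l + 1)
      else 0 := by
  rw [bAt, arrowElt_smul_b x hl]
  have hinv : ∀ y : Letter Q, y.inverse = .dir x ↔ y = .inv x := by
    rintro (y | y) <;> simp [Letter.inverse]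
  have hdir : ∀ y : Letter Q, y.inverse = .inv x ↔ y = .dir x := by
    rintro (y | y) <;> simp [Letter.inverse]
  rcases s with ⟨i, _ | _⟩
  · simp only [bAt, Word.letterAt, Flag.pos, Bool.false_eq_true, if_false, Option.map_eq_some_iff,
      hinv, hdir, exists_eq_right]
    rw [show i + 1 - (l + 1) = i - l by ring, show i - l + 1 = i + 1 - l by ring,
      show i - l - 1 = i - (l + 1) by ring, show i - (l - 1) = i + 1 - l by ring]
    by_cases h1 : C.letter (i - l) = some (.dir x)
    · have : C.letter (i - l + 1) ≠ some (.inv x) := C.not_inverse _ _ h1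
      rw [show i - l + 1 = i + 1 - l by ring] at this
      rw [if_pos h1, if_neg this, if_pos h1]
    · rw [if_neg h1, if_neg h1]
  · simp only [bAt, Word.letterAt, Flag.pos, if_true]
    rw [add_sub_assoc, add_assoc]

/-- The linear map with given values on the basis elements. -/
def linAt {A : Type*} [AddCommGroup A] [Module k A] (s : Flag) (f : ℤ → A) :
    StringModule k C →ₗ[k] A :=
  lin C fun j => f (s.rel j)

theorem linAt_bAt {A : Type*} [AddCommGroup A] [Module k A] (f : ℤ → A) {l : ℤ}
    (hl : s.pos l ∈ C.shape.idx) : linAt s f (bAt k C s l) = f l := by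
  rw [linAt, bAt, lin_b C _ hl, Flag.rel_pos]

theorem hom_extAt {A : Type*} [AddCommGroup A] [Module k A] {f g : StringModule k C →ₗ[k] A}
    (s : Flag) (h : ∀ l, s.pos l ∈ C.shape.idx → f (bAt k C s l) = g (bAt k C s l)) : f = g := by
  refine hom_ext fun i hi => ?_
  have := h (s.rel i) (by simpa using hi)
  simpa [bAt] using this

/-- The coefficient of the basis element at distance `l`. -/
def coeffAt (s : Flag) (l : ℤ) : StringModule k C →ₗ[k] k := linAt s fun m => if m = l then 1 else 0

theorem coeffAt_bAt {l m : ℤ} (hl : s.pos l ∈ C.shape.idx) :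
    coeffAt s m (bAt k C s l) = if l = m then 1 else 0 := linAt_bAt _ hl

theorem bAt_mem_span (s : Flag) (y : StringModule k C) :
    y ∈ Submodule.span k {y | ∃ l, s.pos l ∈ C.shape.idx ∧ y = bAt k C s l} := by
  refine Submodule.span_mono ?_ (b_mem_span y)
  rintro _ ⟨i, hi, rfl⟩
  exact ⟨s.rel i, by simpa using hi, by simp [bAt]⟩

theorem exists_finset_eq_sum (s : Flag) (y : StringModule k C) :
    ∃ T : Finset ℤ, (∀ l ∈ T, s.pos l ∈ C.shape.idx) ∧
      y = ∑ l ∈ T, coeffAt s l y • bAt k C s l := by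
  suffices h : ∃ (T : Finset ℤ) (a : ℤ → k), (∀ l ∈ T, s.pos l ∈ C.shape.idx) ∧
      y = ∑ l ∈ T, a l • bAt k C s l by
    obtain ⟨T, a, hT, h⟩ := h
    refine ⟨T, hT, ?_⟩
    conv_lhs => rw [h]
    refine Finset.sum_congr rfl fun l hl => ?_
    congr 1
    rw [h, map_sum, Finset.sum_eq_single l]
    · simp [coeffAt_bAt (hT l hl)]
    · intro m hm hne
      simp [coeffAt_bAt (hT m hm), hne]
    · exact fun h => absurd hl h
  have := bAt_mem_span s y
  induction this using Submodule.span_induction with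
  | mem y hy =>
    obtain ⟨l, hl, rfl⟩ := hy
    exact ⟨{l}, fun _ => 1, by simpa using hl, by simp⟩
  | zero => exact ⟨∅, 0, by simp, by simp⟩
  | add y z _ _ hy hz =>
    obtain ⟨T, a, hT, hy⟩ := hy
    obtain ⟨T', a', hT', hz⟩ := hz
    refine ⟨T ∪ T', fun l => (if l ∈ T then a l else 0) + (if l ∈ T' then a' l else 0), ?_, ?_⟩
    · intro l hl
      rcases Finset.mem_union.1 hl with h | h
      exacts [hT l h, hT' l h]
    · simp only [add_smul, Finset.sum_add_distrib, ite_smul, zero_smul, Finset.sum_ite_mem]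
      rw [Finset.inter_eq_right.2 Finset.subset_union_left,
        Finset.inter_eq_right.2 Finset.subset_union_right, ← hy, ← hz]
  | smul t y _ hy =>
    obtain ⟨T, a, hT, hy⟩ := hy
    exact ⟨T, fun l => t * a l, hT, by simp only [mul_smul, ← Finset.smul_sum, ← hy]⟩

/-! #### The action of a primitive cycle -/

variable {c : Cyc ρ}

theorem idem_smul_bAt_of_good {l : ℤ} (h : C.Good s c (l + 1)) :
    idem k ρ (c.X (-l)).left • bAt k C s l = bAt k C s l := by
  have h1 := Word.vertex_head_at h
  have h2 := (Word.mem_of_letterAt h).2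
  rw [add_sub_cancel_right] at h2
  rw [idem_smul_bAt _ h2, if_pos]
  rw [h1, show (1 : ℤ) - (l + 1) = -l by ring]
  rfl

theorem arrowElt_smul_bAt_of_good {l : ℤ} (h : C.Good s c (l + 1)) :
    arrowElt k ρ (c.X (-l)) • bAt k C s l = bAt k C s (l + 1) := by
  have h2 := (Word.mem_of_letterAt h).2
  rw [add_sub_cancel_right] at h2
  rw [Word.Good, show (1 : ℤ) - (l + 1) = -l by ring] at h
  rw [arrowElt_smul_bAt _ h2, if_pos h, if_neg]
  intro h3
  exact Word.letterAt_succ_ne h3 h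

theorem seg_smul_bAt_of_good {l : ℤ} {r : ℕ} (h1 : C.Good s c (l + 1))
    (h : ∀ m, l < m → m ≤ l + r → C.Good s c m) :
    c.seg k (-l) r • bAt k C s l = bAt k C s (l + r) := by
  induction r with
  | zero => simpa [Cyc.seg] using idem_smul_bAt_of_good h1
  | succ r ih =>
    rw [Cyc.seg_succ, mul_smul, ih fun m hm hm' => h m hm (by push_cast; omega),
      show -l - (r : ℤ) = -(l + r) by ring,
      arrowElt_smul_bAt_of_good (h _ (by omega) (by push_cast; omega))]
    congr 1
    push_cast
    ring

theorem seg_smul_bAt_of_deep (h : C.Deep s c) (r : ℕ) :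
    c.seg k 0 r • bAt k C s 0 = bAt k C s r := by
  simpa using seg_smul_bAt_of_good (k := k) (l := 0) (r := r) (h 1 le_rfl)
    fun m hm _ => h m (by omega)

theorem p_pow_smul_bAt_of_deep (h : C.Deep s c) (e : ℕ) :
    c.p k ^ e • bAt k C s 0 = bAt k C s (c.n * e) := by
  cases e with
  | zero => simp
  | succ e =>
    rw [← Cyc.seg_mul, seg_smul_bAt_of_deep h]
    push_cast
    rfl

/-- Since r ≤ n(r + 1), the path of length r is a right factor of the power of the cycle. -/
theorem p_pow_smul_of_seg_smul {y : StringModule k C} {r : ℕ} (h : c.seg k 0 r • y = 0) :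
    c.p k ^ (r + 1) • y = 0 := by
  have hn := c.pos
  have : c.n * (r + 1) = r + (c.n * (r + 1) - r) := by
    have : 1 * (r + 1) ≤ c.n * (r + 1) := Nat.mul_le_mul_right _ hn
    omega
  rw [← Cyc.seg_mul, this, Cyc.seg_add, mul_smul, h, smul_zero]

/-- If the word at `s` begins with the last arrow of the cycle, then the cycle is nilpotent at this
basis element, or the word is `(P⁻¹)^∞`. -/
theorem deep_or_nilpotent (h : C.Good s c 1) :
    C.Deep s c ∨ ∃ N, c.p k ^ N • bAt k C s 0 = 0 := by
  by_cases hd : C.Deep s c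
  · exact Or.inl hd
  right
  have h1 : ∃ r : ℕ, ¬ C.Good s c (r + 1) := by
    by_contra! h1
    refine hd fun l hl => ?_
    have := h1 (l - 1).toNat
    rwa [Int.toNat_of_nonneg (by omega), sub_add_cancel] at this
  have h2 := Nat.find_spec h1
  set r := Nat.find h1 with hr
  have h3 : ∀ m : ℤ, 0 < m → m ≤ r → C.Good s c m := fun m hm hm' => by
    have := Nat.find_min h1 (m := (m - 1).toNat) (by omega)
    rwa [not_not, Int.toNat_of_nonneg (by omega), sub_add_cancel] at this
  have h0 : 0 < r := by
    rcases Nat.eq_zero_or_pos r with h0 | h0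
    · rw [h0] at h2
      exact absurd (by simpa using h) h2
    · exact h0
  have h4 := seg_smul_bAt_of_good (k := k) (l := 0) (r := r) h (by simpa using h3)
  -- The letter number `r` is inverse and the next one is not the inverse of `c.X (-r)`. Hence this
  -- arrow kills the basis vector at distance `r`, and the path of length `r + 1` kills the initial
  -- one.
  refine ⟨r + 2, p_pow_smul_of_seg_smul ?_⟩
  rw [neg_zero, zero_add] at h4
  rw [Cyc.seg_succ, mul_smul, h4]
  have h5 := h3 r (by omega) le_rfl
  rw [arrowElt_smul_bAt _ (Word.mem_of_letterAt h5).1, if_neg, if_neg]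
  · rw [Word.Good, show (1 : ℤ) - (r + 1) = 0 - r by ring] at h2
    exact h2
  · rw [Word.Good] at h5
    rw [h5]
    simp

/-- The arrow `c.X 0`, which p applies first, kills the basis vector unless one of the two words
there begins with its inverse. -/
theorem exists_deep_or_nilpotent {j : ℤ} (hj : j ∈ C.shape.idx) (c : Cyc ρ) :
    (∃ d, C.Deep ⟨j, d⟩ c) ∨ ∃ N, c.p k ^ N • b k C j = 0 := by
  by_cases h : ∃ d, C.Good ⟨j, d⟩ c 1
  · obtain ⟨d, hd⟩ := h
    rcases deep_or_nilpotent (k := k) hd with h | ⟨N, h⟩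
    · exact Or.inl ⟨d, h⟩
    · exact Or.inr ⟨N, by simpa [bAt] using h⟩
  · push Not at h
    right
    refine ⟨2, p_pow_smul_of_seg_smul ?_⟩
    rw [Cyc.seg_succ, Cyc.seg, mul_smul]
    have h1 : arrowElt k ρ (c.X 0) • b k C j = 0 := by
      rw [arrowElt_smul_b _ hj, if_neg, if_neg]
      · intro h1
        apply h true
        simpa [Word.Good, Word.letterAt] using h1
      · intro h1
        apply h false
        simp [Word.Good, Word.letterAt, h1, Letter.inverse]
    rw [Nat.cast_zero, sub_zero, ← mul_smul, arrowElt_mul_idem, h1]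

end StringModule

end Flags

section Peaks

variable {Q : Type v} [Quiver.{w} Q] {ρ : Set (QPath Q)} {C : Word ρ} {s : Flag} {c : Cyc ρ}

/-! ### Peaks -/

/-- A word which is `(P⁻¹)^∞` at `s` is `^∞(P⁻¹)^∞`, or one gets to a peak by going back. -/
theorem Word.Deep.peak_or_good (h : C.Deep s c) :
    (∀ l, C.Good s c l) ∨ ∃ e : ℕ, C.Peak (s.shift (-(c.n * e))) c := by
  by_cases hg : ∀ l, C.Good s c l
  · exact Or.inl hg
  right
  have h1 : ∃ t : ℕ, ¬ C.Good s c (-t) := by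
    by_contra! h1
    refine hg fun l => ?_
    rcases le_or_gt 1 l with hl | hl
    · exact h l hl
    · have := h1 (-l).toNat
      rwa [Int.toNat_of_nonneg (by omega), neg_neg] at this
  have h2 := Nat.find_spec h1
  -- The nearest bad letter behind the flag. Going back `t / n` full turns keeps the flag deep and
  -- brings this letter within the range required of a peak.
  set t := Nat.find h1 with ht
  have h3 : ∀ m : ℤ, -t < m → C.Good s c m := fun m hm => by
    rcases le_or_gt 1 m with hm' | hm'
    · exact h m hm'
    · have := Nat.find_min h1 (m := (-m).toNat) (by omega)
      rwa [not_not, Int.toNat_of_nonneg (by omega), neg_neg] at this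
  have hdiv := Nat.mod_add_div t c.n
  have hdvd : (c.n : ℤ) ∣ -(c.n * (t / c.n : ℕ)) := ⟨-(t / c.n : ℕ), by ring⟩
  zify at hdiv
  have hmod : (0 : ℤ) ≤ (t : ℤ) % c.n := Int.emod_nonneg _ (by have := c.pos; omega)
  refine ⟨t / c.n, fun l hl => ?_, t % c.n, Nat.mod_lt _ c.pos, ?_⟩
  · rw [C.good_shift s hdvd]
    refine h3 _ ?_
    push_cast
    linarith
  · rw [C.good_shift s hdvd]
    rwa [show -((c.n : ℤ) * (t / c.n : ℕ)) + -((t % c.n : ℕ) : ℤ) = -t by push_cast; linarith]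

/-- Two deep flags of the same direction share a letter; as the arrows of the cycle are distinct
within a period, their distance is a multiple of n. A deep flag a full turn or more before the peak
would make its bad letter good. -/
theorem Word.Peak.dvd_of_deep (h : C.Peak s c) {r : ℤ} (hr : C.Deep (s.shift r) c) :
    0 ≤ r ∧ (c.n : ℤ) ∣ r := by
  have hdvd : (c.n : ℤ) ∣ r := by
    rcases le_or_gt 0 r with h0 | h0
    · have h1 := hr 1 le_rfl
      have h2 := h.1 (r + 1) (by omega)
      rw [Word.Good, Word.letterAt_shift] at h1
      rw [Word.Good, h1, Option.some.injEq, Letter.inv.injEq, c.eq_iff] at h2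
      convert h2 using 1
      ring
    · have h1 := hr (-r + 1) (by omega)
      have h2 := h.1 1 le_rfl
      rw [Word.Good, Word.letterAt_shift, add_neg_cancel_left] at h1
      rw [Word.Good, h1, Option.some.injEq, Letter.inv.injEq, c.eq_iff] at h2
      convert h2 using 1
      ring
  refine ⟨?_, hdvd⟩
  by_contra! h0
  obtain ⟨t, ht, hbad⟩ := h.2
  apply hbad
  have h1 : (c.n : ℤ) ≤ -r := Int.le_of_dvd (by omega) ((dvd_neg).2 hdvd)
  have := hr (-r - t) (by omega)
  rw [C.good_shift s hdvd] at this
  rwa [show r + (-r - (t : ℤ)) = -t by ring] at this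

namespace StringModule

variable {k : Type u} [Field k]

theorem bAt_of_deep_of_peak (h : C.Peak s c) {r : ℤ} (hr : C.Deep (s.shift r) c) :
    ∃ e : ℕ, bAt k C s r = c.p k ^ e • bAt k C s 0 := by
  obtain ⟨h0, e, rfl⟩ := h.dvd_of_deep hr
  have he : 0 ≤ e := by
    have := c.pos
    by_contra! he
    have : (c.n : ℤ) * e < 0 := mul_neg_of_pos_of_neg (by omega) he
    omega
  obtain ⟨e, rfl⟩ := Int.eq_ofNat_of_zero_le he
  exact ⟨e, (p_pow_smul_bAt_of_deep h.1 e).symm⟩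

open Polynomial in
/-- If `C` is not `^∞P^∞`, then every element of `M(C)` is a sum of an element on which the cycle
is nilpotent, and of multiples of peaks. -/
theorem exists_peak_decomposition (hC : ¬ ∃ s, ∀ l, C.Good s c l) (y : StringModule k C) :
    ∃ (N : ℕ) (y₀ : StringModule k C) (i : Bool → ℤ) (g : Bool → k[X]),
      c.p k ^ N • y₀ = 0 ∧ (∀ d, g d = 0 ∨ C.Peak ⟨i d, d⟩ c) ∧
      y = y₀ + (aeval (c.p k) (g true) • bAt k C ⟨i true, true⟩ 0 +
        aeval (c.p k) (g false) • bAt k C ⟨i false, false⟩ 0) := by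
  -- One peak serves all deep positions of a given direction. If there are none, the index 0 is a
  -- dummy and the corresponding polynomial will be 0.
  have h1 : ∀ d, ∃ i, ∀ j, C.Deep ⟨j, d⟩ c → C.Peak ⟨i, d⟩ c ∧
      ∃ e : ℕ, b k C j = c.p k ^ e • bAt k C ⟨i, d⟩ 0 := by
    intro d
    by_cases hd : ∃ j, C.Deep ⟨j, d⟩ c
    · obtain ⟨j, hj⟩ := hd
      obtain ⟨e, he⟩ := hj.peak_or_good.resolve_left fun h => hC ⟨_, h⟩
      set t : Flag := (⟨j, d⟩ : Flag).shift (-(c.n * e)) with ht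
      refine ⟨t.i, fun j' hj' => ⟨he, ?_⟩⟩
      have h2 : t.shift (t.rel j') = ⟨j', d⟩ := by
        rw [Flag.shift, Flag.pos_rel]
        rfl
      obtain ⟨e', he'⟩ := bAt_of_deep_of_peak (k := k) he (r := t.rel j') (h2 ▸ hj')
      exact ⟨e', by rw [bAt, Flag.pos_rel] at he'; exact he'⟩
    · exact ⟨0, fun j hj => absurd ⟨j, hj⟩ hd⟩
  choose i hi using h1
  have hy := b_mem_span y
  suffices h : ∃ (N : ℕ) (y₀ : StringModule k C) (g : Bool → k[X]),
      c.p k ^ N • y₀ = 0 ∧ (∀ d, g d = 0 ∨ C.Peak ⟨i d, d⟩ c) ∧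
      y = y₀ + (aeval (c.p k) (g true) • bAt k C ⟨i true, true⟩ 0 +
        aeval (c.p k) (g false) • bAt k C ⟨i false, false⟩ 0) by
    obtain ⟨N, y₀, g, h⟩ := h
    exact ⟨N, y₀, i, g, h⟩
  induction hy using Submodule.span_induction with
  | mem y hy =>
    obtain ⟨j, hj, rfl⟩ := hy
    rcases exists_deep_or_nilpotent (k := k) hj c with ⟨d, hd⟩ | ⟨N, hN⟩
    · obtain ⟨hp, e, he⟩ := hi d j hd
      refine ⟨0, 0, Pi.single d (X ^ e), by simp, fun d' => ?_, ?_⟩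
      · by_cases h : d' = d
        · subst h
          exact Or.inr hp
        · exact Or.inl (by simp [h])
      · rw [he]
        cases d <;> simp
    · exact ⟨N, _, 0, hN, fun _ => Or.inl rfl, by simp⟩
  | zero => exact ⟨0, 0, 0, by simp, fun _ => Or.inl rfl, by simp⟩
  | add y z _ _ hy hz =>
    obtain ⟨N, y₀, g, h1, h2, h3⟩ := hy
    obtain ⟨N', z₀, g', h1', h2', h3'⟩ := hz
    refine ⟨N + N', y₀ + z₀, g + g', ?_, fun d => ?_, ?_⟩
    · rw [smul_add, pow_add, mul_smul, mul_smul, h1', smul_zero, add_zero, ← mul_smul, ← pow_add,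
        add_comm, pow_add, mul_smul, h1, smul_zero]
    · rcases h2 d with h | h
      · rcases h2' d with h' | h'
        · exact Or.inl (by simp [h, h'])
        · exact Or.inr h'
      · exact Or.inr h
    · rw [h3, h3']
      simp only [Pi.add_apply, map_add, add_smul]
      abel
  | smul t y _ hy =>
    obtain ⟨N, y₀, g, h1, h2, h3⟩ := hy
    refine ⟨N, t • y₀, t • g, ?_, fun d => ?_, ?_⟩
    · rw [smul_comm, h1, smul_zero]
    · rcases h2 d with h | h
      · exact Or.inl (by simp [h])
      · exact Or.inr h
    · rw [h3]
      simp only [Pi.smul_apply, map_smul, smul_add, smul_assoc]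

/-! ### Homomorphisms defined by a peak -/

variable {Z : Type*} [AddCommGroup Z] [Module k Z] [Module (UAlg k ρ) Z]
  [IsScalarTower k (UAlg k ρ) Z]

/-- For a peak `s`, which starts at distance `t < n` from `s`, the homomorphism `η` sends the basis
elements from there on to the images of `x` under the paths which go round the cycle. -/
structure IsPeakHom (s : Flag) (c : Cyc ρ) (t : ℕ) (x : Z)
    (η : StringModule k C →ₗ[UAlg k ρ] Z) : Prop where
  lt : t < c.n
  good : ∀ l : ℤ, -t < l → C.Good s c l
  map_of_le : ∀ l : ℤ, -t ≤ l → η (bAt k C s l) = c.seg k 0 (c.n + l).toNat • x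
  map_of_lt : ∀ l : ℤ, l < -t → s.pos l ∈ C.shape.idx → η (bAt k C s l) = 0

/-- Let -t be the nearest bad letter. It is not an inverse letter, since uniqueness of continuations
would make it the good one. Hence the basis vectors before -t span a submodule, and modulo it only
the next arrow of the cycle acts non-trivially on each remaining vector. The targets have the same
property, for any `x`: the paths have length n + l ≥ n - t > 0, so every other arrow kills them. -/
theorem exists_isPeakHom (hρ : IsString ρ) (h : C.Peak s c) (x : Z) :
    ∃ (t : ℕ) (η : StringModule k C →ₗ[UAlg k ρ] Z), IsPeakHom s c t x η := by
  obtain ⟨hdeep, hbad⟩ := h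
  obtain ⟨htn, hbadt⟩ := Nat.find_spec hbad
  set t := Nat.find hbad with ht
  have hgood : ∀ l : ℤ, -t < l → C.Good s c l := fun m hm => by
    rcases le_or_gt 1 m with hm' | hm'
    · exact hdeep m hm'
    · have := Nat.find_min hbad (m := (-m).toNat) (by omega)
      rw [not_and, not_not, Int.toNat_of_nonneg (by omega), neg_neg] at this
      exact this (by omega)
  have hidx : ∀ l : ℤ, -t ≤ l → s.pos l ∈ C.shape.idx := fun l hl => by
    have := (Word.mem_of_letterAt (hgood (l + 1) (by omega))).2
    rwa [add_sub_cancel_right] at this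
  let F : ℤ → Z := fun l => if -t ≤ l then c.seg k 0 (c.n + l).toNat • x else 0
  have hF1 : ∀ l : ℤ, -t ≤ l → F l = c.seg k 0 (c.n + l).toNat • x := fun l hl => if_pos hl
  have hF2 : ∀ l : ℤ, l < -t → F l = 0 := fun l hl => if_neg (by omega)
  let φ : StringModule k C →ₗ[k] Z := linAt s F
  have hφ : ∀ l, s.pos l ∈ C.shape.idx → φ (bAt k C s l) = F l := fun l hl => linAt_bAt F hl
  have hX : ∀ l : ℤ, -t ≤ l → c.X (0 - ((c.n + l).toNat : ℤ)) = c.X (-l) := fun l hl => by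
    rw [c.eq_iff, Int.toNat_of_nonneg (by omega)]
    exact ⟨-1, by ring⟩
  refine ⟨t, homOfGenerators φ ?_ ?_, htn, hgood, fun l hl => ?_, fun l hl hl' => ?_⟩
  · intro a y
    have : φ ∘ₗ (Algebra.lsmul k k _ (idem k ρ a)) = (Algebra.lsmul k k Z (idem k ρ a)) ∘ₗ φ := by
      refine hom_extAt s fun l hl => ?_
      simp only [LinearMap.comp_apply, Algebra.lsmul_coe]
      rw [idem_smul_bAt _ hl, hφ l hl]
      by_cases hlt : -t ≤ l
      · have h1 := Word.vertex_head_at (hgood (l + 1) (by omega))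
        rw [show (1 : ℤ) - (l + 1) = -l by ring] at h1
        rw [h1, hF1 l hlt, ← c.idem_mul_seg, hX l hlt, ← mul_smul, ← mul_assoc]
        by_cases ha : (c.X (-l)).left = a
        · subst ha
          rw [if_pos (by rfl), hφ l hl, hF1 l hlt, idem_mul_self, ← hX l hlt, c.idem_mul_seg]
        · rw [if_neg, map_zero, idem_mul_of_ne (Ne.symm ha), zero_mul, zero_smul]
          simpa [Letter.head] using ha
      · rw [hF2 l (by omega), smul_zero]
        split_ifs
        · rw [hφ l hl, hF2 l (by omega)]
        · rw [map_zero]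
    exact LinearMap.congr_fun this y
  · intro y z
    have : φ ∘ₗ (Algebra.lsmul k k _ (arrowElt k ρ y)) =
        (Algebra.lsmul k k Z (arrowElt k ρ y)) ∘ₗ φ := by
      refine hom_extAt s fun l hl => ?_
      simp only [LinearMap.comp_apply, Algebra.lsmul_coe]
      rw [hφ l hl]
      by_cases hlt : -t ≤ l
      · have hg := hgood (l + 1) (by omega)
        rw [hF1 l hlt, ← mul_smul]
        by_cases hy : y = c.X (-l)
        · rw [hy, arrowElt_smul_bAt_of_good hg, hφ _ (hidx _ (by omega)), hF1 _ (by omega),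
            ← hX l hlt, ← c.seg_succ]
          congr 2
          omega
        · rw [c.arrowElt_mul_seg_of_ne hρ (by omega) (by rwa [hX l hlt]), zero_smul,
            arrowElt_smul_bAt _ hl]
          split_ifs with h1 h2
          · rw [hφ _ (Word.mem_of_letterAt h1).2]
            refine hF2 _ ?_
            by_contra! h2
            have := hgood l (by omega)
            rw [Word.Good, h1] at this
            simp at this
          · rw [Word.Good, h2, show (1 : ℤ) - (l + 1) = -l by ring] at hg
            simp only [Option.some.injEq, Letter.inv.injEq] at hg
            exact absurd hg hy
          · exact map_zero _
      · rw [hF2 l (by omega), smul_zero, arrowElt_smul_bAt _ hl]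
        split_ifs with h1 h2
        · rw [hφ _ (Word.mem_of_letterAt h1).2, hF2 _ (by omega)]
        · rw [hφ _ (Word.mem_of_letterAt h2).1]
          refine hF2 _ ?_
          by_contra! h3
          -- The one place where an arrow could lead out of the part sent to zero: it would need an
          -- inverse letter at the bad place.
          obtain rfl : l = -t - 1 := by omega
          rw [sub_add_cancel] at h2
          apply hbadt
          have h4 := hgood (-t + 1) (by omega)
          have h5 := Word.allowed_of_letterAt_inv h2 h4
          have h6 := c.allowed (1 - (-(t : ℤ) + 1))
          rw [Word.Good, h2, h5.right_unique hρ h6]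
          congr 3
          ring
        · exact map_zero _
    exact LinearMap.congr_fun this z
  · exact (hφ l (hidx l hl)).trans (hF1 l hl)
  · exact (hφ l hl').trans (hF2 l hl)

end StringModule

end Peaks

section Core

open Polynomial StringModule

variable {Q : Type v} [Quiver.{w} Q] {ρ : Set (QPath Q)} {C : Word ρ} {s : Flag} {c : Cyc ρ}
  {k : Type u} [Field k]

/-! ### Extensions of primitive simples by string modules with a peak -/

/-- The powers of p send a deep basis vector to distinct basis vectors, so it generates a free
k[p]-module whose coefficients can be read off. -/
theorem StringModule.coeffAt_aeval_smul_bAt (h : C.Deep s c) (g : k[X]) (e : ℕ) :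
    coeffAt s (c.n * e) (aeval (c.p k) g • bAt k C s 0) = g.coeff e := by
  induction g using Polynomial.induction_on' with
  | add g g' hg hg' => rw [map_add, add_smul, map_add, hg, hg', coeff_add]
  | monomial e' t =>
    have hpos : s.pos (c.n * e' : ℤ) ∈ C.shape.idx := by
      have := (Word.mem_of_letterAt (h (c.n * e' + 1) (by
        have : (0 : ℤ) ≤ c.n * e' := by positivity
        omega))).2
      rwa [add_sub_cancel_right] at this
    have hn : c.n ≠ 0 := c.pos.ne'
    rw [aeval_monomial, mul_smul, p_pow_smul_bAt_of_deep h, algebraMap_smul, map_smul,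
      coeffAt_bAt hpos, coeff_monomial, smul_eq_mul]
    simp [hn]

/-- The annihilator of an element which is killed by an irreducible polynomial. -/
theorem dvd_of_aeval_smul_eq_zero {A S : Type*} [Ring A] [Algebra k A] [AddCommGroup S] [Module A S]
    {p : A} {f g : k[X]} {x : S} (hf : Irreducible f) (hx : x ≠ 0) (hfx : aeval p f • x = 0)
    (hgx : aeval p g • x = 0) : f ∣ g := by
  by_contra h
  obtain ⟨a, b, hab⟩ := (hf.coprime_iff_not_dvd).2 h
  apply hx
  rw [← one_smul A x, ← map_one (aeval (R := k) p), ← hab, map_add, map_mul, map_mul, add_smul,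
    mul_smul,
    mul_smul, hfx, hgx, smul_zero, smul_zero, add_zero]

variable {Z : Type*} [AddCommGroup Z] [Module k Z] [Module (UAlg k ρ) Z]
  [IsScalarTower k (UAlg k ρ) Z]

/-- Applying a suitable path to the image of an element under a homomorphism defined by a peak, one
gets a multiple of `p x`. -/
theorem StringModule.IsPeakHom.exists_path_smul (hρ : IsString ρ) {t : ℕ} {x : Z}
    {η : StringModule k C →ₗ[UAlg k ρ] Z} (hη : IsPeakHom s c t x η) {y : StringModule k C}
    (hy : η y ≠ 0) :
    ∃ (a : UAlg k ρ) (h : k[X]), h ≠ 0 ∧ a • η y = aeval (c.p k) h • c.p k • x := by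
  have hn := c.pos
  have ht := hη.lt
  obtain ⟨T, hT, hyT⟩ := exists_finset_eq_sum s y
  set a : ℤ → k := fun l => coeffAt s l y with ha
  obtain ⟨l₀, hl₀, htl₀, hal₀⟩ : ∃ l ∈ T, -(t : ℤ) ≤ l ∧ a l ≠ 0 := by
    by_contra! h
    apply hy
    rw [hyT, map_sum]
    refine Finset.sum_eq_zero fun l hl => ?_
    rw [LinearMap.map_smul_of_tower]
    rcases le_or_gt (-(t : ℤ)) l with h1 | h1
    · rw [show coeffAt s l y = 0 from h l hl h1, zero_smul]
    · rw [hη.map_of_lt l h1 (hT l hl), smul_zero]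
  set r : ℤ → ℕ := fun l => (c.n + l).toNat with hr
  have hrl : ∀ l, -(t : ℤ) ≤ l → (r l : ℤ) = c.n + l := fun l hl =>
    Int.toNat_of_nonneg (by omega)
  -- A path of length `m` completes the path belonging to `l₀` to the power `r l₀ + 1` of the cycle.
  -- It kills the terms not congruent to `l₀` modulo n.
  set m : ℕ := c.n * r l₀ + c.n - r l₀ with hm
  have hm' : (m : ℤ) = c.n * r l₀ + c.n - r l₀ := by
    have : 1 * r l₀ ≤ c.n * r l₀ := Nat.mul_le_mul_right _ hn
    rw [hm, Nat.cast_sub (by omega)]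
    push_cast
    ring
  have hmpos : 0 < m := by
    have : 1 * r l₀ ≤ c.n * r l₀ := Nat.mul_le_mul_right _ hn
    omega
  -- A surviving term `l` becomes a multiple of p^(e l) p x. The exponents are distinct, so the
  -- coefficient at `l₀` cannot cancel.
  set e : ℤ → ℕ := fun l => (r l + m) / c.n - 1 with he
  have hel : ∀ l, -(t : ℤ) ≤ l → (c.n : ℤ) ∣ l - l₀ → r l + m = c.n * (e l + 1) := by
    intro l hl hdvd
    have h1 : (c.n : ℤ) ∣ ((r l + m : ℕ) : ℤ) := by
      obtain ⟨q, hq⟩ := hdvd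
      refine ⟨q + r l₀ + 1, ?_⟩
      push_cast
      have := hrl l hl
      have := hrl l₀ htl₀
      linarith
    obtain ⟨q, hq⟩ := Int.natCast_dvd_natCast.1 h1
    have hq0 : 0 < q := by
      rcases Nat.eq_zero_or_pos q with h0 | h0
      · rw [h0] at hq
        omega
      · exact h0
    change r l + m = c.n * ((r l + m) / c.n - 1 + 1)
    rw [hq, Nat.mul_div_cancel_left _ hn, Nat.sub_add_cancel hq0]
  refine ⟨c.seg k (-r l₀) m, ∑ l ∈ T, if -(t : ℤ) ≤ l ∧ (c.n : ℤ) ∣ l - l₀ then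
    monomial (e l) (a l) else 0, fun h0 => hal₀ ?_, ?_⟩
  · have := congrArg (fun h => coeff h (e l₀)) h0
    rw [finsetSum_coeff, Finset.sum_eq_single l₀, if_pos ⟨htl₀, by simp⟩, coeff_monomial,
      if_pos rfl, coeff_zero] at this
    · exact this
    · intro l hl hne
      split_ifs with hc
      · rw [coeff_monomial, if_neg]
        intro hee
        apply hne
        have h1 := hel l hc.1 hc.2
        have h2 := hel l₀ htl₀ (by simp)
        rw [hee, ← h2] at h1
        have := hrl l hc.1
        have := hrl l₀ htl₀
        omega
      · simp
    · exact fun h => absurd hl₀ h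
  · conv_lhs => rw [hyT]
    rw [map_sum, Finset.smul_sum, map_sum, Finset.sum_smul]
    refine Finset.sum_congr rfl fun l hl => ?_
    rw [LinearMap.map_smul_of_tower, smul_comm]
    rcases le_or_gt (-(t : ℤ)) l with h1 | h1
    · rw [hη.map_of_le l h1, ← mul_smul]
      by_cases h2 : (c.n : ℤ) ∣ l - l₀
      · rw [if_pos ⟨h1, h2⟩, c.seg_congr (j := 0 - (r l : ℕ)), ← c.seg_add, hel l h1 h2,
          c.seg_mul, aeval_monomial, mul_smul, algebraMap_smul, ← mul_smul _ (c.p k), ← pow_succ]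
        have := hrl l h1
        have := hrl l₀ htl₀
        rwa [show -(r l₀ : ℤ) - (0 - r l) = l - l₀ by linarith]
      · rw [if_neg fun h => h2 h.2, c.seg_mul_seg_of_not_dvd hρ _ hmpos]
        · simp
        · have := hrl l h1
          have := hrl l₀ htl₀
          rw [show -(r l₀ : ℤ) - (0 - r l) = l - l₀ by linarith]
          exact h2
        · have := hrl l h1
          change 0 < r l
          omega
    · rw [hη.map_of_lt l h1 (hT l hl), if_neg fun h => absurd h.1 (by omega)]
      simp

variable {S : Type*} [AddCommGroup S] [Module (UAlg k ρ) S]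

/-- An extension of a primitive simple by a string module with a peak at which the extension does
not vanish is isomorphic to the string module. -/
theorem bijective_add_peakHom (hρ : IsString ρ) [IsSimpleModule (UAlg k ρ) S]
    {ι : StringModule k C →ₗ[UAlg k ρ] Z} (hι : Function.Injective ι) {q : Z →ₗ[UAlg k ρ] S}
    (hq : LinearMap.ker q = LinearMap.range ι) {f₁ : k[X]} (hf : Irreducible (1 + X * f₁))
    {m : Z} {y : StringModule k C}
    (hy : ∀ g : k[X], aeval (c.p k) g • y ∈
      Submodule.span k {y | ∃ l : ℤ, l < -c.n ∧ s.pos l ∈ C.shape.idx ∧ y = bAt k C s l})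
    (hm : aeval (c.p k) (1 + X * f₁) • m = c.p k • ι (bAt k C s 0 + y)) (hqm : q m ≠ 0)
    {t : ℕ} {η : StringModule k C →ₗ[UAlg k ρ] Z}
    (hη : IsPeakHom s c t
      (-(aeval (c.p k) f₁ • (ι (bAt k C s 0) - aeval (c.p k) f₁ • m + ι y))) η) :
    Function.Bijective (ι + η) := by
  let _ : Module k[X] Z := Module.compHom Z (aeval (c.p k)).toRingHom
  have hsm : ∀ (g : k[X]) (z : Z), aeval (c.p k) g • z = g • z := fun _ _ => rfl
  have hX : ∀ z : Z, c.p k • z = (X : k[X]) • z := fun z => by rw [← hsm, aeval_X]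
  have hdeep : C.Deep s c := fun l hl => hη.good l (by have := hη.lt; omega)
  -- As t < n, everything at distance below -n lies in the part that `η` kills.
  have hηy : ∀ z ∈ Submodule.span k
      {y | ∃ l : ℤ, l < -c.n ∧ s.pos l ∈ C.shape.idx ∧ y = bAt k C s l}, η z = 0 := by
    intro z hz
    induction hz using Submodule.span_induction with
    | mem z hz =>
      obtain ⟨l, hl, hl', rfl⟩ := hz
      exact hη.map_of_lt l (by have := hη.lt; omega) hl'
    | zero => simp
    | add z z' _ _ h h' => rw [map_add, h, h', add_zero]
    | smul r z _ h => rw [LinearMap.map_smul_of_tower, h, smul_zero]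
  rw [map_add ι, hX, hsm] at hm
  set B := ι (bAt k C s 0) with hB
  set W := ι y with hW
  -- With f = 1 + X f₁, this element satisfies X m' = m and f m' = B + W. The homomorphism `η` is
  -- chosen so that `ι + η` sends the peak plus `y` to it.
  set m' := B - f₁ • m + W with hm'
  have h1 : (X : k[X]) • m' = m := by
    rw [hm']
    linear_combination (norm := module) (-1 : k[X]) • hm
  have h2 : (1 + X * f₁) • m' = B + W := by
    rw [hm']
    linear_combination (norm := module) (-f₁) • hm
  have h3 : (ι + η) (bAt k C s 0 + y) = m' := by
    have h4 : η y = 0 := hηy y (by simpa using hy 1)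
    rw [LinearMap.add_apply, map_add, map_add, h4, hη.map_of_le 0 (by omega), add_zero, add_zero,
      Int.toNat_natCast, ← hB, ← hW]
    change B + W + c.p k • (-(f₁ • m')) = m'
    rw [hX]
    nth_rewrite 2 [hm']
    rw [← h1]
    module
  constructor
  · rw [injective_iff_map_eq_zero]
    intro z hz
    by_contra hz0
    have hηz : η z = -ι z := by
      rw [LinearMap.add_apply] at hz
      exact eq_neg_of_add_eq_zero_right hz
    have hne : η z ≠ 0 := by
      rw [hηz, neg_ne_zero]
      exact fun h => hz0 (hι (by rw [h, map_zero]))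
    -- A path turns the relation η z = -ι z into ι(a z) = h f₁ m with h ≠ 0. The contradiction
    -- sought is h = 0.
    obtain ⟨a, h, h0, ha⟩ := hη.exists_path_smul hρ hne
    apply h0
    have ha' : ι (a • z) = (h * f₁) • m := by
      rw [map_smul, ← neg_neg (ι z), ← hηz, smul_neg, ha, hX, hsm]
      change -(h • (X : k[X]) • -(f₁ • m')) = _
      rw [← h1]
      module
    have hfqm : aeval (c.p k) (1 + X * f₁) • q m = 0 := by
      rw [← map_smul, hsm, hm, ← LinearMap.mem_ker, hq, hB, hW, ← map_add, ← hX, ← map_smul]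
      exact ⟨_, rfl⟩
    -- In S the annihilator of q m in k[X] is generated by f, which does not divide f₁ because f - X
    -- f₁ = 1.
    have hdvd : (1 + X * f₁) ∣ h * f₁ := by
      refine dvd_of_aeval_smul_eq_zero hf hqm hfqm ?_
      rw [← map_smul, hsm, ← ha', ← LinearMap.mem_ker, hq]
      exact ⟨_, rfl⟩
    have hnd : ¬ (1 + X * f₁) ∣ f₁ := fun hd =>
      hf.not_isUnit (isUnit_of_dvd_one ((dvd_add_left (hd.mul_left X)).1 dvd_rfl))
    obtain ⟨h', rfl⟩ := (hf.prime.dvd_or_dvd hdvd).resolve_right hnd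
    have hf₁ : f₁ ≠ 0 := fun h => hnd (h ▸ dvd_zero _)
    have haz : a • z = aeval (c.p k) (X * h' * f₁) • (bAt k C s 0 + y) := by
      apply hι
      rw [ha', map_smul, map_add, ← hB, ← hW, hsm, ← h2, ← h1]
      module
    have h5 : (h' * f₁) • m = 0 := by
      have h6 : (ι + η) (a • z) = 0 := by rw [map_smul, hz, smul_zero]
      rw [haz, map_smul, h3, hsm] at h6
      rw [← h1, ← h6]
      module
    have h6 : aeval (c.p k) (X * (h' * f₁)) • (bAt k C s 0 + y) = 0 := by
      apply hι
      rw [map_smul, map_add, ← hB, ← hW, hsm, map_zero, ← h2]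
      have : (X * (h' * f₁)) • (1 + X * f₁) • m' = (1 + X * f₁) • (h' * f₁) • m := by
        rw [← h1]
        module
      rw [this, h5, smul_zero]
    -- The multiples of `y` have no component at the positive multiples of n, so these coefficients
    -- of the relation `h6` are those of h' f₁.
    have h7 : h' * f₁ = 0 := by
      ext e
      have h8 : ∀ z ∈ Submodule.span k
          {y | ∃ l : ℤ, l < -c.n ∧ s.pos l ∈ C.shape.idx ∧ y = bAt k C s l},
          coeffAt s (c.n * (e + 1 : ℕ)) z = 0 := by
        intro z hz
        induction hz using Submodule.span_induction with
        | mem z hz =>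
          obtain ⟨l, hl, hl', rfl⟩ := hz
          rw [coeffAt_bAt hl', if_neg]
          have : (0 : ℤ) ≤ c.n * (e + 1 : ℕ) := by positivity
          omega
        | zero => simp
        | add z z' _ _ h h' => rw [map_add, h, h', add_zero]
        | smul r z _ h => rw [map_smul, h, smul_zero]
      have h9 := congrArg (coeffAt s (c.n * (e + 1 : ℕ))) h6
      rw [smul_add, map_add, coeffAt_aeval_smul_bAt hdeep, h8 _ (hy _), map_zero, add_zero,
        coeff_X_mul] at h9
      rw [h9, coeff_zero]
    rw [(mul_eq_zero.1 h7).resolve_right hf₁, mul_zero]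
  · rw [← LinearMap.range_eq_top]
    have hm'mem : m' ∈ LinearMap.range (ι + η) := ⟨_, h3⟩
    -- The values of `η` lie in the submodule generated by m', hence in the range. Then so do those
    -- of ι = (ι + η) - η, and m = p m' covers S.
    have hηmem : ∀ z, η z ∈ LinearMap.range (ι + η) := by
      intro z
      obtain ⟨T, hT, hzT⟩ := exists_finset_eq_sum s z
      rw [hzT, map_sum]
      refine sum_mem fun l hl => ?_
      rw [LinearMap.map_smul_of_tower]
      refine Submodule.smul_of_tower_mem _ _ ?_
      rcases le_or_gt (-(t : ℤ)) l with h1 | h1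
      · rw [hη.map_of_le l h1]
        exact Submodule.smul_mem _ _ (neg_mem (Submodule.smul_mem _ _ hm'mem))
      · rw [hη.map_of_lt l h1 (hT l hl)]
        exact zero_mem _
    have hιmem : ∀ z, ι z ∈ LinearMap.range (ι + η) := fun z => by
      have : ι z = (ι + η) z - η z := by simp
      rw [this]
      exact sub_mem ⟨z, rfl⟩ (hηmem z)
    rw [eq_top_iff]
    intro z _
    obtain ⟨a, ha⟩ : ∃ a : UAlg k ρ, a • q m = q z := by
      have := IsSimpleModule.span_singleton_eq_top (UAlg k ρ) hqm
      exact Submodule.mem_span_singleton.1 (this ▸ Submodule.mem_top)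
    have h4 : z - a • m ∈ LinearMap.ker q := by
      rw [LinearMap.mem_ker, map_sub, map_smul, ha, sub_self]
    rw [hq] at h4
    obtain ⟨z', hz'⟩ := h4
    have h5 : z = ι z' + a • c.p k • m' := by rw [hX, h1, hz']; abel
    rw [h5]
    exact add_mem (hιmem z') (Submodule.smul_mem _ _ (Submodule.smul_mem _ _ hm'mem))

end Core

section Dichotomy

open Polynomial StringModule

variable {Q : Type v} [Quiver.{w} Q] {ρ : Set (QPath Q)} {C : Word ρ} {s : Flag} {c : Cyc ρ}
  {k : Type u} [Field k]

/-! ### String modules without a relevant peak -/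

theorem isCoprime_one_add_X_mul (f₁ : k[X]) (N : ℕ) : IsCoprime (1 + X * f₁) (X ^ N) :=
  IsCoprime.pow_right ⟨1, -f₁, by ring⟩

/-- An element which is annihilated by some polynomial in `p` is divisible by `1 + p f₁(p)`, up to
an element which is annihilated by a polynomial with constant term `1`. -/
theorem exists_aeval_smul_sub_eq_zero {A Y : Type*} [Ring A] [Algebra k A] [AddCommGroup Y]
    [Module A Y] (p : A) (f₁ : k[X]) {g : k[X]} (hg : g ≠ 0) {y : Y} (hy : aeval p g • y = 0) :
    ∃ (y' : Y) (f' : k[X]), f'.eval 0 = 1 ∧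
      aeval p f' • (y - aeval p (1 + X * f₁) • y') = 0 := by
  obtain ⟨g', hg', hnd⟩ := exists_eq_pow_rootMultiplicity_mul_and_not_dvd g hg 0
  rw [map_zero, sub_zero] at hg' hnd
  set e := rootMultiplicity 0 g
  have h0 : g'.coeff 0 ≠ 0 := by rwa [Ne, ← X_dvd_iff]
  obtain ⟨a, b, hab⟩ := isCoprime_one_add_X_mul f₁ e
  let _ : Module k[X] Y := Module.compHom Y (aeval p).toRingHom
  have hsm : ∀ (g : k[X]) (z : Y), aeval p g • z = g • z := fun _ _ => rfl
  -- With g = X^e g' and a f + b X^e = 1, the difference y - f a y = b X^e y is killed by g', whose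
  -- constant term is non-zero and can be normalised.
  refine ⟨aeval p a • y, C (g'.coeff 0)⁻¹ * g', ?_, ?_⟩
  · rw [eval_mul, eval_C, ← coeff_zero_eq_eval_zero, inv_mul_cancel₀ h0]
  · simp only [hsm] at hy ⊢
    have h1 : y - (1 + X * f₁) • a • y = (b * X ^ e) • y := by
      have h2 : y = (a * (1 + X * f₁) + b * X ^ e) • y := by rw [hab, one_smul]
      nth_rewrite 1 [h2]
      module
    rw [h1]
    have h3 : (C (g'.coeff 0)⁻¹ * g') • (b * X ^ e) • y =
        (C (g'.coeff 0)⁻¹ * b) • (X ^ e * g') • y := by module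
    rw [h3, ← hg', hy, smul_zero]

/-- A polynomial with constant term 1 is invertible modulo X^N, so it can be divided by wherever p
is nilpotent. -/
theorem exists_eq_aeval_smul {A Y : Type*} [Ring A] [Algebra k A] [AddCommGroup Y] [Module A Y]
    {p : A} (f₁ : k[X]) {N : ℕ} {y : Y} (hy : p ^ N • y = 0) :
    ∃ y' : Y, y = aeval p (1 + X * f₁) • y' := by
  obtain ⟨a, b, hab⟩ := isCoprime_one_add_X_mul f₁ N
  refine ⟨aeval p a • y, ?_⟩
  have h2 : y = aeval p (a * (1 + X * f₁) + b * X ^ N) • y := by rw [hab, map_one, one_smul]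
  nth_rewrite 1 [h2]
  rw [map_add, add_smul, map_mul _ b, mul_smul _ _ y, map_pow, aeval_X, hy, smul_zero, add_zero,
    mul_comm, map_mul, mul_smul]

/-- Deep words of opposite directions cannot overlap, since a common letter would be both direct and
inverse; so they point away from each other. -/
theorem Word.Deep.rel_le {s' : Flag} (h : C.Deep s c) (h' : C.Deep s' c) (hd : s'.d = !s.d)
    (l : ℤ) : s.rel (s'.pos l) ≤ -l := by
  rcases s with ⟨i, d⟩
  rcases s' with ⟨j, d'⟩
  obtain rfl : d' = !d := hd
  by_contra! hlt
  rcases d with _ | _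
  · simp only [Flag.rel, Flag.pos, Bool.not_false, Bool.false_eq_true, if_false, if_true] at hlt
    have h1 := h (i - j) (by omega)
    have h2 := h' 1 le_rfl
    simp only [Word.Good, Word.letterAt, Bool.not_false, Bool.false_eq_true, if_false, if_true]
      at h1 h2
    rw [show i + 1 - (i - j) = j + 1 by ring, h2] at h1
    simp [Letter.inverse] at h1
  · simp only [Flag.rel, Flag.pos, Bool.not_true, Bool.false_eq_true, if_false, if_true] at hlt
    have h1 := h' (j - i) (by omega)
    have h2 := h 1 le_rfl
    simp only [Word.Good, Word.letterAt, Bool.not_true, Bool.false_eq_true, if_false, if_true]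
      at h1 h2
    rw [show j + 1 - (j - i) = i + 1 by ring, h2] at h1
    simp [Letter.inverse] at h1

theorem Word.Deep.mem {l : ℤ} (h : C.Deep s c) (hl : 0 ≤ l) : s.pos l ∈ C.shape.idx := by
  have := (Word.mem_of_letterAt (h (l + 1) (by omega))).2
  rwa [add_sub_cancel_right] at this

/-- Multiples of a peak in the opposite direction are far away. -/
theorem StringModule.aeval_smul_bAt_mem {s' : Flag} (h : C.Deep s c) (h' : C.Deep s' c)
    (hd : s'.d = !s.d) (g : k[X]) :
    aeval (c.p k) (X ^ 2 * g) • bAt k C s' 0 ∈ Submodule.span k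
      {y | ∃ l : ℤ, l < -c.n ∧ s.pos l ∈ C.shape.idx ∧ y = bAt k C s l} := by
  induction g using Polynomial.induction_on' with
  | add g g' hg hg' => rw [mul_add, map_add, add_smul]; exact add_mem hg hg'
  | monomial e t =>
    rw [X_pow_mul_monomial, aeval_monomial, mul_smul, p_pow_smul_bAt_of_deep h', algebraMap_smul]
    refine Submodule.smul_mem _ _ (Submodule.subset_span
      ⟨s.rel (s'.pos (c.n * (e + 2 : ℕ))), ?_, ?_, by rw [bAt, bAt, Flag.pos_rel]⟩)
    -- The factor X² moves at least 2n steps away, beyond the bound n within which `η` may be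
    -- non-zero.
    · have h1 := h.rel_le h' hd (c.n * (e + 2 : ℕ))
      have hn := c.pos
      have : (c.n : ℤ) * 1 < c.n * (e + 2 : ℕ) := by
        apply mul_lt_mul_of_pos_left <;> push_cast <;> omega
      omega
    · rw [Flag.pos_rel]
      exact h'.mem (by positivity)

variable {Z : Type*} [AddCommGroup Z] [Module (UAlg k ρ) Z] {S : Type*} [AddCommGroup S]
  [Module (UAlg k ρ) S]

/-- In an extension of a primitive simple by a string module which is not `M(^∞P^∞)`, the extension
vanishes, or there is a peak at which it does not vanish. -/
theorem dvd_or_exists_peak [Module k Z] [IsScalarTower k (UAlg k ρ) Z] (hρ : IsString ρ)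
    [IsSimpleModule (UAlg k ρ) S]
    {ι : StringModule k C →ₗ[UAlg k ρ] Z} (hι : Function.Injective ι) {q : Z →ₗ[UAlg k ρ] S}
    (hq : LinearMap.ker q = LinearMap.range ι) {f₁ : k[X]} (hf : Irreducible (1 + X * f₁))
    {m₁ : Z} {y : StringModule k C} (hm : aeval (c.p k) (1 + X * f₁) • m₁ = ι y)
    (hqm : c.p k • q m₁ ≠ 0) (hC : ¬ ∃ s, ∀ l, C.Good s c l) :
    (∃ y', y = aeval (c.p k) (1 + X * f₁) • y') ∨
      ∃ s, C.Peak s c ∧ ∃ x : Z, ∀ t (η : StringModule k C →ₗ[UAlg k ρ] Z),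
        IsPeakHom s c t x η → Function.Bijective (ι + η) := by
  obtain ⟨N, y₀, i, g, hN, hg, hy⟩ := exists_peak_decomposition (k := k) hC y
  obtain ⟨y₀, rfl⟩ := exists_eq_aeval_smul f₁ hN
  by_cases hfg : ∀ d, 1 + X * f₁ ∣ g d
  · left
    choose g' hg' using hfg
    refine ⟨y₀ + (aeval (c.p k) (g' true) • bAt k C ⟨i true, true⟩ 0 +
        aeval (c.p k) (g' false) • bAt k C ⟨i false, false⟩ 0), ?_⟩
    rw [hy, hg' true, hg' false, smul_add, smul_add, map_mul, map_mul, mul_smul, mul_smul]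
  right
  push Not at hfg
  obtain ⟨d, hd⟩ := hfg
  have hpeak := (hg d).resolve_left fun h => hd (h ▸ dvd_zero _)
  -- The identity e f + h g_d = 1 serves to replace the coefficient g_d of the peak by 1.
  obtain ⟨e, h, heh⟩ := hf.coprime_iff_not_dvd.2 hd
  have hy' : y = aeval (c.p k) (1 + X * f₁) • y₀ + (aeval (c.p k) (g d) • bAt k C ⟨i d, d⟩ 0 +
      aeval (c.p k) (g !d) • bAt k C ⟨i !d, !d⟩ 0) := by
    rw [hy]
    cases d
    · rw [Bool.not_false, add_comm (aeval (c.p k) (g true) • _)]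
    · rfl
  clear hy
  let _ : Module k[X] Z := Module.compHom Z (aeval (c.p k)).toRingHom
  have hsm : ∀ (g : k[X]) (z : Z), aeval (c.p k) g • z = g • z := fun _ _ => rfl
  have hX : ∀ z : Z, c.p k • z = (X : k[X]) • z := fun z => by rw [← hsm, aeval_X]
  set b := bAt k C ⟨i d, d⟩ 0
  set b' := bAt k C ⟨i !d, !d⟩ 0
  -- The factor 1 - X f₁ in the element `m` defined next inverts f modulo X². So the opposite peak
  -- contributes to f m only a multiple of X³, that is X w with w far from the chosen peak.
  set w := aeval (c.p k) (X ^ 2 * (f₁ ^ 2 * h * g !d)) • b' with hw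
  set m : Z := (h * X) • m₁ - (h * X) • ι y₀ + (e * X) • ι b -
    ((1 - X * f₁) * h * g (!d) * X) • ι b' with hmdef
  have hιk : ∀ (g : k[X]) z, ι (aeval (c.p k) g • z) = g • ι z := fun g z => by
    rw [map_smul, hsm]
  have hm₁ : (1 + X * f₁) • m₁ = (1 + X * f₁) • ι y₀ + (g d • ι b + (g !d) • ι b') := by
    rw [← hsm, hm, hy', map_add ι, map_add ι, hιk, hιk, hιk]
  have hmm : aeval (c.p k) (1 + X * f₁) • m = c.p k • ι (b + w) := by
    rw [hsm, hX, map_add, hw, hιk, hmdef]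
    have h1 : (X : k[X]) • ι b = (X * (e * (1 + X * f₁) + h * g d)) • ι b := by rw [heh, mul_one]
    rw [smul_add, h1]
    linear_combination (norm := module) (h * X : k[X]) • hm₁
  have hqι : ∀ z, q (ι z) = 0 := fun z => by
    rw [← LinearMap.mem_ker, hq]
    exact ⟨z, rfl⟩
  have hqm' : q m = aeval (c.p k) h • c.p k • q m₁ := by
    rw [hmdef, map_sub, map_add, map_sub]
    simp only [← hsm, map_smul, hqι, smul_zero, sub_zero, add_zero]
    rw [map_mul, aeval_X, mul_smul]
  refine ⟨⟨i d, d⟩, hpeak, _, fun t η hη =>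
    bijective_add_peakHom hρ hι hq hf (m := m) (y := w) (fun u => ?_) hmm (fun h0 => ?_) hη⟩
  · rcases hg !d with h0 | h0
    · rw [hw, h0]
      simp
    · rw [hw, ← mul_smul, ← map_mul, mul_left_comm]
      exact aeval_smul_bAt_mem hpeak.1 h0.1 rfl _
  -- Here q m = h p q(m₁). If it vanished, f would divide h, and then 1 by the Bézout identity.
  · rw [hqm'] at h0
    have h1 : aeval (c.p k) (1 + X * f₁) • c.p k • q m₁ = 0 := by
      have h2 : aeval (c.p k) (1 + X * f₁) • c.p k • m₁ = c.p k • ι y := by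
        rw [← hm, hsm, hX, hX, hsm]
        module
      rw [← map_smul q, ← map_smul q, h2, map_smul, hqι, smul_zero]
    have h2 := dvd_of_aeval_smul_eq_zero hf hqm h1 h0
    have h3 : 1 + X * f₁ ∣ e * (1 + X * f₁) + h * g d :=
      dvd_add (Dvd.intro_left e rfl) (h2.mul_right _)
    rw [heh] at h3
    exact hf.not_isUnit (isUnit_of_dvd_one h3)

/-- A finitely controlled module has no submodule `M(^∞P^∞)` whose quotient is a primitive simple on
which `P` is non-zero. -/
theorem false_of_forall_good (hρ : IsString ρ) [IsSimpleModule (UAlg k ρ) S]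
    {ι : StringModule k C →ₗ[UAlg k ρ] Z} (hι : Function.Injective ι) {q : Z →ₗ[UAlg k ρ] S}
    (hq : LinearMap.ker q = LinearMap.range ι) {f₁ : k[X]}
    {m₁ : Z} {y : StringModule k C} (hm : aeval (c.p k) (1 + X * f₁) • m₁ = ι y)
    (hqm : c.p k • q m₁ ≠ 0) (hg : ∀ l, C.Good s c l)
    (hfc : ∃ F : Submodule (UAlg k ρ) Z, F.FG ∧ ∀ z : Z, idem k ρ (c.X 0).left • z ∈ F) :
    False := by
  have hidx : ∀ l, s.pos l ∈ C.shape.idx := fun l => (Word.mem_of_letterAt (hg l)).1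
  -- All letters are inverse in the direction of `s`, so arrows only move forward: these
  -- half-infinite spans are submodules, and they exhaust M(C).
  let U₀ : ℕ → Submodule k (StringModule k C) := fun B =>
    Submodule.span k {y | ∃ l : ℤ, -B ≤ l ∧ y = bAt k C s l}
  have hU1 : ∀ B a, ∀ z ∈ U₀ B, idem k ρ a • z ∈ U₀ B := by
    intro B a z hz
    induction hz using Submodule.span_induction with
    | mem z hz =>
      obtain ⟨l, hl, rfl⟩ := hz
      rw [idem_smul_bAt _ (hidx l)]
      split_ifs
      · exact Submodule.subset_span ⟨l, hl, rfl⟩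
      · exact zero_mem _
    | zero => rw [smul_zero]; exact zero_mem _
    | add z z' _ _ h h' => rw [smul_add]; exact add_mem h h'
    | smul r z _ h => rw [smul_comm]; exact Submodule.smul_mem _ _ h
  have hU2 : ∀ B x, ∀ z ∈ U₀ B, arrowElt k ρ x • z ∈ U₀ B := by
    intro B x z hz
    induction hz using Submodule.span_induction with
    | mem z hz =>
      obtain ⟨l, hl, rfl⟩ := hz
      rw [arrowElt_smul_bAt _ (hidx l)]
      split_ifs with h1 h2
      · have := hg l
        rw [Word.Good, h1] at this
        simp at this
      · exact Submodule.subset_span ⟨l + 1, by omega, rfl⟩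
      · exact zero_mem _
    | zero => rw [smul_zero]; exact zero_mem _
    | add z z' _ _ h h' => rw [smul_add]; exact add_mem h h'
    | smul r z _ h => rw [smul_comm]; exact Submodule.smul_mem _ _ h
  let U : ℕ → Submodule (UAlg k ρ) (StringModule k C) := fun B =>
    submoduleOfGenerators (U₀ B) (hU1 B) (hU2 B)
  have hmono : ∀ {B B'}, B ≤ B' → U B ≤ U B' := fun {B B'} h z hz => by
    refine Submodule.span_mono ?_ (show z ∈ U₀ B from hz)
    rintro _ ⟨l, hl, rfl⟩
    exact ⟨l, by omega, rfl⟩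
  have hex : ∀ z, ∃ B, z ∈ U B := by
    intro z
    have := bAt_mem_span s z
    induction this using Submodule.span_induction with
    | mem z hz =>
      obtain ⟨l, -, rfl⟩ := hz
      exact ⟨l.natAbs, Submodule.subset_span ⟨l, by omega, rfl⟩⟩
    | zero => exact ⟨0, zero_mem _⟩
    | add z z' _ _ h h' =>
      obtain ⟨B, hB⟩ := h
      obtain ⟨B', hB'⟩ := h'
      exact ⟨max B B', add_mem (hmono (le_max_left _ _) hB) (hmono (le_max_right _ _) hB')⟩
    | smul r z _ h =>
      obtain ⟨B, hB⟩ := h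
      exact ⟨B, Submodule.smul_of_tower_mem _ _ hB⟩
  obtain ⟨F, hF, hFmem⟩ := hfc
  set m := c.p k • m₁ with hmdef
  -- The image of m generates S, so each of the finitely many generators of F is a multiple of m
  -- plus an element of some ι(U B).
  have hF' : ∃ B, F ≤ Submodule.span _ {m} ⊔ (U B).map ι := by
    clear hFmem
    induction F, hF using Submodule.fg_induction with
    | singleton x =>
      obtain ⟨a, ha⟩ : ∃ a : UAlg k ρ, a • q m = q x := by
        have h1 : q m ≠ 0 := by rwa [hmdef, map_smul]
        have := IsSimpleModule.span_singleton_eq_top (UAlg k ρ) h1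
        exact Submodule.mem_span_singleton.1 (this ▸ Submodule.mem_top)
      have h4 : x - a • m ∈ LinearMap.ker q := by
        rw [LinearMap.mem_ker, map_sub, map_smul, ha, sub_self]
      rw [hq] at h4
      obtain ⟨z, hz⟩ := h4
      obtain ⟨B, hB⟩ := hex z
      refine ⟨B, ?_⟩
      rw [Submodule.span_singleton_le_iff_mem, show x = a • m + ι z by rw [hz]; abel]
      exact add_mem (Submodule.mem_sup_left (Submodule.smul_mem _ _
        (Submodule.mem_span_singleton_self m))) (Submodule.mem_sup_right ⟨z, hB, rfl⟩)
    | sup F F' _ _ h h' =>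
      obtain ⟨B, hB⟩ := h
      obtain ⟨B', hB'⟩ := h'
      exact ⟨max B B', sup_le
        (hB.trans (sup_le_sup_left (Submodule.map_mono (hmono (le_max_left _ _))) _))
        (hB'.trans (sup_le_sup_left (Submodule.map_mono (hmono (le_max_right _ _))) _))⟩
  obtain ⟨B₁, hB₁⟩ := hF'
  obtain ⟨B₂, hB₂⟩ := hex y
  set B := max B₁ B₂ with hB
  have hn := c.pos
  -- A multiple of n, so that the basis vector is fixed by the idempotent of the cycle. Its image
  -- under p still lies outside U B.
  set l : ℤ := -(c.n * (B + 2 : ℕ)) with hl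
  have hln : l + c.n < -B := by
    rw [hl]
    have : 1 * (B + 1) ≤ c.n * (B + 1) := Nat.mul_le_mul_right _ hn
    push_cast
    zify at this
    linarith
  have hdvd : (c.n : ℤ) ∣ l + c.n := ⟨-(B + 1 : ℕ), by rw [hl]; push_cast; ring⟩
  have h1 : ι (bAt k C s l) ∈ F := by
    have h2 := hFmem (ι (bAt k C s l))
    rwa [← map_smul, (c.eq_iff 0 (-l)).2 (by simp [hl]),
      idem_smul_bAt_of_good (hg _)] at h2
  obtain ⟨x, hx, z, hz, hxz⟩ := Submodule.mem_sup.1 (hB₁ h1)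
  obtain ⟨a, rfl⟩ := Submodule.mem_span_singleton.1 hx
  obtain ⟨z, hz, rfl⟩ := hz
  -- Since m = p m₁, this gives p a m = h(p) p m₁; applying f then lands in ι(U B).
  obtain ⟨h, hh⟩ := c.p_mul_mul_p hρ a
  have h2 : c.p k • bAt k C s l = bAt k C s (l + c.n) := by
    rw [← seg_smul_bAt_of_good (k := k) (hg _) fun m _ _ => hg m, Cyc.p,
      c.seg_congr (i := 0) (j := -l) (by simp [hl])]
  have h3 : aeval (c.p k) (1 + X * f₁) • bAt k C s (l + c.n) ∈ U B := by
    have h4 : aeval (c.p k) (1 + X * f₁) • bAt k C s (l + c.n) =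
        aeval (c.p k) h • c.p k • y + aeval (c.p k) (1 + X * f₁) • c.p k • z := by
      apply hι
      let _ : Module k[X] Z := Module.compHom Z (aeval (c.p k)).toRingHom
      have hsm : ∀ (g : k[X]) (z : Z), aeval (c.p k) g • z = g • z := fun _ _ => rfl
      have hX : ∀ z : Z, c.p k • z = (X : k[X]) • z := fun z => by rw [← hsm, aeval_X]
      have h5 : c.p k • a • m = h • (X : k[X]) • m₁ := by
        rw [hmdef, ← mul_smul, ← mul_smul, hh, mul_smul, hX, hsm]
      rw [← h2, map_smul ι, map_smul ι, ← hxz, map_add ι, map_smul ι, map_smul ι, map_smul ι,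
        map_smul ι, smul_add (c.p k), h5, ← hm]
      simp only [hX, hsm]
      module
    rw [h4]
    exact add_mem (Submodule.smul_mem _ _ (Submodule.smul_mem _ _ (hmono (le_max_right _ _) hB₂)))
      (Submodule.smul_mem _ _ (Submodule.smul_mem _ _ (hmono (le_max_left _ _) hz)))
  set s' := s.shift (l + c.n) with hs'
  have hdeep : C.Deep s' c := fun l' _ => (C.good_shift s hdvd l').2 (hg _)
  -- This coefficient is f(0) = 1, but it vanishes on U B: the contradiction.
  have h4 := coeffAt_aeval_smul_bAt hdeep (1 + X * f₁ : k[X]) 0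
  rw [bAt_shift, add_zero] at h4
  have h5 : ∀ z ∈ U₀ B, coeffAt s' (c.n * (0 : ℕ)) z = 0 := by
    intro z hz
    induction hz using Submodule.span_induction with
    | mem z hz =>
      obtain ⟨l', hl', rfl⟩ := hz
      have h6 : bAt k C s l' = bAt k C s' (l' - (l + c.n)) := by
        rw [bAt_shift, add_sub_cancel]
      rw [h6, coeffAt_bAt, if_neg]
      · simp only [Nat.cast_zero, mul_zero]
        omega
      · rw [hs', Flag.pos_shift]
        exact hidx _
    | zero => simp
    | add z z' _ _ h h' => rw [map_add, h, h', add_zero]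
    | smul r z _ h => rw [map_smul, h, smul_zero]
  rw [h5 _ h3] at h4
  simp at h4

end Dichotomy

/-! ### Band modules -/

section Bands

open scoped TensorProduct

variable {Q : Type v} [Quiver.{w} Q] {ρ : Set (QPath Q)} {C : Word ρ} {n : ℕ}
  (k : Type u) [Field k] (h : C.HasPeriod n)

/-- The basis element `bᵢ` of the bimodule `M(C)`. -/
def Bimodule.b (i : ℤ) : Bimodule k h := StringModule.b k C i

theorem laurentAct_C_mul_T (t : k) (m : ℤ) :
    laurentAct k h (LaurentPolynomial.C t * LaurentPolynomial.T m) = t • shiftAct k h m := by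
  rw [← LaurentPolynomial.single_eq_C_mul_T]
  exact AddMonoidAlgebra.lift_single _ _ _

variable {k}

theorem Bimodule.C_mul_T_smul (t : k) (m : ℤ) (x : Bimodule k h) :
    (LaurentPolynomial.C t * LaurentPolynomial.T m) • x = t • shiftAct k h m x := by
  change laurentAct k h _ x = _
  rw [laurentAct_C_mul_T]
  rfl

theorem Bimodule.C_smul (t : k) (x : Bimodule k h) : (LaurentPolynomial.C t) • x = t • x := by
  have h1 : shiftAct k h 0 = LinearMap.id :=
    StringModule.hom_ext fun i _ => by simp [shiftAct_b]
  have := Bimodule.C_mul_T_smul h t 0 x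
  rwa [LaurentPolynomial.T_zero, mul_one, h1] at this

theorem Bimodule.T_smul_b (m i : ℤ) :
    (LaurentPolynomial.T m : LaurentPolynomial k) • Bimodule.b k h i =
      Bimodule.b k h (i - m * n) := by
  have := Bimodule.C_mul_T_smul h (1 : k) m (Bimodule.b k h i)
  rw [map_one, one_mul, one_smul] at this
  exact this.trans (shiftAct_b k h m i)

theorem Bimodule.mem_span_b (x : Bimodule k h) :
    x ∈ Submodule.span k (Set.range (Bimodule.b k h)) := by
  have h1 : {y : StringModule k C | ∃ i ∈ C.shape.idx, y = StringModule.b k C i} ⊆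
      Set.range (Bimodule.b k h) := by
    rintro _ ⟨i, -, rfl⟩
    exact ⟨i, rfl⟩
  exact Submodule.span_mono h1 (StringModule.b_mem_span (k := k) (C := C) x)

variable {V : Type*} [AddCommGroup V] [Module (LaurentPolynomial k) V]

/-- Powers of T move across the tensor sign, which brings every index into a single period. -/
theorem BandModule.exists_eq_sum (z : BandModule k h V) :
    ∃ v : ℕ → V, z = ∑ j ∈ Finset.range n, Bimodule.b k h (-j) ⊗ₜ[LaurentPolynomial k] v j := by
  induction z using TensorProduct.induction_on with
  | zero => exact ⟨0, by simp⟩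
  | add z z' hz hz' =>
    obtain ⟨v, rfl⟩ := hz
    obtain ⟨v', rfl⟩ := hz'
    exact ⟨v + v', by simp [TensorProduct.tmul_add, Finset.sum_add_distrib]⟩
  | tmul x v =>
    have hx := Bimodule.mem_span_b h x
    induction hx using Submodule.span_induction generalizing v with
    | mem x hx =>
      obtain ⟨i, rfl⟩ := hx
      have hn : (0 : ℤ) < n := Int.natCast_pos.2 h.pos
      have h1 := Int.emod_nonneg (-i) hn.ne'
      have h2 := Int.emod_lt_of_pos (-i) hn
      refine ⟨Pi.single ((-i) % n).toNat
        ((LaurentPolynomial.T ((-i) / n) : LaurentPolynomial k) • v), ?_⟩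
      rw [Finset.sum_eq_single ((-i) % n).toNat, Pi.single_eq_same, ← TensorProduct.smul_tmul,
        Bimodule.T_smul_b]
      · congr 1
        rw [Bimodule.b]
        congr 1
        have := Int.emod_add_mul_ediv (-i) n
        rw [Int.toNat_of_nonneg h1]
        linarith
      · intro j _ hj
        rw [Pi.single_eq_of_ne hj, TensorProduct.tmul_zero]
      · intro h3
        simp only [Finset.mem_range] at h3
        omega
    | zero => exact ⟨0, by simp⟩
    | add x y _ _ hx hy =>
      obtain ⟨v₁, h₁⟩ := hx v
      obtain ⟨v₂, h₂⟩ := hy v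
      refine ⟨v₁ + v₂, ?_⟩
      rw [TensorProduct.add_tmul, h₁, h₂]
      simp [TensorProduct.tmul_add, Finset.sum_add_distrib]
    | smul t x _ hx =>
      obtain ⟨v', h'⟩ := hx ((LaurentPolynomial.C t) • v)
      refine ⟨v', ?_⟩
      rw [← h', ← TensorProduct.smul_tmul, Bimodule.C_smul]

/-- Elements of a band module are annihilated by some polynomial in any given element of `Λ`. -/
theorem BandModule.exists_aeval_smul_eq_zero
    (hV : Module.Finite k (RestrictScalars k (LaurentPolynomial k) V)) (a : UAlg k ρ)
    (z : BandModule k h V) :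
    ∃ g : Polynomial k, g ≠ 0 ∧ Polynomial.aeval a g • z = 0 := by
  let _ : Module k (BandModule k h V) :=
    Module.compHom (BandModule k h V) (algebraMap k (UAlg k ρ))
  have : IsScalarTower k (UAlg k ρ) (BandModule k h V) :=
    IsScalarTower.of_algebraMap_smul fun _ _ => rfl
  let _ : Module k V := Module.compHom V (algebraMap k (LaurentPolynomial k))
  have : Module.Finite k V := hV
  -- The surjection from n copies of V shows that the band module is finite-dimensional; the
  -- polynomial sought is then a minimal polynomial.
  let φ : (Fin n → V) →ₗ[k] BandModule k h V :=
    { toFun := fun v => ∑ j : Fin n, Bimodule.b k h (-(j : ℕ)) ⊗ₜ[LaurentPolynomial k] v j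
      map_add' := fun v v' => by
        rw [← Finset.sum_add_distrib]
        exact Finset.sum_congr rfl fun j _ => TensorProduct.tmul_add _ _ _
      map_smul' := fun t v => by
        rw [Finset.smul_sum]
        refine Finset.sum_congr rfl fun j _ => ?_
        have h1 : (t • v) j = (LaurentPolynomial.C t : LaurentPolynomial k) • v j := rfl
        have h2 : ∀ x : Bimodule k h, (algebraMap k (UAlg k ρ) t) • x = t • x := fun x =>
          algebraMap_smul (M := StringModule k C) (UAlg k ρ) t x
        rw [h1, ← TensorProduct.smul_tmul, Bimodule.C_smul]
        change _ = (algebraMap k (UAlg k ρ) t) • (Bimodule.b k h (-(j : ℕ)) ⊗ₜ _)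
        rw [TensorProduct.smul_tmul', h2] }
  have hφ : Function.Surjective φ := by
    intro z
    obtain ⟨v, rfl⟩ := BandModule.exists_eq_sum h z
    exact ⟨fun j => v j, (Finset.sum_range
      (fun j : ℕ => Bimodule.b k h (-(j : ℤ)) ⊗ₜ[LaurentPolynomial k] v j)).symm⟩
  have : Module.Finite k (BandModule k h V) := Module.Finite.of_surjective φ hφ
  let α : Module.End k (BandModule k h V) := Algebra.lsmul k k (BandModule k h V) a
  have hα : IsIntegral k α := Algebra.IsIntegral.isIntegral α
  refine ⟨minpoly k α, minpoly.ne_zero hα, ?_⟩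
  have h1 := minpoly.aeval k α
  have h2 : Polynomial.aeval α (minpoly k α) =
      Algebra.lsmul k k (BandModule k h V) (Polynomial.aeval a (minpoly k α)) :=
    Polynomial.aeval_algHom_apply (Algebra.lsmul k k (BandModule k h V)) a _
  rw [h1] at h2
  exact (LinearMap.congr_fun h2 z).symm

end Bands

/-! ### Primitive simples -/

section Simples

open Polynomial

variable {Q : Type v} [Quiver.{w} Q] {ρ : Set (QPath Q)} {k : Type u} [Field k] {a : Q}
  {P : Quiver.Path a a} {c : Cyc ρ} {S : Type*} [AddCommGroup S] [Module (UAlg k ρ) S]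

theorem aeval_zElt_mul_p (hρ : IsString ρ) (hP : IsPrimitiveCycle ρ P) (hc : c.Represents P)
    (g : k[X]) : aeval (zElt k ρ a) g * c.p k = aeval (c.p k) g * c.p k := by
  have h1 : ∀ e : ℕ, zElt k ρ a ^ e * c.p k = c.p k ^ e * c.p k := by
    intro e
    induction e with
    | zero => simp
    | succ e ih => rw [pow_succ', mul_assoc, ih, ← pow_succ, pow_succ', ← mul_assoc,
        zElt_mul_p k hρ hP hc, mul_assoc, mul_assoc, ← pow_succ, ← pow_succ']
  induction g using Polynomial.induction_on' with
  | add g g' hg hg' => rw [map_add, map_add, add_mul, add_mul, hg, hg']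
  | monomial e t => rw [aeval_monomial, aeval_monomial, mul_assoc, mul_assoc, h1]

theorem Cyc.Represents.idem_mul_p (hc : c.Represents P) (b : Q) :
    idem k ρ b * c.p k = if b = a then c.p k else 0 := by
  rw [← (hc.pathElt_eq k).1]
  split_ifs with h
  · subst h
    exact idem_mul_pathElt P
  · exact pathElt_mul_of_ne h

/-- On the image of a primitive cycle, primitive torsion may be computed using the cycle. -/
theorem p_smul_mem_primitiveTorsion_iff (hρ : IsString ρ) (hP : IsPrimitiveCycle ρ P)
    (hc : c.Represents P) (x : S) :
    c.p k • x ∈ primitiveTorsion k ρ S ↔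
      ∃ g : k[X], g.eval 0 = 1 ∧ aeval (c.p k) g • c.p k • x = 0 := by
  have h1 : ∀ (b : Q) (g : k[X]), aeval (zElt k ρ b) g • (idem k ρ b • c.p k • x) =
      if b = a then aeval (c.p k) g • c.p k • x else 0 := by
    intro b g
    rw [← mul_smul (idem k ρ b), hc.idem_mul_p]
    split_ifs with h
    · subst h
      rw [← mul_smul, ← mul_smul, aeval_zElt_mul_p hρ hP hc]
    · rw [zero_smul, smul_zero]
  simp only [primitiveTorsion, Set.mem_ofPred_eq, h1]
  refine exists_congr fun g => and_congr_right fun _ => ⟨fun h => ?_, fun h b => ?_⟩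
  · simpa using h a
  · rw [h, ite_self]

/-- A primitive simple on which a primitive cycle acts non-trivially has an element on which it acts
non-trivially and which is killed by an irreducible polynomial with constant term `1`. -/
theorem exists_irreducible_aeval_smul_eq_zero (hρ : IsString ρ) (hP : IsPrimitiveCycle ρ P)
    (hc : c.Represents P) (hS : primitiveTorsion k ρ S = Set.univ) {x : S} (hx : c.p k • x ≠ 0) :
    ∃ (f₁ : k[X]) (s : S), Irreducible (1 + X * f₁) ∧ c.p k • s ≠ 0 ∧
      aeval (c.p k) (1 + X * f₁) • s = 0 := by
  -- Both the polynomial and the element vary: a polynomial of least degree among all these pairs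
  -- will be irreducible.
  have hex : ∃ d : ℕ, ∃ (g : k[X]) (x : S), g.natDegree = d ∧ g.coeff 0 ≠ 0 ∧ c.p k • x ≠ 0 ∧
      aeval (c.p k) g • c.p k • x = 0 := by
    have h1 : c.p k • x ∈ primitiveTorsion k ρ S := hS ▸ Set.mem_univ _
    obtain ⟨g, hg, hgx⟩ := (p_smul_mem_primitiveTorsion_iff hρ hP hc x).1 h1
    exact ⟨_, g, x, rfl, by rw [coeff_zero_eq_eval_zero, hg]; exact one_ne_zero, hx, hgx⟩
  obtain ⟨g, y, hgd, hg0, hy, hgy⟩ := Nat.find_spec hex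
  have hmin : ∀ (g' : k[X]) (y' : S), g'.coeff 0 ≠ 0 → c.p k • y' ≠ 0 →
      aeval (c.p k) g' • c.p k • y' = 0 → g.natDegree ≤ g'.natDegree := by
    intro g' y' h1 h2 h3
    rw [hgd]
    exact Nat.find_min' hex ⟨g', y', rfl, h1, h2, h3⟩
  have hgne : g ≠ 0 := fun h => hg0 (by rw [h, coeff_zero])
  have hirr : Irreducible g := by
    refine ⟨fun hu => ?_, fun a b hab => ?_⟩
    · obtain ⟨t, ht, rfl⟩ := Polynomial.isUnit_iff.1 hu
      apply hy
      rw [aeval_C] at hgy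
      have h2 := congrArg (fun z => algebraMap k (UAlg k ρ) t⁻¹ • z) hgy
      rwa [← mul_smul, ← map_mul, inv_mul_cancel₀ ht.ne_zero, map_one, one_smul, smul_zero] at h2
    · have ha : a ≠ 0 := fun h => hgne (by rw [hab, h, zero_mul])
      have hb : b ≠ 0 := fun h => hgne (by rw [hab, h, mul_zero])
      rw [hab, mul_coeff_zero, mul_ne_zero_iff] at hg0
      have hdeg := natDegree_mul ha hb
      rw [← hab] at hdeg
      -- If a kills p y, minimality makes b constant. Otherwise b kills the non-zero element p(a y),
      -- and a is constant.
      by_cases h : aeval (c.p k) a • c.p k • y = 0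
      · right
        have := hmin a y hg0.1 hy h
        exact (isUnit_iff_degree_eq_zero).2 (by
          rw [degree_eq_natDegree hb, show b.natDegree = 0 by omega]; rfl)
      · left
        have hcomm : aeval (c.p k) a • c.p k • y = c.p k • aeval (c.p k) a • y := by
          have h1 := congrArg (aeval (c.p k)) (mul_comm a X)
          rw [map_mul, map_mul, aeval_X] at h1
          rw [← mul_smul, ← mul_smul, h1]
        rw [hcomm] at h
        have := hmin b _ hg0.2 h (by
          rw [← hcomm, ← mul_smul, ← map_mul, mul_comm, ← hab, hgy])
        exact (isUnit_iff_degree_eq_zero).2 (by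
          rw [degree_eq_natDegree ha, show a.natDegree = 0 by omega]; rfl)
  have hu : IsUnit (C (g.coeff 0)⁻¹) := isUnit_C.2 (inv_ne_zero hg0).isUnit
  have hf : C (g.coeff 0)⁻¹ * g = 1 + X * (C (g.coeff 0)⁻¹ * g).divX := by
    conv_lhs => rw [← X_mul_divX_add (C (g.coeff 0)⁻¹ * g)]
    rw [coeff_C_mul, inv_mul_cancel₀ hg0, map_one, add_comm]
  -- With s = -f₁(p) p y, the relation (1 + p f₁(p)) p y = 0 reads p s = p y ≠ 0.
  refine ⟨(C (g.coeff 0)⁻¹ * g).divX,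
    -(aeval (c.p k) (C (g.coeff 0)⁻¹ * g).divX • c.p k • y), ?_, ?_, ?_⟩
  · rw [← hf]
    exact (irreducible_isUnit_mul hu).2 hirr
  all_goals
    have hfy : aeval (c.p k) (1 + X * (C (g.coeff 0)⁻¹ * g).divX) • c.p k • y = 0 := by
      rw [← hf, map_mul, mul_smul, hgy, smul_zero]
  · have h1 : c.p k • -(aeval (c.p k) (C (g.coeff 0)⁻¹ * g).divX • c.p k • y) = c.p k • y := by
      rw [map_add, map_one, add_smul, one_smul, map_mul, aeval_X, mul_smul] at hfy
      rw [smul_neg, eq_comm]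
      exact eq_neg_of_add_eq_zero_left hfy
    rw [h1]
    exact hy
  · rw [smul_neg, ← mul_smul, ← map_mul, mul_comm, map_mul, mul_smul, hfy, smul_zero, neg_zero]

end Simples

section SimpleOfCycle

open Polynomial
open scoped TensorProduct

variable {Q : Type v} [Quiver.{w} Q] {ρ : Set (QPath Q)} {C : Word ρ} {k : Type u} [Field k] {a : Q}
  {P : Quiver.Path a a} {c : Cyc ρ}

/-! ### The simple modules given by a primitive cycle -/

theorem Word.IsBiInfinitePower.letter_eq (hC : C.IsBiInfinitePower P) (hc : c.Represents P)
    (i : ℤ) : C.letter i = some (.dir (c.X i)) := by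
  rw [hC.2, dirLetters, List.getElem?_map, hc.arrows]
  rfl

theorem Word.IsBiInfinitePower.seg_smul_b (hC : C.IsBiInfinitePower P) (hc : c.Represents P)
    (r : ℕ) : c.seg k 0 r • StringModule.b k C 0 = StringModule.b k C (-r) := by
  have h : C.Deep ⟨0, false⟩ c := fun l _ => by
    simp [Word.Good, Word.letterAt, hC.letter_eq hc, Letter.inverse]
  simpa [StringModule.bAt, Flag.pos] using StringModule.seg_smul_bAt_of_deep (k := k) h r

variable {S : Type*} [AddCommGroup S] [Module (UAlg k ρ) S]

/-- The cycle `P` acts non-trivially on `M(^∞P^∞, V)`. -/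
theorem IsSimpleOfCycle.exists_p_smul_ne_zero [Nontrivial S] (hc : c.Represents P)
    (h : IsSimpleOfCycle k ρ S P) : ∃ x : S, c.p k • x ≠ 0 := by
  obtain ⟨C, hper, V, _, _, hC, -, ⟨e⟩⟩ := h
  by_contra! h0
  have h1 : ∀ z : BandModule k hper V, c.p k • z = 0 := fun z => by
    rw [← e.apply_symm_apply z, ← map_smul, h0, map_zero]
  have hseg : ∀ (r : ℕ) (v : V), c.seg k 0 r • (Bimodule.b k hper 0 ⊗ₜ[LaurentPolynomial k] v) =
      Bimodule.b k hper (-r) ⊗ₜ v := fun r v => by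
    rw [TensorProduct.smul_tmul']
    congr 1
    exact hC.seg_smul_b hc r
  -- The cycle shifts by one period, which T⁻¹ undoes: b₀ ⊗ v = p(b₀ ⊗ T⁻¹v).
  have h2 : ∀ v : V, Bimodule.b k hper 0 ⊗ₜ[LaurentPolynomial k] v = 0 := by
    intro v
    have h3 := h1 (Bimodule.b k hper 0 ⊗ₜ[LaurentPolynomial k]
      ((LaurentPolynomial.T (-1) : LaurentPolynomial k) • v))
    rw [Cyc.p, hseg, ← TensorProduct.smul_tmul, Bimodule.T_smul_b, hc.length] at h3
    simpa using h3
  obtain ⟨x, hx⟩ := exists_ne (0 : S)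
  apply hx
  rw [← e.map_eq_zero_iff]
  obtain ⟨v, hv⟩ := BandModule.exists_eq_sum hper (e x)
  rw [hv]
  refine Finset.sum_eq_zero fun j _ => ?_
  rw [← hseg, h2, smul_zero]

/-- The homomorphism `k[T,T⁻¹] → K` which sends `T` to a unit `x`, as a module structure on `K`. -/
@[reducible]
def laurentModule {K : Type*} [CommRing K] [Algebra k K] (x : Kˣ) :
    Module (LaurentPolynomial k) K :=
  Module.compHom K (LaurentPolynomial.eval₂ (algebraMap k K) x)

theorem isSimpleModule_laurentModule {f : k[X]} [Fact (Irreducible f)] (x : (AdjoinRoot f)ˣ)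
    (hx : (x : AdjoinRoot f) = AdjoinRoot.root f) :
    @IsSimpleModule (LaurentPolynomial k) _ (AdjoinRoot f) _ (laurentModule x) := by
  let _ := laurentModule (k := k) x
  refine isSimpleModule_iff_toSpanSingleton_surjective.2 ⟨inferInstance, fun y hy z => ?_⟩
  obtain ⟨g, hg⟩ := AdjoinRoot.mk_surjective (g := f) (z * y⁻¹)
  refine ⟨toLaurent g, ?_⟩
  have h1 : LaurentPolynomial.eval₂ (algebraMap k (AdjoinRoot f)) x (toLaurent g) =
      AdjoinRoot.mk f g := by
    rw [LaurentPolynomial.eval₂_toLaurent, hx]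
    exact AdjoinRoot.aeval_eq g
  change LaurentPolynomial.eval₂ (algebraMap k (AdjoinRoot f)) x (toLaurent g) * y = z
  rw [h1, hg, mul_assoc, inv_mul_cancel₀ hy, mul_one]

/-- Take V = k[X]/(f) with T acting as X, which is a unit because X(-f₁) ≡ 1 modulo f. The map κ
sending g to g(p)s turns multiplication by X into p, so b₋ᵣ ⊗ v can be sent to the path of length r
applied to κ(v), compatibly with T. Paths separate the terms, which gives injectivity; simplicity of
S gives surjectivity. -/
theorem isSimpleOfCycle_of_p_smul_ne_zero (hρ : IsString ρ) (hP : IsPrimitiveCycle ρ P)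
    (hc : c.Represents P) [IsSimpleModule (UAlg k ρ) S] (hS : primitiveTorsion k ρ S = Set.univ)
    {x₀ : S} (hx₀ : c.p k • x₀ ≠ 0) : IsSimpleOfCycle k ρ S P := by
  obtain ⟨f₁, s, hf, hs, hfs⟩ := exists_irreducible_aeval_smul_eq_zero hρ hP hc hS hx₀
  obtain ⟨C, hC, hper⟩ := hP
  set f : k[X] := 1 + X * f₁ with hfdef
  have : Fact (Irreducible f) := ⟨hf⟩
  have hn := c.pos
  let K := AdjoinRoot f
  -- `k[T,T⁻¹]` acts on `K = k[X]/(f)`, with `T` acting as multiplication by the unit `X`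
  have hroot : AdjoinRoot.root f * AdjoinRoot.mk f (-f₁) = 1 := by
    have h1 : AdjoinRoot.mk f (1 + X * f₁) = 0 := AdjoinRoot.mk_self
    rw [map_add, map_one, map_mul, AdjoinRoot.mk_X] at h1
    rw [map_neg, mul_neg]
    exact (eq_neg_of_add_eq_zero_left h1).symm
  let x : Kˣ := ⟨AdjoinRoot.root f, AdjoinRoot.mk f (-f₁), hroot, by rw [mul_comm, hroot]⟩
  let _ : Module (LaurentPolynomial k) K := laurentModule x
  -- the homomorphism from `K` to `S` with image the submodule over `k[X]` generated by `s`
  let _ : Module k S := Module.compHom S (algebraMap k (UAlg k ρ))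
  have : IsScalarTower k (UAlg k ρ) S := IsScalarTower.of_algebraMap_smul fun _ _ => rfl
  obtain ⟨κ, hκ⟩ : ∃ κ : K →ₗ[k] S, ∀ g, κ (AdjoinRoot.mk f g) = aeval (c.p k) g • s := by
    let φ : k[X] →ₗ[k] S :=
      (LinearMap.toSpanSingleton (UAlg k ρ) S s).restrictScalars k ∘ₗ (aeval (c.p k)).toLinearMap
    have hφ : (Ideal.span {f}).restrictScalars k ≤ LinearMap.ker φ := by
      intro g hg
      obtain ⟨g', rfl⟩ := Ideal.mem_span_singleton'.1 hg
      change aeval (c.p k) (g' * f) • s = 0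
      rw [map_mul, mul_smul, hfs, smul_zero]
    exact ⟨(((Ideal.span {f}).restrictScalars k).liftQ φ hφ : _ →ₗ[k] S), fun g => rfl⟩
  have hκx : ∀ v, κ (x * v) = c.p k • κ v := fun v => by
    obtain ⟨g, rfl⟩ := AdjoinRoot.mk_surjective (g := f) v
    have : (x : K) * AdjoinRoot.mk f g = AdjoinRoot.mk f (X * g) := by
      rw [map_mul, AdjoinRoot.mk_X]
    rw [this, hκ, hκ, map_mul, aeval_X, mul_smul]
  have hκinj : ∀ v, κ v = 0 → v = 0 := fun v hv => by
    obtain ⟨g, rfl⟩ := AdjoinRoot.mk_surjective (g := f) v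
    rw [hκ] at hv
    exact AdjoinRoot.mk_eq_zero.2 (dvd_of_aeval_smul_eq_zero hf
      (fun h => hs (by rw [h, smul_zero])) hfs hv)
  have hκp : ∀ v, κ v = c.p k • κ ((x⁻¹ : Kˣ) * v) := fun v => by
    rw [← hκx, ← mul_assoc, Units.mul_inv, one_mul]
  have hsegκ : ∀ r v, c.seg k 0 r • κ v = c.seg k 0 (c.n + r) • κ ((x⁻¹ : Kˣ) * v) :=
    fun r v => by rw [hκp, c.seg_zero_add, mul_smul]
  -- the images of the basis elements
  let G₀ : ℕ → ℤ → K →ₗ[k] S := fun r e =>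
    Algebra.lsmul k k S (c.seg k 0 r) ∘ₗ κ ∘ₗ LinearMap.mulLeft k ((x ^ e : Kˣ) : K)
  have hG₀ : ∀ r e v, G₀ r e v = c.seg k 0 r • κ ((x ^ e : Kˣ) * v) := fun _ _ _ => rfl
  -- Division with remainder selects one expression l = -r - e n; `hstep` makes every expression
  -- with r ≥ 0 give the same map, which is `hG`.
  let G : ℤ → K →ₗ[k] S := fun l => G₀ ((-l) % c.n).toNat ((-l) / c.n)
  have hstep : ∀ (r j : ℕ) (e : ℤ), G₀ (r + c.n * j) (e - j) = G₀ r e := by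
    intro r j e
    induction j with
    | zero => simp
    | succ j ih =>
      rw [← ih]
      ext v
      rw [hG₀, hG₀, hsegκ (r + c.n * j), ← mul_assoc, ← Units.val_mul, ← zpow_neg_one, ← zpow_add,
        show r + c.n * (j + 1) = c.n + (r + c.n * j) by ring,
        show e - ((j + 1 : ℕ) : ℤ) = -1 + (e - j) by push_cast; ring]
  have hG : ∀ (r : ℕ) (e : ℤ), G (-r - e * c.n) = G₀ r e := by
    intro r e
    have h1 : -(-(r : ℤ) - e * c.n) = r + c.n * e := by ring
    change G₀ _ _ = _
    rw [h1, Int.add_mul_emod_self_left, Int.add_mul_ediv_left _ _ (by omega)]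
    rw [← hstep ((r : ℤ) % c.n).toNat (r / c.n) (r / c.n + e)]
    congr 1
    · have := Nat.mod_add_div r c.n
      rw [← Int.natCast_mod, Int.toNat_natCast, this]
    · push_cast
      ring
  have hGex : ∀ l : ℤ, ∃ (r : ℕ) (e : ℤ), l = -r - e * c.n := fun l => by
    have h1 := Int.emod_nonneg (-l) (show (c.n : ℤ) ≠ 0 by omega)
    refine ⟨((-l) % c.n).toNat, (-l) / c.n, ?_⟩
    have := Int.emod_add_mul_ediv (-l) c.n
    rw [Int.toNat_of_nonneg h1]
    linarith
  have hX : ∀ (r : ℕ) (e : ℤ), c.X (-r - e * c.n) = c.X (0 - r) := fun r e => by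
    rw [c.eq_iff]
    exact ⟨-e, by ring⟩
  have hmem : ∀ l, l ∈ C.shape.idx := hper.mem
  let β : StringModule k C →ₗ[k] K →ₗ[k] S := StringModule.lin C G
  have hβ : ∀ l, β (StringModule.b k C l) = G l := fun l => StringModule.lin_b C G (hmem l)
  have hβidem : ∀ v b y, β.flip v (idem k ρ b • y) = idem k ρ b • β.flip v y := by
    intro v b y
    have : β.flip v ∘ₗ (Algebra.lsmul k k _ (idem k ρ b)) =
        (Algebra.lsmul k k S (idem k ρ b)) ∘ₗ β.flip v := by
      refine StringModule.hom_ext fun l hl => ?_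
      simp only [LinearMap.comp_apply, Algebra.lsmul_coe, LinearMap.flip_apply]
      rw [StringModule.idem_smul_b b hl, hβ, C.vertex_tail _ _ (hC.letter_eq hc l)]
      obtain ⟨r, e, rfl⟩ := hGex l
      rw [hG, hG₀, hX, ← mul_smul, ← c.idem_mul_seg, ← mul_assoc]
      by_cases hb : (c.X (0 - r)).left = b
      · subst hb
        rw [if_pos (by rfl), hβ, hG, hG₀, idem_mul_self, c.idem_mul_seg]
      · rw [if_neg (by simpa [Letter.tail] using hb), idem_mul_of_ne (Ne.symm hb), zero_mul,
          zero_smul, map_zero, LinearMap.zero_apply]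
    exact LinearMap.congr_fun this y
  have hβarrow : ∀ v z y, β.flip v (arrowElt k ρ z • y) = arrowElt k ρ z • β.flip v y := by
    intro v z y
    have : β.flip v ∘ₗ (Algebra.lsmul k k _ (arrowElt k ρ z)) =
        (Algebra.lsmul k k S (arrowElt k ρ z)) ∘ₗ β.flip v := by
      refine StringModule.hom_ext fun l hl => ?_
      simp only [LinearMap.comp_apply, Algebra.lsmul_coe, LinearMap.flip_apply]
      rw [StringModule.arrowElt_smul_b z hl, hβ, hC.letter_eq hc, hC.letter_eq hc]
      obtain ⟨r, e, rfl⟩ := hGex l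
      rw [hG, hG₀, hX, ← mul_smul]
      by_cases hz : c.X (0 - r) = z
      · subst hz
        rw [if_pos rfl, hβ, ← c.seg_succ, ← hG₀, ← hG]
        congr 2
        push_cast
        ring
      · rw [if_neg (by simpa using hz), if_neg (by simp), mul_smul, hsegκ, ← mul_smul,
          c.arrowElt_mul_seg_of_ne hρ (by omega), zero_smul, map_zero, LinearMap.zero_apply]
        rw [(c.eq_iff (0 - ((c.n + r : ℕ) : ℤ)) (0 - r)).2 ⟨-1, by push_cast; ring⟩]
        exact Ne.symm hz
    exact LinearMap.congr_fun this y
  have hβA : ∀ v (b : UAlg k ρ) y, β (b • y) v = b • β y v := fun v b y =>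
    (homOfGenerators (β.flip v) (hβidem v) (hβarrow v)).map_smul b y
  -- the action of `k[T,T⁻¹]`
  have hTsmul : ∀ (t : k) (m : ℤ) (v : K), (LaurentPolynomial.C t * LaurentPolynomial.T m) • v =
      t • (((x ^ m : Kˣ) : K) * v) := fun t m v => by
    change LaurentPolynomial.eval₂ (algebraMap k K) x _ * v = _
    rw [map_mul, LaurentPolynomial.eval₂_C, LaurentPolynomial.eval₂_T, mul_assoc,
      Algebra.smul_def]
  let βb : Bimodule k hper →ₗ[k] K →ₗ[k] S := β
  have hbal : ∀ (q : LaurentPolynomial k) (y : Bimodule k hper) (v : K),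
      βb (q • y) v = βb y (q • v) := by
    intro q y v
    induction q using LaurentPolynomial.induction_on' with
    | add q q' hq hq' =>
      rw [add_smul, add_smul, map_add, map_add, ← hq, ← hq', LinearMap.add_apply]
    | C_mul_T m t =>
      rw [hTsmul, map_smul (βb y)]
      have h1 : β (shiftAct k hper m y) v = βb y ((x ^ m : Kˣ) * v) := by
        have h2 : (β.flip v) ∘ₗ shiftAct k hper m = β.flip ((x ^ m : Kˣ) * v) := by
          refine StringModule.hom_ext fun l hl => ?_
          simp only [LinearMap.comp_apply, LinearMap.flip_apply]
          rw [shiftAct_b, hβ, hβ]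
          obtain ⟨r, e, rfl⟩ := hGex l
          rw [← hc.length, show -(r : ℤ) - e * c.n - m * c.n = -r - (e + m) * c.n by ring, hG, hG,
            hG₀, hG₀, ← mul_assoc, ← Units.val_mul, ← zpow_add]
        exact LinearMap.congr_fun h2 y
      rw [← h1]
      exact (congrArg (fun z => β z v) (Bimodule.C_mul_T_smul hper t m y)).trans
        (congrArg (fun z => z v) (map_smul β t _))
  let β' : Bimodule k hper →+ K →+ S :=
    { toFun := fun y => (βb y).toAddMonoidHom
      map_zero' := by
        ext v
        exact congrArg (fun z => z v) (map_zero βb)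
      map_add' := fun y y' => by
        ext v
        exact congrArg (fun z => z v) (map_add βb y y') }
  let Ψ₀ : BandModule k hper K →+ S := TensorProduct.liftAddHom β' hbal
  have hΨ₀ : ∀ (y : Bimodule k hper) (v : K),
      Ψ₀ (y ⊗ₜ v) = βb y v := fun y v => rfl
  let Ψ : BandModule k hper K →ₗ[UAlg k ρ] S :=
    { Ψ₀ with
      map_smul' := fun b z => by
        change Ψ₀ (b • z) = b • Ψ₀ z
        induction z using TensorProduct.induction_on with
        | zero => rw [smul_zero, map_zero, smul_zero]
        | add z z' hz hz' => rw [smul_add, map_add, hz, hz', map_add, smul_add]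
        | tmul y v =>
          rw [TensorProduct.smul_tmul', hΨ₀, hΨ₀]
          exact hβA v b y }
  have hΨ : ∀ (j : ℕ) (v : K), Ψ (Bimodule.b k hper (-j) ⊗ₜ v) = c.seg k 0 j • κ v := by
    intro j v
    have h1 : Ψ (Bimodule.b k hper (-j) ⊗ₜ v) = G (-j) v := congrArg (fun z => z v) (hβ (-j))
    have h2 := hG j 0
    rw [zero_mul, sub_zero] at h2
    rw [h1, h2, hG₀, zpow_zero, Units.val_one, one_mul]
  have hinj : Function.Injective Ψ := by
    rw [injective_iff_map_eq_zero]
    intro z hz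
    obtain ⟨v, rfl⟩ := BandModule.exists_eq_sum hper z
    rw [map_sum] at hz
    refine Finset.sum_eq_zero fun j hj => ?_
    have hj' := Finset.mem_range.1 hj
    rw [← hc.length] at hj'
    suffices h : v j = 0 by rw [h, TensorProduct.tmul_zero]
    -- This path completes the term `j` to a power of the cycle and kills the others. By `hsegκ`
    -- each term is first lengthened by one turn, so that all paths involved are non-trivial.
    have h1 := congrArg (fun z => c.seg k (-j) (c.n - j) • z) hz
    simp only [hΨ, Finset.smul_sum, smul_zero] at h1
    rw [Finset.sum_eq_single j] at h1
    · rw [hsegκ, ← mul_smul, c.seg_congr (j := 0 - ((c.n + j : ℕ) : ℤ)) ⟨1, by push_cast; ring⟩,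
        ← c.seg_add, show c.n + j + (c.n - j) = c.n * (1 + 1) by omega, c.seg_mul, pow_succ,
        mul_smul, ← hκx, ← mul_assoc, Units.mul_inv, one_mul, pow_one, ← hκx] at h1
      exact (Units.mul_right_eq_zero x).1 (hκinj _ h1)
    · intro i hi hij
      have hi' := Finset.mem_range.1 hi
      rw [← hc.length] at hi'
      rw [hsegκ, ← mul_smul, c.seg_mul_seg_of_not_dvd hρ (by omega) (by omega), zero_smul]
      rintro ⟨e, he⟩
      push_cast at he
      have h2 : (c.n : ℤ) ∣ i - j := ⟨e - 1, by rw [mul_sub, ← he]; ring⟩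
      have h3 := Int.eq_zero_of_abs_lt_dvd h2 (by rw [abs_lt]; omega)
      omega
    · exact fun h => absurd hj h
  have hsurj : Function.Surjective Ψ := by
    refine LinearMap.surjective_of_ne_zero fun h0 => hs ?_
    have h1 := hΨ 0 (x : K)
    rw [h0, LinearMap.zero_apply] at h1
    have h2 : κ x = c.p k • s := by
      have := hκx 1
      rw [mul_one] at this
      rw [this, ← map_one (AdjoinRoot.mk f), hκ, map_one, one_smul]
    rw [h2, ← mul_smul, Cyc.seg, c.idem_mul_p] at h1
    exact h1.symm
  exact ⟨C, hper, K, inferInstance, inferInstance, hC, isSimpleModule_laurentModule x rfl,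
    ⟨(LinearEquiv.ofBijective Ψ ⟨hinj, hsurj⟩).symm⟩⟩

end SimpleOfCycle

section Extension

open Polynomial StringModule

variable {Q : Type v} [Quiver.{w} Q] {ρ : Set (QPath Q)} {C : Word ρ} {k : Type u} [Field k] {a : Q}
  {P : Quiver.Path a a} {c : Cyc ρ}
variable {M : Type*} [AddCommGroup M] [Module (UAlg k ρ) M] {S : Type*} [AddCommGroup S]
  [Module (UAlg k ρ) S]

/-! ### Extensions of primitive simples -/

theorem IsUnital.of_surjective (hM : IsUnital k ρ M) {π : M →ₗ[UAlg k ρ] S}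
    (hπ : Function.Surjective π) : IsUnital k ρ S := by
  rw [IsUnital, eq_top_iff, ← LinearMap.range_eq_top.2 hπ, LinearMap.range_eq_map, ← hM,
    Submodule.map_span]
  refine Submodule.span_mono ?_
  rintro _ ⟨_, ⟨b, hb, m, rfl⟩, rfl⟩
  exact ⟨b, hb, π m, map_smul _ _ _⟩

/-- Each path factors through the idempotent at its tail, and paths span Λ; if all idempotents
killed S, then ΛS = 0. -/
theorem IsUnital.exists_idem_smul_ne_zero [Nontrivial S] (hS : IsUnital k ρ S) :
    ∃ (b : Q) (x : S), idem k ρ b • x ≠ 0 := by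
  by_contra! h
  have hp : ∀ (p : QPath Q) (x : S), pathElt k ρ p • x = 0 := fun p x => by
    rw [← pathElt_mul_idem, mul_smul, h, smul_zero]
  have hL : ∀ b ∈ Lam k ρ, ∀ x : S, b • x = 0 := by
    rintro _ ⟨b, rfl⟩ x
    induction b using PathAlgebra.induction with
    | h0 => simp
    | hadd b b' hb hb' =>
      simp only at hb hb' ⊢
      rw [Unitization.inr_add, map_add, add_smul, hb, hb', add_zero]
    | hof t p =>
      simp only
      rw [Unitization.inr_smul, map_smul, ← mul_one (UAlg.mk k ρ _), ← mul_smul_comm, mul_smul]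
      exact hp p _
  obtain ⟨x, hx⟩ := exists_ne (0 : S)
  apply hx
  have h1 : x ∈ Submodule.span (UAlg k ρ) {y : S | ∃ a ∈ Lam k ρ, ∃ m : S, y = a • m} :=
    hS ▸ Submodule.mem_top
  have h2 : Submodule.span (UAlg k ρ) {y : S | ∃ a ∈ Lam k ρ, ∃ m : S, y = a • m} ≤ ⊥ := by
    rw [Submodule.span_le]
    rintro _ ⟨b, hb, m, rfl⟩
    exact hL b hb m
  exact h2 h1

/-- Some primitive cycle acts non-trivially on a non-zero unital primitive torsion module. -/
theorem exists_primitiveCycle_smul_ne_zero [Nontrivial S] (hρ : IsString ρ)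
    (hS : IsUnital k ρ S) (hτ : primitiveTorsion k ρ S = Set.univ) :
    ∃ (b : Q) (P : Quiver.Path b b) (x : S),
      IsPrimitiveCycle ρ P ∧ pathElt k ρ ⟨b, b, P⟩ • x ≠ 0 := by
  obtain ⟨b, x, hx⟩ := hS.exists_idem_smul_ne_zero
  obtain ⟨f, hf, hfx⟩ : x ∈ primitiveTorsion k ρ S := hτ ▸ Set.mem_univ x
  -- If z killed this element, a polynomial in z with constant term 1 would fix it instead of
  -- killing it.
  have h1 : zElt k ρ b • idem k ρ b • x ≠ 0 := by
    intro h0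
    have h2 := hfx b
    rw [← divX_mul_X_add f, coeff_zero_eq_eval_zero, hf, map_add, map_mul, aeval_X, C_1, map_one,
      add_smul, one_smul, mul_smul, h0, smul_zero, zero_add] at h2
    exact hx h2
  have := finite_primitiveCycles hρ b
  have := Fintype.ofFinite {P : Quiver.Path b b // IsPrimitiveCycle ρ P}
  rw [zElt, finsum_eq_sum_of_fintype, Finset.sum_smul] at h1
  obtain ⟨P, -, hP⟩ := Finset.exists_ne_zero_of_sum_ne_zero h1
  exact ⟨b, P, _, P.2, hP⟩

/-- The homomorphism is constructed with values in M from a lift of the prescribed element, and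
compared with the quotient through this lemma. -/
theorem StringModule.IsPeakHom.comp [Module k M] [IsScalarTower k (UAlg k ρ) M] {Z : Type*}
    [AddCommGroup Z] [Module k Z] [Module (UAlg k ρ) Z] [IsScalarTower k (UAlg k ρ) Z]
    {s : Flag} {t : ℕ} {x : M} {η : StringModule k C →ₗ[UAlg k ρ] M} (h : IsPeakHom s c t x η)
    (π : M →ₗ[UAlg k ρ] Z) : IsPeakHom s c t (π x) (π ∘ₗ η) where
  lt := h.lt
  good := h.good
  map_of_le l hl := by rw [LinearMap.comp_apply, h.map_of_le l hl, map_smul]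
  map_of_lt l hl hl' := by rw [LinearMap.comp_apply, h.map_of_lt l hl hl', map_zero]

/-- A summand of the kernel of `M → S` which is a string module: the obstruction to correcting the
lift `m` within this summand yields a peak and a complement. -/
theorem dvd_or_exists_isCompl [Module k M] [IsScalarTower k (UAlg k ρ) M] (hρ : IsString ρ)
    [IsSimpleModule (UAlg k ρ) S] {N₁ N₂ : Submodule (UAlg k ρ) M} (hN : Disjoint N₁ N₂)
    {π : M →ₗ[UAlg k ρ] S} (hπ : LinearMap.ker π = N₁ ⊔ N₂)
    (e : N₁ ≃ₗ[UAlg k ρ] StringModule k C) {f₁ : k[X]} (hf : Irreducible (1 + X * f₁))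
    (hfc : ∃ F : Submodule (UAlg k ρ) M, F.FG ∧ ∀ m : M, idem k ρ (c.X 0).left • m ∈ F)
    {m : M} {y : N₁} (hm : aeval (c.p k) (1 + X * f₁) • m - y ∈ N₂) (hpm : c.p k • π m ≠ 0) :
    (∃ y' : N₁, y = aeval (c.p k) (1 + X * f₁) • y') ∨
      ∃ s, C.Peak s c ∧ ∃ N : Submodule (UAlg k ρ) M, Nonempty (N ≃ₗ[UAlg k ρ] N₁) ∧
        IsCompl N N₂ := by
  let ι₀ : StringModule k C →ₗ[UAlg k ρ] M := N₁.subtype ∘ₗ e.symm.toLinearMap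
  -- Modulo N₂ the module M becomes an extension of S by M(C).
  let ι : StringModule k C →ₗ[UAlg k ρ] M ⧸ N₂ := N₂.mkQ ∘ₗ ι₀
  let q : M ⧸ N₂ →ₗ[UAlg k ρ] S := N₂.liftQ π (hπ ▸ le_sup_right)
  have hι : Function.Injective ι := by
    rw [injective_iff_map_eq_zero]
    intro z hz
    have h1 : (e.symm z : M) ∈ N₂ := (Submodule.Quotient.mk_eq_zero N₂).1 hz
    have h2 := (Submodule.disjoint_def.1 hN) _ (e.symm z).2 h1
    rwa [Submodule.coe_eq_zero, e.symm.map_eq_zero_iff] at h2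
  have hq : LinearMap.ker q = LinearMap.range ι := by
    rw [Submodule.ker_liftQ, hπ, Submodule.map_sup, Submodule.mkQ_map_self, sup_bot_eq,
      LinearMap.range_comp]
    congr 1
    rw [LinearMap.range_comp, LinearEquiv.range, Submodule.map_top, Submodule.range_subtype]
  have hm' : aeval (c.p k) (1 + X * f₁) • N₂.mkQ m = ι (e y) := by
    rw [← map_smul, ← sub_eq_zero]
    have : ι (e y) = N₂.mkQ y := by simp [ι, ι₀]
    rw [this, ← map_sub]
    exact (Submodule.Quotient.mk_eq_zero N₂).2 hm
  have hpm' : c.p k • q (N₂.mkQ m) ≠ 0 := hpm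
  by_cases hgood : ∃ s, ∀ l, C.Good s c l
  · obtain ⟨s, hs⟩ := hgood
    obtain ⟨F, hF, hFm⟩ := hfc
    refine (false_of_forall_good hρ hι hq hm' hpm' hs ⟨F.map N₂.mkQ, hF.map _, fun z => ?_⟩).elim
    obtain ⟨z, rfl⟩ := N₂.mkQ_surjective z
    exact ⟨_, hFm z, map_smul _ _ _⟩
  rcases dvd_or_exists_peak hρ hι hq hf hm' hpm' hgood with ⟨y', hy'⟩ | ⟨s, hs, x, hx⟩
  · exact Or.inl ⟨e.symm y', e.injective (by rw [hy', map_smul, e.apply_symm_apply])⟩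
  · obtain ⟨x, rfl⟩ := N₂.mkQ_surjective x
    obtain ⟨t, η, hη⟩ := exists_isPeakHom (k := k) hρ hs x
    -- A map to M that becomes an isomorphism modulo N₂ is injective, and its image is a complement
    -- of N₂.
    have hbij : Function.Bijective (N₂.mkQ ∘ₗ (ι₀ + η)) := by
      rw [LinearMap.comp_add]
      exact hx t _ (hη.comp N₂.mkQ)
    have hinj : Function.Injective (ι₀ + η) := Function.Injective.of_comp hbij.1
    refine Or.inr ⟨s, hs, LinearMap.range (ι₀ + η),
      ⟨(LinearEquiv.ofInjective _ hinj).symm.trans e.symm⟩, ?_, ?_⟩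
    · rw [Submodule.disjoint_def]
      rintro _ ⟨z, rfl⟩ hz
      have h1 : (N₂.mkQ ∘ₗ (ι₀ + η)) z = 0 := (Submodule.Quotient.mk_eq_zero N₂).2 hz
      rw [(injective_iff_map_eq_zero _).1 hbij.1 z h1, map_zero]
    · rw [codisjoint_iff, eq_top_iff]
      intro z _
      obtain ⟨w, hw⟩ := hbij.2 (N₂.mkQ z)
      refine Submodule.mem_sup.2 ⟨_, ⟨w, rfl⟩, z - (ι₀ + η) w, ?_, add_sub_cancel _ _⟩
      rw [← Submodule.Quotient.mk_eq_zero N₂, Submodule.Quotient.mk_sub, sub_eq_zero]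
      exact hw.symm

theorem exists_peak_and_isCompl (hρ : IsString ρ) [IsSimpleModule (UAlg k ρ) S]
    (hS : primitiveTorsion k ρ S = Set.univ) (hfc : IsFinitelyControlled k ρ M)
    {π : M →ₗ[UAlg k ρ] S} (hπ : Function.Surjective π)
    (hτ : primitiveTorsion k ρ M ⊆ LinearMap.ker π)
    {Φ : Type*} {N : Φ → Submodule (UAlg k ρ) M} (hind : iSupIndep N)
    (hsum : ⨆ l, N l = LinearMap.ker π)
    (hN : ∀ l, IsStringModule k ρ (N l) ∨ IsBandModule k ρ (N l))
    (hP : IsPrimitiveCycle ρ P) (hSP : IsSimpleOfCycle k ρ S P) :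
    ∃ j, (∃ C : Word ρ, Nonempty (N j ≃ₗ[UAlg k ρ] StringModule k C) ∧ ∃ i, C.IsPeak P i) ∧
      ∃ N' : Submodule (UAlg k ρ) M, Nonempty (N' ≃ₗ[UAlg k ρ] N j) ∧
        IsCompl N' (⨆ (l) (_ : l ≠ j), N l) := by
  let _ : Module k M := Module.compHom M (algebraMap k (UAlg k ρ))
  have : IsScalarTower k (UAlg k ρ) M := IsScalarTower.of_algebraMap_smul fun _ _ => rfl
  have := IsSimpleModule.nontrivial (UAlg k ρ) S
  obtain ⟨c, hc⟩ := hP.exists_cyc hρ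
  obtain ⟨x, hx⟩ := hSP.exists_p_smul_ne_zero hc
  obtain ⟨f₁, s, hf, hs, hfs⟩ := exists_irreducible_aeval_smul_eq_zero hρ hP hc hS hx
  obtain ⟨m, rfl⟩ := hπ s
  have hidem := hfc (idem k ρ (c.X 0).left) ⟨_, rfl⟩
  have hfm : aeval (c.p k) (1 + X * f₁) • m ∈ ⨆ l, N l := by
    rw [hsum, LinearMap.mem_ker, map_smul, hfs]
  obtain ⟨y, hy, hym⟩ := (Submodule.mem_iSup_iff_exists_finsupp N _).1 hfm
  by_contra! hno
  -- In the absence of a peak with a complement, the lift can be corrected in every summand: exactly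
  -- in string modules, and up to an element killed by `f'` in band modules.
  have hcorr : ∀ l, ∃ (y' : N l) (f' : k[X]), f'.eval 0 = 1 ∧
      aeval (c.p k) f' • (y l - aeval (c.p k) (1 + X * f₁) • (y' : M)) = 0 := by
    intro l
    rcases hN l with ⟨C, ⟨e⟩⟩ | ⟨C, n, h, V, _, _, hV, -, ⟨e⟩⟩
    · have hl : LinearMap.ker π = N l ⊔ ⨆ (l') (_ : l' ≠ l), N l' := by
        rw [← hsum, iSup_split_single N l]
      have hml : aeval (c.p k) (1 + X * f₁) • m - ((⟨y l, hy l⟩ : N l) : M) ∈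
          ⨆ (l') (_ : l' ≠ l), N l' := by
        rw [← hym, ← Finsupp.add_sum_erase' y l _ fun _ => rfl, add_sub_cancel_left]
        refine Submodule.sum_mem _ fun l' hl' => ?_
        rw [Finsupp.support_erase, Finset.mem_erase] at hl'
        dsimp only
        rw [Finsupp.erase_ne hl'.1]
        exact Submodule.mem_iSup_of_mem l' (Submodule.mem_iSup_of_mem hl'.1 (hy l'))
      rcases dvd_or_exists_isCompl hρ (hind l) hl e hf hidem hml hs with
        ⟨y', hy'⟩ | ⟨s, hs, N', hN'⟩
      · refine ⟨y', 1, eval_one, ?_⟩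
        have := congrArg Subtype.val hy'
        rw [map_one, one_smul, sub_eq_zero]
        exact this
      · exact (hno l ⟨C, ⟨e⟩, _, Word.isPeak_of_peak C s hc hs⟩ N' hN'.1 hN'.2).elim
    -- The cycle is algebraic on a band module, so no obstruction can arise there.
    · obtain ⟨g, hg, hgy⟩ := BandModule.exists_aeval_smul_eq_zero h hV (c.p k) (e ⟨y l, hy l⟩)
      rw [← map_smul, e.map_eq_zero_iff] at hgy
      obtain ⟨y', f', hf', hy'⟩ := exists_aeval_smul_sub_eq_zero (c.p k) f₁ hg hgy
      exact ⟨y', f', hf', congrArg Subtype.val hy'⟩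
  choose y' f' hf' hy' using hcorr
  -- the corrected lift is primitive torsion after multiplication by the cycle
  let m' : M := m - ∑ l ∈ y.support, (y' l : M)
  have hm' : aeval (c.p k) ((1 + X * f₁) * ∏ l ∈ y.support, f' l) • m' = 0 := by
    have h1 : aeval (c.p k) (1 + X * f₁) • m' =
        ∑ l ∈ y.support, (y l - aeval (c.p k) (1 + X * f₁) • (y' l : M)) := by
      rw [smul_sub, Finset.smul_sum, ← hym, Finset.sum_sub_distrib]
      rfl
    rw [mul_comm, map_mul, mul_smul, h1, Finset.smul_sum]
    refine Finset.sum_eq_zero fun l hl => ?_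
    rw [← Finset.prod_erase_mul _ _ hl, map_mul, mul_smul, hy', smul_zero]
  have hmem : c.p k • m' ∈ primitiveTorsion k ρ M := by
    refine (p_smul_mem_primitiveTorsion_iff hρ hP hc m').2
      ⟨(1 + X * f₁) * ∏ l ∈ y.support, f' l, ?_, ?_⟩
    · simp [eval_prod, hf']
    · nth_rewrite 2 [← aeval_X (R := k) (c.p k)]
      rw [← mul_smul, ← map_mul, mul_comm, map_mul, mul_smul, hm', smul_zero]
  -- Primitive torsion lies in the kernel of π, while m' and m have the same image: this contradicts
  -- p π(m) ≠ 0.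
  have h2 : c.p k • π m' = 0 := by
    rw [← map_smul]
    exact hτ hmem
  have h3 : π m' = π m := by
    have h4 : ∑ l ∈ y.support, (y' l : M) ∈ LinearMap.ker π := by
      rw [← hsum]
      exact Submodule.sum_mem _ fun l _ => Submodule.mem_iSup_of_mem l (y' l).2
    rw [map_sub, LinearMap.mem_ker.1 h4, sub_zero]
  exact hs (h3 ▸ h2)

end Extension

end StringAlg

end

theorem theoremt {k : Type*} [Field k] {Q : Type*} [Quiver Q] (ρ : Set (StringAlg.QPath Q))
    (hρ : StringAlg.IsString ρ)
    {S : Type*} [AddCommGroup S] [Module (StringAlg.UAlg k ρ) S]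
    (hS : StringAlg.IsPrimitiveSimple k ρ S)
    {M : Type*} [AddCommGroup M] [Module (StringAlg.UAlg k ρ) M]
    (hM : StringAlg.IsUnital k ρ M) (hfc : StringAlg.IsFinitelyControlled k ρ M)
    (N : Submodule (StringAlg.UAlg k ρ) M)
    (hτ : StringAlg.primitiveTorsion k ρ M ⊆ N)
    (hMN : Nonempty ((M ⧸ N) ≃ₗ[StringAlg.UAlg k ρ] S))
    {Φ : Type*} (N_ : Φ → Submodule (StringAlg.UAlg k ρ) M)
    (hind : iSupIndep N_) (hsum : ⨆ l, N_ l = N)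
    (hN : ∀ l, StringAlg.IsStringModule k ρ (N_ l) ∨ StringAlg.IsBandModule k ρ (N_ l)) :
    (∃ (a : Q) (P : Quiver.Path a a),
      StringAlg.IsPrimitiveCycle ρ P ∧ StringAlg.IsSimpleOfCycle k ρ S P) ∧
    ∀ (a : Q) (P : Quiver.Path a a),
      StringAlg.IsPrimitiveCycle ρ P → StringAlg.IsSimpleOfCycle k ρ S P →
      ∃ m : Φ,
        (∃ C : StringAlg.Word ρ,
          Nonempty (N_ m ≃ₗ[StringAlg.UAlg k ρ] StringAlg.StringModule k C) ∧
          ∃ i : ℤ, C.IsPeak P i) ∧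
        ∃ N' : Submodule (StringAlg.UAlg k ρ) M,
          Nonempty (N' ≃ₗ[StringAlg.UAlg k ρ] N_ m) ∧
          IsCompl N' (⨆ (l : Φ) (_ : l ≠ m), N_ l) := by
  obtain ⟨hSs, hSτ⟩ := hS
  obtain ⟨e⟩ := hMN
  have := IsSimpleModule.nontrivial (StringAlg.UAlg k ρ) S
  let π : M →ₗ[StringAlg.UAlg k ρ] S := e.toLinearMap ∘ₗ N.mkQ
  have hπ : Function.Surjective π := e.surjective.comp N.mkQ_surjective
  have hker : LinearMap.ker π = N := by
    rw [LinearEquiv.ker_comp, Submodule.ker_mkQ]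
  refine ⟨?_, fun a P hP hSP => ?_⟩
  · obtain ⟨a, P, x, hP, hx⟩ :=
      StringAlg.exists_primitiveCycle_smul_ne_zero hρ (hM.of_surjective hπ) hSτ
    obtain ⟨c, hc⟩ := hP.exists_cyc hρ
    rw [(hc.pathElt_eq k).1] at hx
    exact ⟨a, P, hP, StringAlg.isSimpleOfCycle_of_p_smul_ne_zero hρ hP hc hSτ hx⟩
  · exact StringAlg.exists_peak_and_isCompl hρ hSτ hfc hπ (hker ▸ hτ) hind (hsum.trans hker.symm)
      hN hP hSP
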